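/- Let $G$ be a connected semisimple linear algebraic group over $\mathbb{C}$ (for example a simple, simply connected one) with Lie algebra $\mathfrak g$, let $T\subset G$ be a maximal torus with Lie algebra $\mathfrak t$, and let $\alpha_1,\dots,\alpha_n\in\mathfrak t^*$ be a base of simple roots. For each $i$, the simple coroot $\check\alpha_i$ is the unique element of $\mathfrak t\cap[\mathfrak g_{\alpha_i},\mathfrak g_{-\alpha_i}]$ with $\alpha_i(\check\alpha_i)=2$; the simple coroots form a basis of $\mathfrak t$, and the fundamental weights $\omega_1,\dots,\omega_n\in\mathfrak t^*$ are the dual basis. Let $\rho_\lambda:G\to \mathrm{Aut}(V_\lambda)$ be an irreducible finite-dimensional algebraic representation (with highest weight $\lambda$) whose kernel is finite. Then the derivative $d\rho_\lambda:\mathfrak g\to \mathrm{End}(V_\lambda)$ is injective and $\mathrm{End}(V_\lambda)=\mathfrak g\oplus\mathfrak g^{\perp}$, where $\mathfrak g$ is identified with $d\rho_\lambda(\mathfrak g)$ and the orthogonal complement is taken for the form $\langle A,B\rangle=\mathrm{tr}(AB)$; let the Springer morphism $\theta_\lambda:G\to\mathfrak g$ be $\rho_\lambda$ followed by the projection $\mathrm{End}(V_\lambda)\to\mathfrak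 g$ along $\mathfrak g^\perp$. Let $\Lambda_\lambda$ be the set of weights of $T$ on $V_\lambda$, listed with multiplicity; write $\mu=\mu_1\omega_1+\dots+\mu_n\omega_n$ for $\mu\in\Lambda_\lambda$, and let $e^\mu$ be the corresponding character of $T$. Then for every $t\in T$ the element $\theta_\lambda(t)$ lies in $\mathfrak t$, so that $\theta_\lambda(t)=\sum_{i=1}^n c_i(t)\check\alpha_i$ for some $c_i(t)\in\mathbb C$, and the vector $(c_1(t),\dots,c_n(t))$ is the unique solution of the linear system $$\begin{pmatrix}\sum_{\mu\in\Lambda_\lambda}\mu_1\, e^\mu(t)\\ \vdots\\ \sum_{\mu\in\Lambda_\lambda}\mu_n\, e^\mu(t)\end{pmatrix}=S(G,\lambda)\begin{pmatrix}c_1(t)\\ \vdots\\ c_n(t)\end{pmatrix},\qquad S(G,\lambda)=\Big(\sum_{\mu\in\Lambda_\lambda}\mu_i\mu_j\Big)_{1\le i,j\le n}.$$ -/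

import Mathlib

open scoped Matrix

attribute [local instance] LieRing.ofAssociativeRing

noncomputable section

namespace LinAlgGroup

/-- Variables for the coordinate ring of `GL_N`: the entries of `g` (left summand) and the entries
of `g⁻¹` (right summand). -/
abbrev Vars (N : ℕ) : Type := (Fin N × Fin N) ⊕ (Fin N × Fin N)

/-- Value at `g ∈ GL_N(ℂ)` of a polynomial in the entries of `g` and `g⁻¹`. The functions
`g ↦ evalAt g F` are exactly the regular functions on the variety `GL_N`. -/
def evalAt {N : ℕ} (g : GL (Fin N) ℂ) : MvPolynomial (Vars N) ℂ →ₐ[ℂ] ℂ :=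
  MvPolynomial.aeval (Sum.elim (fun p => (g : Matrix (Fin N) (Fin N) ℂ) p.1 p.2)
    (fun p => ((g⁻¹ : GL (Fin N) ℂ) : Matrix (Fin N) (Fin N) ℂ) p.1 p.2))

/-- Zariski-closed subsets of `GL_N(ℂ)`. -/
def IsZariskiClosed {N : ℕ} (S : Set (GL (Fin N) ℂ)) : Prop :=
  ∃ E : Set (MvPolynomial (Vars N) ℂ), S = {g | ∀ F ∈ E, evalAt g F = 0}

/-- Connectedness of a subset of `GL_N(ℂ)` in the Zariski topology. -/
def IsZariskiConnected {N : ℕ} (S : Set (GL (Fin N) ℂ)) : Prop :=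
  S.Nonempty ∧ ∀ Z₁ Z₂ : Set (GL (Fin N) ℂ), IsZariskiClosed Z₁ → IsZariskiClosed Z₂ →
    S ⊆ Z₁ ∪ Z₂ → S ∩ (Z₁ ∩ Z₂) = ∅ → S ⊆ Z₁ ∨ S ⊆ Z₂

/-- The left-invariant vector field on `GL_N` with value `X` at the identity: it differentiates
along `g ↦ g (1 + ε X)`, so that `∂ g = g X` and `∂ (g⁻¹) = - X g⁻¹`. -/
def leftInvariant {N : ℕ} (X : Matrix (Fin N) (Fin N) ℂ) :
    Derivation ℂ (MvPolynomial (Vars N) ℂ) (MvPolynomial (Vars N) ℂ) :=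
  MvPolynomial.mkDerivation ℂ (Sum.elim
    (fun p => ∑ k, MvPolynomial.C (X k p.2) * MvPolynomial.X (Sum.inl (p.1, k)))
    (fun p => -∑ k, MvPolynomial.C (X p.1 k) * MvPolynomial.X (Sum.inr (k, p.2))))

theorem leftInvariant_add {N : ℕ} (X Y : Matrix (Fin N) (Fin N) ℂ) :
    leftInvariant (X + Y) = leftInvariant X + leftInvariant Y := by
  apply MvPolynomial.derivation_ext
  rintro (p | p) <;>
    simp [leftInvariant, MvPolynomial.mkDerivation_X, add_mul, Finset.sum_add_distrib]
  ring

theorem leftInvariant_smul {N : ℕ} (c : ℂ) (X : Matrix (Fin N) (Fin N) ℂ) :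
    leftInvariant (c • X) = c • leftInvariant X := by
  apply MvPolynomial.derivation_ext
  rintro (p | p) <;>
    simp [leftInvariant, MvPolynomial.mkDerivation_X, Finset.smul_sum, MvPolynomial.smul_eq_C_mul,
      mul_assoc]

theorem leftInvariant_X_inl {N : ℕ} (X : Matrix (Fin N) (Fin N) ℂ) (i j : Fin N) :
    leftInvariant X (MvPolynomial.X (Sum.inl (i, j))) =
      ∑ k, MvPolynomial.C (X k j) * MvPolynomial.X (Sum.inl (i, k)) := by
  simp [leftInvariant, MvPolynomial.mkDerivation_X]

theorem leftInvariant_X_inr {N : ℕ} (X : Matrix (Fin N) (Fin N) ℂ) (i j : Fin N) :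
    leftInvariant X (MvPolynomial.X (Sum.inr (i, j))) =
      -∑ k, MvPolynomial.C (X i k) * MvPolynomial.X (Sum.inr (k, j)) := by
  simp [leftInvariant, MvPolynomial.mkDerivation_X]

theorem leftInvariant_C_mul {N : ℕ} (X : Matrix (Fin N) (Fin N) ℂ) (c : ℂ)
    (F : MvPolynomial (Vars N) ℂ) :
    leftInvariant X (MvPolynomial.C c * F) = MvPolynomial.C c * leftInvariant X F := by
  simp [Derivation.leibniz]

theorem leftInvariant_sub {N : ℕ} (X Y : Matrix (Fin N) (Fin N) ℂ) :
    leftInvariant (X - Y) = leftInvariant X - leftInvariant Y := by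
  rw [eq_sub_iff_add_eq, ← leftInvariant_add, sub_add_cancel]

theorem leftInvariant_leftInvariant_inl {N : ℕ} (X Y : Matrix (Fin N) (Fin N) ℂ) (i j : Fin N) :
    leftInvariant X (leftInvariant Y (MvPolynomial.X (Sum.inl (i, j)))) =
      leftInvariant (X * Y) (MvPolynomial.X (Sum.inl (i, j))) := by
  simp_rw [leftInvariant_X_inl, map_sum, leftInvariant_C_mul, leftInvariant_X_inl, Finset.mul_sum,
    Matrix.mul_apply, map_sum, Finset.sum_mul, map_mul]
  rw [Finset.sum_comm]
  refine Finset.sum_congr rfl fun a _ => Finset.sum_congr rfl fun b _ => ?_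
  rw [← mul_assoc, mul_comm (MvPolynomial.C (Y b j))]

theorem leftInvariant_leftInvariant_inr {N : ℕ} (X Y : Matrix (Fin N) (Fin N) ℂ) (i j : Fin N) :
    leftInvariant X (leftInvariant Y (MvPolynomial.X (Sum.inr (i, j)))) =
      -leftInvariant (Y * X) (MvPolynomial.X (Sum.inr (i, j))) := by
  simp_rw [leftInvariant_X_inr, map_neg, map_sum, leftInvariant_C_mul, leftInvariant_X_inr,
    mul_neg, Finset.mul_sum, Matrix.mul_apply, map_sum, Finset.sum_mul, map_mul,
    Finset.sum_neg_distrib]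
  rw [Finset.sum_comm]
  refine congrArg _ (congrArg _ (Finset.sum_congr rfl fun a _ => Finset.sum_congr rfl fun b _ => ?_))
  rw [mul_assoc]

theorem leftInvariant_lie {N : ℕ} (X Y : Matrix (Fin N) (Fin N) ℂ) :
    leftInvariant ⁅X, Y⁆ = ⁅leftInvariant X, leftInvariant Y⁆ := by
  apply MvPolynomial.derivation_ext
  rintro (⟨i, j⟩ | ⟨i, j⟩)
  · rw [LieRing.of_associative_ring_bracket, leftInvariant_sub, Derivation.commutator_apply,
      leftInvariant_leftInvariant_inl, leftInvariant_leftInvariant_inl, Derivation.sub_apply]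
  · rw [LieRing.of_associative_ring_bracket, leftInvariant_sub, Derivation.commutator_apply,
      leftInvariant_leftInvariant_inr, leftInvariant_leftInvariant_inr, Derivation.sub_apply]
    abel

/-- Left translation of regular functions: `(translate g F)(x) = F (g x)`. -/
def translate {N : ℕ} (g : GL (Fin N) ℂ) :
    MvPolynomial (Vars N) ℂ →ₐ[ℂ] MvPolynomial (Vars N) ℂ :=
  MvPolynomial.aeval (Sum.elim
    (fun p => ∑ k, MvPolynomial.C ((g : Matrix (Fin N) (Fin N) ℂ) p.1 k) *
      MvPolynomial.X (Sum.inl (k, p.2)))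
    (fun p => ∑ k, MvPolynomial.C (((g⁻¹ : GL (Fin N) ℂ) : Matrix (Fin N) (Fin N) ℂ) k p.2) *
      MvPolynomial.X (Sum.inr (p.1, k))))

theorem evalAt_translate {N : ℕ} (g x : GL (Fin N) ℂ) (F : MvPolynomial (Vars N) ℂ) :
    evalAt x (translate g F) = evalAt (g * x) F := by
  have h : (evalAt x).comp (translate g) = evalAt (g * x) := by
    apply MvPolynomial.algHom_ext
    rintro (p | p)
    · simp [evalAt, translate, Matrix.mul_apply]
    · simp only [evalAt, translate, AlgHom.comp_apply, MvPolynomial.aeval_X, Sum.elim_inr, map_sum,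
        map_mul, MvPolynomial.aeval_C, mul_inv_rev, Units.val_mul, Matrix.mul_apply,
        Algebra.algebraMap_self, RingHom.id_apply]
      exact Finset.sum_congr rfl fun _ _ => mul_comm _ _
  exact DFunLike.congr_fun h F

theorem leftInvariant_translate {N : ℕ} (g : GL (Fin N) ℂ) (X : Matrix (Fin N) (Fin N) ℂ)
    (F : MvPolynomial (Vars N) ℂ) :
    leftInvariant X (translate g F) = translate g (leftInvariant X F) := by
  induction F using MvPolynomial.induction_on with
  | C a => simp [translate]
  | add p q hp hq => simp [hp, hq]
  | mul_X p i hp =>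
    have hX : leftInvariant X (translate g (MvPolynomial.X i)) =
        translate g (leftInvariant X (MvPolynomial.X i)) := by
      rcases i with p | p
      · simp only [leftInvariant, translate, MvPolynomial.mkDerivation_X, MvPolynomial.aeval_X,
          Sum.elim_inl, map_sum, map_mul, Derivation.leibniz, MvPolynomial.derivation_C,
          smul_eq_mul, mul_zero, add_zero, MvPolynomial.aeval_C, MvPolynomial.algebraMap_eq,
          Finset.mul_sum]
        rw [Finset.sum_comm]
        exact Finset.sum_congr rfl fun _ _ => Finset.sum_congr rfl fun _ _ => by ring
      · simp only [leftInvariant, translate, MvPolynomial.mkDerivation_X, MvPolynomial.aeval_X,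
          Sum.elim_inr, map_sum, map_mul, Derivation.leibniz, MvPolynomial.derivation_C,
          smul_eq_mul, mul_zero, add_zero, MvPolynomial.aeval_C, MvPolynomial.algebraMap_eq,
          Finset.mul_sum, map_neg, mul_neg, Finset.sum_neg_distrib]
        rw [Finset.sum_comm]
        refine congrArg _ (Finset.sum_congr rfl fun _ _ => Finset.sum_congr rfl fun _ _ => by ring)
    simp [hp, hX]

/-- `F` vanishes on `G`. -/
def Vanishes {N : ℕ} (G : Subgroup (GL (Fin N) ℂ)) (F : MvPolynomial (Vars N) ℂ) : Prop :=
  ∀ g ∈ G, evalAt g F = 0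

theorem vanishes_leftInvariant {N : ℕ} {G : Subgroup (GL (Fin N) ℂ)}
    {X : Matrix (Fin N) (Fin N) ℂ} (hX : ∀ F, Vanishes G F → evalAt 1 (leftInvariant X F) = 0)
    {F : MvPolynomial (Vars N) ℂ} (hF : Vanishes G F) : Vanishes G (leftInvariant X F) := by
  intro g hg
  have h := hX (translate g F) fun x hx => by
    rw [evalAt_translate]; exact hF _ (G.mul_mem hg hx)
  rwa [leftInvariant_translate, evalAt_translate, mul_one] at h

/-- The Lie algebra of a closed subgroup `G` of `GL_N(ℂ)`: the Zariski tangent space of `G` at the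
identity, i.e. the matrices whose directional derivative at `1` kills every regular function that
vanishes on `G`, with the commutator of matrices as bracket. -/
def lieAlgebra {N : ℕ} (G : Subgroup (GL (Fin N) ℂ)) :
    LieSubalgebra ℂ (Matrix (Fin N) (Fin N) ℂ) where
  carrier := {X | ∀ F, Vanishes G F → evalAt 1 (leftInvariant X F) = 0}
  add_mem' := fun hX hY F hF => by
    simp [leftInvariant_add, hX F hF, hY F hF]
  zero_mem' := fun F _ => by
    have h := leftInvariant_smul 0 (0 : Matrix (Fin N) (Fin N) ℂ)
    rw [zero_smul, zero_smul] at h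
    simp [h]
  smul_mem' := fun c X hX F hF => by
    simp [leftInvariant_smul, hX F hF]
  lie_mem' := fun {X Y} hX hY F hF => by
    simp [leftInvariant_lie, Derivation.commutator_apply, hX _ (vanishes_leftInvariant hY hF),
      hY _ (vanishes_leftInvariant hX hF)]

theorem lieAlgebra_mono {N : ℕ} {T G : Subgroup (GL (Fin N) ℂ)} (h : T ≤ G) :
    lieAlgebra T ≤ lieAlgebra G :=
  fun _ hX F hF => hX F fun g hg => hF g (h hg)

/-- `f : G → ℂ` is a regular function: the restriction to `G` of a regular function on `GL_N`. -/
def IsRegularFun {N : ℕ} (G : Subgroup (GL (Fin N) ℂ)) (f : G → ℂ) : Prop :=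
  ∃ F : MvPolynomial (Vars N) ℂ, ∀ g : G, f g = evalAt (g : GL (Fin N) ℂ) F

/-- `f : G → W` is a morphism of varieties into the finite-dimensional vector space `W`: all its
coordinates are regular functions. -/
def IsRegularMap {N : ℕ} (G : Subgroup (GL (Fin N) ℂ)) {W : Type*} [AddCommGroup W] [Module ℂ W]
    (f : G → W) : Prop :=
  ∀ φ : Module.Dual ℂ W, IsRegularFun G fun g => φ (f g)

/-- The differential at the identity of a regular function `f` on `G`, as a linear form on the Lie
algebra: differentiate any regular extension of `f` to `GL_N`. -/
def diffFun {N : ℕ} {G : Subgroup (GL (Fin N) ℂ)} {f : G → ℂ} (hf : IsRegularFun G f) :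
    lieAlgebra G →ₗ[ℂ] ℂ where
  toFun X := evalAt 1 (leftInvariant (X : Matrix (Fin N) (Fin N) ℂ) hf.choose)
  map_add' X Y := by simp [leftInvariant_add]
  map_smul' c X := by simp [leftInvariant_smul]

theorem diffFun_apply {N : ℕ} {G : Subgroup (GL (Fin N) ℂ)} {f : G → ℂ} (hf : IsRegularFun G f)
    (F : MvPolynomial (Vars N) ℂ) (hF : ∀ g : G, f g = evalAt (g : GL (Fin N) ℂ) F)
    (X : lieAlgebra G) :
    diffFun hf X = evalAt 1 (leftInvariant (X : Matrix (Fin N) (Fin N) ℂ) F) := by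
  have h := X.2 (hf.choose - F) fun g hg => by
    rw [map_sub, ← hf.choose_spec ⟨g, hg⟩, ← hF ⟨g, hg⟩, sub_self]
  rw [map_sub, map_sub, sub_eq_zero] at h
  exact h

/-- The differential at the identity `Lie G → W` of a morphism `f : G → W` into a
finite-dimensional vector space, computed in coordinates. -/
def differential {N : ℕ} {G : Subgroup (GL (Fin N) ℂ)} {W : Type*} [AddCommGroup W] [Module ℂ W]
    [FiniteDimensional ℂ W] {f : G → W} (hf : IsRegularMap G f) : lieAlgebra G →ₗ[ℂ] W :=
  ∑ i, (diffFun (hf ((Module.finBasis ℂ W).coord i))).smulRight (Module.finBasis ℂ W i)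

/-- The differential does not depend on the coordinates. -/
theorem apply_differential {N : ℕ} {G : Subgroup (GL (Fin N) ℂ)} {W : Type*} [AddCommGroup W]
    [Module ℂ W] [FiniteDimensional ℂ W] {f : G → W} (hf : IsRegularMap G f)
    (φ : Module.Dual ℂ W) (X : lieAlgebra G) :
    φ (differential hf X) = diffFun (hf φ) X := by
  classical
  set b := Module.finBasis ℂ W with hb
  have hF : ∀ g : G, φ (f g) = evalAt (g : GL (Fin N) ℂ)
      (∑ i, φ (b i) • (hf (b.coord i)).choose) := by
    intro g
    conv_lhs => rw [← b.sum_repr (f g)]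
    simp only [map_sum, map_smul]
    refine Finset.sum_congr rfl fun i _ => ?_
    rw [← (hf (b.coord i)).choose_spec g]
    simp [mul_comm]
  rw [diffFun_apply (hf φ) _ hF]
  simp [differential, diffFun, mul_comm, hb]

/-- A semisimple linear algebraic group: Zariski closed, connected, with trivial radical. -/
structure IsSemisimple {N : ℕ} (G : Subgroup (GL (Fin N) ℂ)) : Prop where
  closed : IsZariskiClosed (G : Set (GL (Fin N) ℂ))
  connected : IsZariskiConnected (G : Set (GL (Fin N) ℂ))
  radical_trivial : ∀ R : Subgroup (GL (Fin N) ℂ), R ≤ G → (R.subgroupOf G).Normal →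
    Group.IsSolvable R → IsZariskiClosed (R : Set (GL (Fin N) ℂ)) →
    IsZariskiConnected (R : Set (GL (Fin N) ℂ)) → R = ⊥

/-- A torus in `GL_N(ℂ)`: a closed connected subgroup that is simultaneously diagonalizable. -/
structure IsTorus {N : ℕ} (T : Subgroup (GL (Fin N) ℂ)) : Prop where
  closed : IsZariskiClosed (T : Set (GL (Fin N) ℂ))
  connected : IsZariskiConnected (T : Set (GL (Fin N) ℂ))
  diagonalizable : ∃ P : GL (Fin N) ℂ, ∀ t ∈ T,
    ((P * t * P⁻¹ : GL (Fin N) ℂ) : Matrix (Fin N) (Fin N) ℂ).IsDiag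

/-- `T` is a maximal torus of `G`. -/
def IsMaximalTorus {N : ℕ} (G T : Subgroup (GL (Fin N) ℂ)) : Prop :=
  Maximal (fun T' : Subgroup (GL (Fin N) ℂ) => T' ≤ G ∧ IsTorus T') T

/-- The space `𝔤_α` of `X ∈ 𝔤` with `[h, X] = α(h) X` for all `h ∈ 𝔱`. -/
def rootSpace {N : ℕ} (G T : Subgroup (GL (Fin N) ℂ)) (α : Module.Dual ℂ (lieAlgebra T)) :
    Submodule ℂ (Matrix (Fin N) (Fin N) ℂ) where
  carrier := {X | X ∈ lieAlgebra G ∧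
    ∀ h : lieAlgebra T, ⁅(h : Matrix (Fin N) (Fin N) ℂ), X⁆ = α h • X}
  add_mem' := fun hX hY => ⟨add_mem hX.1 hY.1, fun h => by rw [lie_add, hX.2, hY.2, smul_add]⟩
  zero_mem' := ⟨zero_mem _, fun h => by simp⟩
  smul_mem' := fun c X hX => ⟨(lieAlgebra G).smul_mem c hX.1, fun h => by
    rw [lie_smul, hX.2, smul_comm]⟩

/-- `α ∈ 𝔱*` is a root of `G` with respect to `T`. -/
def IsRoot {N : ℕ} (G T : Subgroup (GL (Fin N) ℂ)) (α : Module.Dual ℂ (lieAlgebra T)) : Prop :=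
  α ≠ 0 ∧ rootSpace G T α ≠ ⊥

/-- `α` enumerates a base (system of simple roots) of the root system of `(G, T)`. -/
structure IsBase {N n : ℕ} (G T : Subgroup (GL (Fin N) ℂ))
    (α : Fin n → Module.Dual ℂ (lieAlgebra T)) : Prop where
  isRoot : ∀ i, IsRoot G T (α i)
  linearIndependent : LinearIndependent ℂ α
  nonneg_or_nonpos : ∀ β, IsRoot G T β →
    ∃ m : Fin n → ℕ, β = ∑ i, m i • α i ∨ β = -∑ i, m i • α i

/-- `h` is the coroot of the root `α`: the element of `[𝔤_α, 𝔤_{-α}] ∩ 𝔱` with `α(h) = 2`. -/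
def IsCoroot {N : ℕ} (G T : Subgroup (GL (Fin N) ℂ)) (α : Module.Dual ℂ (lieAlgebra T))
    (h : lieAlgebra T) : Prop :=
  (h : Matrix (Fin N) (Fin N) ℂ) ∈
    Submodule.span ℂ {Z | ∃ X ∈ rootSpace G T α, ∃ Y ∈ rootSpace G T (-α), Z = ⁅X, Y⁆} ∧
  α h = 2

/-- The character group `X^*(T)`: regular homomorphisms `e : T → ℂˣ`. -/
def AlgChar {N : ℕ} (T : Subgroup (GL (Fin N) ℂ)) : Type :=
  {e : T →* ℂˣ // IsRegularMap T fun t => (e t : ℂ)}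

/-- The weight `μ ∈ 𝔱*` with `e^μ = e`, i.e. the differential of the character `e`. -/
def AlgChar.weight {N : ℕ} {T : Subgroup (GL (Fin N) ℂ)} (e : AlgChar T) :
    Module.Dual ℂ (lieAlgebra T) :=
  differential e.2

/-- The coordinate `μ_i` of a weight `μ = ∑ i, μ_i ω_i` in the basis of fundamental weights, where
`ω` is the basis of `𝔱*` dual to the given basis of `𝔱` (the simple coroots):
`ω_i (coroot j) = δ_{ij}`. -/
def AlgChar.coord {N n : ℕ} {T : Subgroup (GL (Fin N) ℂ)} (μ : AlgChar T)
    (coroot : Module.Basis (Fin n) ℂ (lieAlgebra T)) (i : Fin n) : ℂ :=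
  coroot.dualBasis.repr μ.weight i

section Rep

variable {N : ℕ} {G T : Subgroup (GL (Fin N) ℂ)} {V : Type*} [AddCommGroup V] [Module ℂ V]
  [FiniteDimensional ℂ V]

/-- The weight space of `V` on which `T` acts through the character `e`. -/
def weightSpace (hTG : T ≤ G) (ρ : Representation ℂ G V) (e : AlgChar T) : Submodule ℂ V where
  carrier := {v | ∀ t : T, ρ (Subgroup.inclusion hTG t) v = (e.1 t : ℂ) • v}
  add_mem' := fun hv hw t => by rw [map_add, hv t, hw t, smul_add]
  zero_mem' := fun t => by simp
  smul_mem' := fun c v hv t => by rw [map_smul, hv t, smul_comm]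

theorem finite_weights (hTG : T ≤ G) (ρ : Representation ℂ G V) :
    {e : AlgChar T | weightSpace hTG ρ e ≠ ⊥}.Finite := by
  classical
  let L : Module.Dual ℂ (Module.End ℂ V) →ₗ[ℂ] (T → ℂ) :=
    LinearMap.pi fun t => Module.Dual.eval ℂ (Module.End ℂ V) (ρ (Subgroup.inclusion hTG t))
  have key : ∀ e : {e : AlgChar T | weightSpace hTG ρ e ≠ ⊥},
      (fun t => ((e.1.1 t : ℂˣ) : ℂ)) ∈ LinearMap.range L := by
    rintro ⟨e, he⟩
    obtain ⟨v, hv, hv0⟩ := Submodule.exists_mem_ne_zero_of_ne_bot he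
    obtain ⟨φ, hφ⟩ : ∃ φ : Module.Dual ℂ V, φ v = 1 := Module.Projective.exists_dual_eq_one ℂ hv0
    refine ⟨φ.comp (LinearMap.applyₗ v), ?_⟩
    ext t
    have := hv t
    simp [L, this, hφ]
  have hli : LinearIndependent ℂ
      (fun e : {e : AlgChar T | weightSpace hTG ρ e ≠ ⊥} =>
        (⟨fun t => ((e.1.1 t : ℂˣ) : ℂ), key e⟩ : LinearMap.range L)) := by
    apply LinearIndependent.of_comp (LinearMap.range L).subtype
    have h := linearIndependent_monoidHom T ℂ
    refine h.comp (fun e : {e : AlgChar T | weightSpace hTG ρ e ≠ ⊥} =>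
      (Units.coeHom ℂ).comp e.1.1) ?_
    intro a b hab
    apply Subtype.ext
    apply Subtype.ext
    ext t
    exact DFunLike.congr_fun hab t
  have := hli.finite
  exact Set.toFinite _

/-- The finite set of weights of `V`, without multiplicities. -/
def weights (hTG : T ≤ G) (ρ : Representation ℂ G V) : Finset (AlgChar T) :=
  (finite_weights hTG ρ).toFinset

/-- The sum `∑_{μ ∈ Λ} f μ` of `f` over the weights of `V`, each weight being listed with its multiplicity
`dim V_μ`. -/
def weightSum (hTG : T ≤ G) (ρ : Representation ℂ G V) (f : AlgChar T → ℂ) : ℂ :=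
  ∑ e ∈ weights hTG ρ, Module.finrank ℂ (weightSpace hTG ρ e) • f e

/-- The invariant form `⟨A, B⟩ = tr (A B)` on `End V`. -/
def endTraceForm (V : Type*) [AddCommGroup V] [Module ℂ V] :
    LinearMap.BilinForm ℂ (Module.End ℂ V) :=
  (LinearMap.mul ℂ (Module.End ℂ V)).compr₂ (LinearMap.trace ℂ V)

/-- The image of `𝔤` in `End V` under the derivative of the representation. -/
def imageLie {ρ : Representation ℂ G V} (hρ : IsRegularMap G fun g => ρ g) :
    Submodule ℂ (Module.End ℂ V) :=
  LinearMap.range (differential hρ)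

/-- The orthogonal complement `𝔤^⊥` of `𝔤` in `End V` for the form `tr (A B)`. -/
def perpLie {ρ : Representation ℂ G V} (hρ : IsRegularMap G fun g => ρ g) :
    Submodule ℂ (Module.End ℂ V) :=
  (endTraceForm V).orthogonal (imageLie hρ)

/-- The Springer morphism `θ : G → 𝔤`: the representation `G → Aut V ⊆ End V` followed by the
projection `End V = 𝔤 ⊕ 𝔤^⊥ → 𝔤`. -/
def springer {ρ : Representation ℂ G V} (hρ : IsRegularMap G fun g => ρ g)
    (hinj : Function.Injective (differential hρ)) (hcompl : IsCompl (imageLie hρ) (perpLie hρ))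
    (g : G) : lieAlgebra G :=
  LinearMap.linearProjOfIsCompl (perpLie hρ) (differential hρ) hinj hcompl (ρ g)

end Rep

end LinAlgGroup

end

/-!
The Springer morphism is pinned down by the trace form: `θ(g)` is the element of `𝔤` with
`tr (dρ(Y) dρ(θ(g))) = tr (dρ(Y) ρ(g))` for all `Y ∈ 𝔤`. Granted that this form is nondegenerate on
`𝔤`, the rest is short. For `t ∈ T` and `h ∈ 𝔱` the operators `dρ(h)` and `ρ(t)` are simultaneously
diagonal on the weight spaces, so `[h, θ(t)]` is orthogonal to `𝔤` and vanishes; since `𝔱` is its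
own centralizer, `θ(t) ∈ 𝔱`. Pairing `θ(t) = ∑ j, c_j α̌_j` with `α̌_i`, and computing both traces
on the weight spaces, on which `dρ(α̌_i)` is multiplication by `μ_i` and `ρ(t)` by `e^μ(t)`, gives
the linear system. The weights are rational on the coroots, so for complex `x` with `S x = 0` the
sum `∑ conj x_i (S x)_i` equals `∑_μ |μ(∑ x_i α̌_i)|²`; hence `dρ(∑ x_i α̌_i) = 0` and `x = 0`. The
same computation shows that the kernel of the trace form, an ideal of `𝔤`, meets `𝔱` trivially, and
an ideal of a semisimple Lie algebra that meets a Cartan subalgebra trivially is zero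
(`eq_zero_of_endTraceForm_torusDeriv_eq_zero`, `eq_zero_of_endTraceForm_differential_eq_zero`).

Mathlib's theory of Killing Lie algebras supplies roots, coroots and the rationality of weights,
once two facts about algebraic groups over `ℂ` are available.

* `𝔤` is semisimple (`isKilling_lieAlgebra`). Regular functions on a connected group are determined
  by their invariant derivatives at the identity (`vanishes_of_leftInvariant_stable`). This is
  Cartier's argument in characteristic zero: an Euler operator built from invariant fields acts as
  `k` on `𝔪 ^ k / 𝔪 ^ (k + 1)`, so a function with vanishing derivatives lies in every `𝔪 ^ k`, and
  Krull's intersection theorem applies. Therefore an irreducible `V` stays irreducible over `𝔤`, and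
  `𝔤` acts faithfully because one-parameter groups `exp (z X)` with `X ∈ 𝔤` lie in `G`. So the
  radical of `𝔤` is central, and a central element would generate a connected closed normal
  commutative subgroup of `G`.
* `𝔱` is a Cartan subalgebra (`isCartanSubalgebra_centralizerTorus`, `mem_centralizerTorus_iff`). An
  element of the centralizer of `𝔱` in `𝔤` has its Jordan components in `𝔤`
  (`mem_lieAlgebra_of_add_mem`). The semisimple one lies in `𝔱`, since otherwise it would
  generate, together with `T`, a larger torus. The nilpotent one is then zero, as a nilpotent
  element of a Cartan subalgebra.

The weight space decomposition (`isInternal_weightSpace`) holds because the regular functions on a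
diagonalizable group are spanned by its characters, which are linearly independent.
-/

noncomputable section

namespace LinAlgGroup

/-! ### First-order expansion of regular functions at the identity -/

/-- The maximal ideal of regular functions on `GL_N` that vanish at the identity. -/
def maxIdealOne (N : ℕ) : Ideal (MvPolynomial (Vars N) ℂ) :=
  RingHom.ker (evalAt (1 : GL (Fin N) ℂ))

theorem mem_maxIdealOne {N : ℕ} {F : MvPolynomial (Vars N) ℂ} :
    F ∈ maxIdealOne N ↔ evalAt 1 F = 0 := Iff.rfl

/-- The ideal of regular functions on `GL_N` that vanish on `G`. -/
def vanishingIdeal {N : ℕ} (G : Subgroup (GL (Fin N) ℂ)) : Ideal (MvPolynomial (Vars N) ℂ) where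
  carrier := {F | Vanishes G F}
  add_mem' := fun hF hF' g hg => by rw [map_add, hF g hg, hF' g hg, add_zero]
  zero_mem' := fun g _ => map_zero _
  smul_mem' := fun c F hF g hg => by rw [smul_eq_mul, map_mul, hF g hg, mul_zero]

theorem mem_vanishingIdeal {N : ℕ} {G : Subgroup (GL (Fin N) ℂ)} {F : MvPolynomial (Vars N) ℂ} :
    F ∈ vanishingIdeal G ↔ Vanishes G F := Iff.rfl

theorem vanishingIdeal_le_maxIdealOne {N : ℕ} (G : Subgroup (GL (Fin N) ℂ)) :
    vanishingIdeal G ≤ maxIdealOne N := fun _ hF => hF 1 G.one_mem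

theorem evalAt_C {N : ℕ} (g : GL (Fin N) ℂ) (c : ℂ) : evalAt g (MvPolynomial.C c) = c := by
  simp [evalAt]

theorem evalAt_inl {N : ℕ} (g : GL (Fin N) ℂ) (p : Fin N × Fin N) :
    evalAt g (MvPolynomial.X (Sum.inl p)) = (g : Matrix (Fin N) (Fin N) ℂ) p.1 p.2 := by
  simp [evalAt]

theorem evalAt_inr {N : ℕ} (g : GL (Fin N) ℂ) (p : Fin N × Fin N) :
    evalAt g (MvPolynomial.X (Sum.inr p)) =
      ((g⁻¹ : GL (Fin N) ℂ) : Matrix (Fin N) (Fin N) ℂ) p.1 p.2 := by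
  simp [evalAt]

/-- The differential at the identity of a regular function on `GL_N`, as a linear form on
matrices. -/
def diffOne (N : ℕ) :
    MvPolynomial (Vars N) ℂ →ₗ[ℂ] Module.Dual ℂ (Matrix (Fin N) (Fin N) ℂ) where
  toFun F :=
    { toFun := fun X => evalAt 1 (leftInvariant X F)
      map_add' := fun X Y => by simp [leftInvariant_add]
      map_smul' := fun c X => by simp [leftInvariant_smul] }
  map_add' F F' := by ext; simp
  map_smul' c F := by ext; simp

theorem diffOne_apply {N : ℕ} (F : MvPolynomial (Vars N) ℂ) (X : Matrix (Fin N) (Fin N) ℂ) :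
    diffOne N F X = evalAt 1 (leftInvariant X F) := rfl

theorem diffOne_mul {N : ℕ} (F F' : MvPolynomial (Vars N) ℂ) :
    diffOne N (F * F') = evalAt 1 F • diffOne N F' + evalAt 1 F' • diffOne N F := by
  ext X : 1
  simp [diffOne_apply]

theorem diffOne_C {N : ℕ} (c : ℂ) : diffOne N (MvPolynomial.C c) = 0 := by
  ext X : 1
  simp [diffOne_apply]

theorem diffOne_inl {N : ℕ} (p : Fin N × Fin N) (X : Matrix (Fin N) (Fin N) ℂ) :
    diffOne N (MvPolynomial.X (Sum.inl p)) X = X p.1 p.2 := by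
  rw [diffOne_apply, leftInvariant_X_inl, map_sum]
  simp [evalAt_inl, Matrix.one_apply]

theorem diffOne_inr {N : ℕ} (p : Fin N × Fin N) (X : Matrix (Fin N) (Fin N) ℂ) :
    diffOne N (MvPolynomial.X (Sum.inr p)) X = -X p.1 p.2 := by
  rw [diffOne_apply, leftInvariant_X_inr, map_neg, map_sum]
  simp [evalAt_inr, Matrix.one_apply]

/-- The linear form `ℓ` on matrices as a regular function on `GL_N`. -/
def linearFun {N : ℕ} :
    Module.Dual ℂ (Matrix (Fin N) (Fin N) ℂ) →ₗ[ℂ] MvPolynomial (Vars N) ℂ where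
  toFun ℓ := ∑ i, ∑ j, MvPolynomial.C (ℓ (Matrix.single i j 1)) * MvPolynomial.X (Sum.inl (i, j))
  map_add' ℓ ℓ' := by simp [add_mul, Finset.sum_add_distrib]
  map_smul' c ℓ := by simp [Finset.smul_sum, MvPolynomial.smul_eq_C_mul, mul_assoc]

theorem dual_apply_eq_sum {N : ℕ} (ℓ : Module.Dual ℂ (Matrix (Fin N) (Fin N) ℂ))
    (A : Matrix (Fin N) (Fin N) ℂ) : ℓ A = ∑ i, ∑ j, ℓ (Matrix.single i j 1) * A i j := by
  conv_lhs => rw [Matrix.matrix_eq_sum_single A]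
  simp only [map_sum]
  refine Finset.sum_congr rfl fun i _ => Finset.sum_congr rfl fun j _ => ?_
  rw [← mul_one (A i j), ← smul_eq_mul, ← Matrix.smul_single, map_smul]
  simp [mul_comm]

theorem evalAt_linearFun {N : ℕ} (g : GL (Fin N) ℂ)
    (ℓ : Module.Dual ℂ (Matrix (Fin N) (Fin N) ℂ)) :
    evalAt g (linearFun ℓ) = ℓ (g : Matrix (Fin N) (Fin N) ℂ) := by
  rw [dual_apply_eq_sum ℓ]
  simp [linearFun, evalAt_inl]

theorem leftInvariant_linearFun {N : ℕ} (X : Matrix (Fin N) (Fin N) ℂ)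
    (ℓ : Module.Dual ℂ (Matrix (Fin N) (Fin N) ℂ)) :
    leftInvariant X (linearFun ℓ) = linearFun (ℓ ∘ₗ LinearMap.mulRight ℂ X) := by
  have h : ∀ i k : Fin N, ℓ (Matrix.single i k 1 * X) =
      ∑ j, ℓ (Matrix.single i j 1) * X k j := by
    intro i k
    rw [dual_apply_eq_sum, Finset.sum_eq_single i]
    · simp
    · intro b _ hb
      simp [Matrix.single_mul_apply_of_ne _ _ _ _ _ hb]
    · simp
  simp only [linearFun, LinearMap.coe_mk, AddHom.coe_mk, map_sum, leftInvariant_C_mul,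
    leftInvariant_X_inl, LinearMap.comp_apply, LinearMap.mulRight_apply, h, Finset.mul_sum,
    Finset.sum_mul, map_mul]
  refine Finset.sum_congr rfl fun i _ => ?_
  rw [Finset.sum_comm]
  simp only [mul_assoc]

theorem diffOne_linearFun {N : ℕ} (ℓ : Module.Dual ℂ (Matrix (Fin N) (Fin N) ℂ)) :
    diffOne N (linearFun ℓ) = ℓ := by
  ext X : 1
  rw [diffOne_apply, leftInvariant_linearFun, evalAt_linearFun]
  simp

/-- The first-order Taylor polynomial at the identity, in the entries of `g - 1`, without its
constant term. -/
def linearPart {N : ℕ} : MvPolynomial (Vars N) ℂ →ₗ[ℂ] MvPolynomial (Vars N) ℂ where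
  toFun F := linearFun (diffOne N F) - MvPolynomial.C (diffOne N F 1)
  map_add' F F' := by simp only [map_add, LinearMap.add_apply]; ring
  map_smul' c F := by
    rw [map_smul]
    simp only [map_smul, LinearMap.smul_apply, smul_eq_mul, RingHom.id_apply, smul_sub,
      MvPolynomial.smul_eq_C_mul, map_mul]

theorem linearPart_mem_maxIdealOne {N : ℕ} (F : MvPolynomial (Vars N) ℂ) :
    linearPart F ∈ maxIdealOne N := by
  rw [mem_maxIdealOne]
  simp [linearPart, evalAt_linearFun]

theorem linearPart_inl {N : ℕ} (p : Fin N × Fin N) :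
    linearPart (MvPolynomial.X (Sum.inl p) : MvPolynomial (Vars N) ℂ) =
      MvPolynomial.X (Sum.inl p) - MvPolynomial.C ((1 : Matrix (Fin N) (Fin N) ℂ) p.1 p.2) := by
  obtain ⟨a, b⟩ := p
  simp only [linearPart, linearFun, LinearMap.coe_mk, AddHom.coe_mk, diffOne_inl]
  rw [Finset.sum_eq_single a, Finset.sum_eq_single b]
  · simp
  · intro j _ hj
    simp [Matrix.single_apply_of_ne, hj]
  · simp
  · intro i _ hi
    refine Finset.sum_eq_zero fun j _ => ?_
    simp [Matrix.single_apply_of_ne, hi]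
  · simp

theorem linearPart_inr {N : ℕ} (p : Fin N × Fin N) :
    linearPart (MvPolynomial.X (Sum.inr p) : MvPolynomial (Vars N) ℂ) =
      -linearPart (MvPolynomial.X (Sum.inl p)) := by
  have h : diffOne N (MvPolynomial.X (Sum.inr p)) = -diffOne N (MvPolynomial.X (Sum.inl p)) := by
    ext X : 1
    rw [LinearMap.neg_apply, diffOne_inr, diffOne_inl]
  simp only [linearPart, LinearMap.coe_mk, AddHom.coe_mk, h, map_neg, LinearMap.neg_apply]
  ring

/-- First-order Taylor expansion at the identity. The functions `inr` are reduced to the functions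
`inl` modulo `vanishingIdeal G` because of the relation `g * g⁻¹ = 1`. -/
theorem sub_linearPart_mem {N : ℕ} (G : Subgroup (GL (Fin N) ℂ)) (F : MvPolynomial (Vars N) ℂ) :
    F - MvPolynomial.C (evalAt 1 F) - linearPart F ∈ maxIdealOne N ^ 2 ⊔ vanishingIdeal G := by
  set Q := maxIdealOne N ^ 2 ⊔ vanishingIdeal G with hQ
  have hmul : ∀ {a b}, a ∈ maxIdealOne N → b ∈ maxIdealOne N → a * b ∈ Q := fun ha hb =>
    Ideal.mem_sup_left (by rw [pow_two]; exact Ideal.mul_mem_mul ha hb)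
  have hX : ∀ i, MvPolynomial.X i - MvPolynomial.C (evalAt 1 (MvPolynomial.X i)) -
      linearPart (MvPolynomial.X i) ∈ Q := by
    rintro (⟨a, b⟩ | ⟨a, b⟩)
    · rw [linearPart_inl, evalAt_inl]
      simp
    · rw [linearPart_inr, linearPart_inl, evalAt_inr]
      -- The entries of `(g - 1) (g⁻¹ - 1) = (g g⁻¹ - 1) - (g - 1) - (g⁻¹ - 1)`.
      have h1 : (∑ k, (MvPolynomial.X (Sum.inl (a, k)) -
          MvPolynomial.C ((1 : Matrix (Fin N) (Fin N) ℂ) a k)) *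
          (MvPolynomial.X (Sum.inr (k, b)) -
          MvPolynomial.C ((1 : Matrix (Fin N) (Fin N) ℂ) k b)) : MvPolynomial (Vars N) ℂ) ∈ Q := by
        refine Ideal.sum_mem _ fun k _ => hmul ?_ ?_
        · rw [mem_maxIdealOne, map_sub, evalAt_inl, evalAt_C]; simp
        · rw [mem_maxIdealOne, map_sub, evalAt_inr, evalAt_C]; simp
      have h2 : (∑ k, MvPolynomial.X (Sum.inl (a, k)) * MvPolynomial.X (Sum.inr (k, b)) -
          MvPolynomial.C ((1 : Matrix (Fin N) (Fin N) ℂ) a b) : MvPolynomial (Vars N) ℂ) ∈ Q := by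
        refine Ideal.mem_sup_right fun g _ => ?_
        simp only [map_sub, map_sum, map_mul, evalAt_inl, evalAt_inr, evalAt_C]
        rw [← Matrix.mul_apply, ← Units.val_mul, mul_inv_cancel, Units.val_one, sub_self]
      convert Ideal.sub_mem _ h2 h1 using 1
      simp only [sub_mul, mul_sub, Finset.sum_sub_distrib, Matrix.one_apply, inv_one, Units.val_one]
      simp
      ring
  induction F using MvPolynomial.induction_on with
  | C a => simp [linearPart, diffOne_C]
  | add p q hp hq =>
    convert Ideal.add_mem _ hp hq using 1
    simp only [map_add]
    ring
  | mul_X p i hp =>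
    have hL : linearPart (p * MvPolynomial.X i) =
        MvPolynomial.C (evalAt 1 p) * linearPart (MvPolynomial.X i) +
          MvPolynomial.C (evalAt 1 (MvPolynomial.X i)) * linearPart p := by
      rw [← MvPolynomial.smul_eq_C_mul, ← MvPolynomial.smul_eq_C_mul]
      simp only [linearPart, LinearMap.coe_mk, AddHom.coe_mk, diffOne_mul, map_add, map_smul,
        LinearMap.add_apply, LinearMap.smul_apply, smul_eq_mul, map_mul, smul_sub,
        MvPolynomial.smul_eq_C_mul]
      ring
    have h1 := hmul (linearPart_mem_maxIdealOne p)
      (linearPart_mem_maxIdealOne (MvPolynomial.X i))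
    have h2 := Ideal.mul_mem_right (MvPolynomial.X i) _ hp
    have h3 := Ideal.mul_mem_left _ (MvPolynomial.C (evalAt 1 p) + linearPart p) (hX i)
    convert Ideal.add_mem _ (Ideal.add_mem _ h2 h3) h1 using 1
    rw [hL, map_mul, map_mul]
    ring

/-- A function vanishing at the identity whose differential vanishes on the Lie algebra vanishes to
second order on `G`. -/
theorem mem_sq_sup_of_diffOne_eq_zero {N : ℕ} (G : Subgroup (GL (Fin N) ℂ))
    {F : MvPolynomial (Vars N) ℂ} (hF : F ∈ maxIdealOne N)
    (h : ∀ X ∈ lieAlgebra G, diffOne N F X = 0) :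
    F ∈ maxIdealOne N ^ 2 ⊔ vanishingIdeal G := by
  set D : Submodule ℂ (Module.Dual ℂ (Matrix (Fin N) (Fin N) ℂ)) :=
    ((vanishingIdeal G).restrictScalars ℂ).map (diffOne N) with hD
  have hco : ∀ X, X ∈ D.dualCoannihilator → X ∈ lieAlgebra G := by
    intro X hX F' hF'
    exact (Submodule.mem_dualCoannihilator X).1 hX _ ⟨F', hF', rfl⟩
  have hmem : diffOne N F ∈ D := by
    rw [← Subspace.dualCoannihilator_dualAnnihilator_eq (W := D)]
    exact (Submodule.mem_dualAnnihilator _).2 fun X hX => h X (hco X hX)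
  obtain ⟨F', hF', hdF⟩ := hmem
  have h1 := sub_linearPart_mem G (F - F')
  have h2 : linearPart (F - F') = 0 := by simp [linearPart, hdF]
  rw [h2, map_sub, mem_maxIdealOne.1 hF,
    mem_maxIdealOne.1 (vanishingIdeal_le_maxIdealOne G hF'), sub_zero, sub_zero, map_zero,
    sub_zero] at h1
  simpa using Ideal.add_mem _ h1 (Ideal.mem_sup_right hF')

/-! ### A connected group is controlled by its Lie algebra -/

theorem sum_smul_derivation_apply {R A ι : Type*} [CommRing R] [CommRing A] [Algebra R A]
    (s : Finset ι) (x : ι → A) (D : ι → Derivation R A A) (F : A) :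
    (∑ i ∈ s, x i • D i) F = ∑ i ∈ s, x i * D i F := by
  rw [← Derivation.coeFnAddMonoidHom_apply, map_sum, Finset.sum_apply]
  rfl

/-- The Euler operator `E = ∑ i, x_i D_i` of local coordinates `x_i` of `G` at the identity, where
the `D_i` are the invariant vector fields of a basis of the Lie algebra dual to the `d x_i`. -/
theorem exists_euler_derivation {N : ℕ} (G : Subgroup (GL (Fin N) ℂ)) :
    ∃ E : Derivation ℂ (MvPolynomial (Vars N) ℂ) (MvPolynomial (Vars N) ℂ),
      (∀ F ∈ maxIdealOne N, E F - F ∈ maxIdealOne N ^ 2 ⊔ vanishingIdeal G) ∧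
      ∀ (J : Ideal (MvPolynomial (Vars N) ℂ)) (F : MvPolynomial (Vars N) ℂ),
        (∀ X ∈ lieAlgebra G, leftInvariant X F ∈ J) → E F ∈ maxIdealOne N * J := by
  set b := Module.finBasis ℂ (lieAlgebra G) with hb
  choose ℓ hℓ using fun i => LinearMap.exists_extend (p := (lieAlgebra G).toSubmodule) (b.coord i)
  have hℓ' : ∀ i (X : lieAlgebra G), ℓ i X = b.repr X i := fun i X =>
    DFunLike.congr_fun (hℓ i) X
  let x : Fin _ → MvPolynomial (Vars N) ℂ := fun i => linearFun (ℓ i) - MvPolynomial.C (ℓ i 1)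
  have hx : ∀ i, x i ∈ maxIdealOne N := fun i => by
    rw [mem_maxIdealOne]; simp [x, evalAt_linearFun]
  have hdx : ∀ i, diffOne N (x i) = ℓ i := fun i => by
    simp [x, diffOne_linearFun, diffOne_C]
  refine ⟨∑ i, x i • leftInvariant (b i : Matrix (Fin N) (Fin N) ℂ), fun F hF => ?_,
    fun J F hF => ?_⟩
  · have hE : (∑ i, x i • leftInvariant (b i : Matrix (Fin N) (Fin N) ℂ)) F =
        ∑ i, x i * leftInvariant (b i : Matrix (Fin N) (Fin N) ℂ) F := by
      rw [sum_smul_derivation_apply]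
    have h1 : F - ∑ i, diffOne N F (b i : Matrix (Fin N) (Fin N) ℂ) • x i ∈
        maxIdealOne N ^ 2 ⊔ vanishingIdeal G := by
      refine mem_sq_sup_of_diffOne_eq_zero G (Ideal.sub_mem _ hF (Ideal.sum_mem _ fun i _ => ?_))
        fun X hX => ?_
      · rw [MvPolynomial.smul_eq_C_mul]
        exact Ideal.mul_mem_left _ _ (hx i)
      · have h2 : X = ∑ i, b.repr ⟨X, hX⟩ i • (b i : Matrix (Fin N) (Fin N) ℂ) := by
          have h := congrArg (lieAlgebra G).toSubmodule.subtype (b.sum_repr ⟨X, hX⟩)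
          rw [map_sum] at h
          exact h.symm
        have h3 : ∀ i, ℓ i X = b.repr ⟨X, hX⟩ i := fun i => hℓ' i ⟨X, hX⟩
        rw [map_sub, map_sum, LinearMap.sub_apply, LinearMap.sum_apply]
        conv_lhs => arg 1; rw [h2]
        simp [hdx, h3, mul_comm]
    have h2 : ∑ i, x i * (leftInvariant (b i : Matrix (Fin N) (Fin N) ℂ) F -
        MvPolynomial.C (diffOne N F (b i : Matrix (Fin N) (Fin N) ℂ))) ∈
        maxIdealOne N ^ 2 ⊔ vanishingIdeal G := by
      refine Ideal.mem_sup_left (Ideal.sum_mem _ fun i _ => ?_)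
      rw [pow_two]
      refine Ideal.mul_mem_mul (hx i) ?_
      rw [mem_maxIdealOne, map_sub, evalAt_C, diffOne_apply, sub_self]
    convert Ideal.sub_mem _ h2 h1 using 1
    rw [hE]
    simp only [mul_sub, Finset.sum_sub_distrib, MvPolynomial.smul_eq_C_mul]
    simp only [mul_comm (x _) (MvPolynomial.C _)]
    ring
  · rw [sum_smul_derivation_apply]
    exact Ideal.sum_mem _ fun i _ => Ideal.mul_mem_mul (hx i) (hF _ (b i).2)

/-- An operator that behaves like the Euler operator acts as multiplication by `k` on
`𝔪 ^ k / 𝔪 ^ (k + 1)`. -/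
theorem derivation_sub_mul_mem {R A : Type*} [CommRing R] [CommRing A] [Algebra R A]
    (E : Derivation R A A) (m I : Ideal A) (hE : ∀ F ∈ m, E F - F ∈ m ^ 2 ⊔ I)
    (hm : ∀ F, E F ∈ m) (k : ℕ) : ∀ F ∈ m ^ k, E F - k * F ∈ m ^ (k + 1) ⊔ I := by
  induction k with
  | zero =>
    intro F _
    simpa using Ideal.mem_sup_left (hm F)
  | succ k ih =>
    intro F hF
    rw [pow_succ'] at hF
    refine Submodule.mul_induction_on hF (fun a ha c hc => ?_) fun F F' hF hF' => ?_
    · have h1 : (E a - a) * c ∈ m ^ (k + 1 + 1) ⊔ I := by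
        obtain ⟨u, hu, v, hv, huv⟩ := Submodule.mem_sup.1 (hE a ha)
        rw [← huv, add_mul]
        refine Ideal.add_mem _ (Ideal.mem_sup_left ?_)
          (Ideal.mem_sup_right (Ideal.mul_mem_right _ _ hv))
        rw [show k + 1 + 1 = 2 + k by ring, pow_add]
        exact Ideal.mul_mem_mul hu hc
      have h2 : a * (E c - k * c) ∈ m ^ (k + 1 + 1) ⊔ I := by
        obtain ⟨u, hu, v, hv, huv⟩ := Submodule.mem_sup.1 (ih c hc)
        rw [← huv, mul_add]
        refine Ideal.add_mem _ (Ideal.mem_sup_left ?_)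
          (Ideal.mem_sup_right (Ideal.mul_mem_left _ _ hv))
        rw [pow_succ' _ (k + 1)]
        exact Ideal.mul_mem_mul ha hu
      have h3 : E (a * c) - (k + 1 : ℕ) * (a * c) = (E a - a) * c + a * (E c - k * c) := by
        rw [Derivation.leibniz, smul_eq_mul, smul_eq_mul, Nat.cast_add, Nat.cast_one]
        ring
      rw [h3]
      exact Ideal.add_mem _ h1 h2
    · have h3 : E (F + F') - (k + 1 : ℕ) * (F + F') =
          (E F - (k + 1 : ℕ) * F) + (E F' - (k + 1 : ℕ) * F') := by
        rw [map_add]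
        ring
      rw [h3]
      exact Ideal.add_mem _ hF hF'

/-- In characteristic zero a function on `G` all of whose iterated invariant derivatives vanish at
the identity vanishes there to infinite order: the Euler operator acts as multiplication by `k` on
`𝔪 ^ k / 𝔪 ^ (k + 1)`. -/
theorem le_pow_sup_vanishingIdeal {N : ℕ} (G : Subgroup (GL (Fin N) ℂ))
    (J : Ideal (MvPolynomial (Vars N) ℂ)) (hJ : J ≤ maxIdealOne N)
    (hD : ∀ X ∈ lieAlgebra G, ∀ F ∈ J, leftInvariant X F ∈ J) (k : ℕ) :
    J ≤ maxIdealOne N ^ k ⊔ vanishingIdeal G := by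
  obtain ⟨E, hE, hEJ⟩ := exists_euler_derivation G
  have hEI : ∀ F ∈ vanishingIdeal G, E F ∈ vanishingIdeal G := by
    intro F hF
    have h := hEJ (vanishingIdeal G) F fun X hX => by
      rw [mem_vanishingIdeal]
      exact vanishes_leftInvariant hX hF
    have hle : maxIdealOne N * vanishingIdeal G ≤ vanishingIdeal G := Ideal.mul_le_right
    exact hle h
  have hEm : ∀ F, E F ∈ maxIdealOne N := by
    intro F
    have h : E F ∈ maxIdealOne N * ⊤ := hEJ ⊤ F (fun X _ => Submodule.mem_top)
    rwa [Ideal.mul_top] at h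
  have hpow := derivation_sub_mul_mem E (maxIdealOne N) (vanishingIdeal G) hE hEm
  induction k with
  | zero => simp
  | succ k ih =>
    rcases Nat.eq_zero_or_pos k with rfl | hk
    · simpa using hJ.trans le_sup_left
    intro F hF
    have h1 : E F ∈ maxIdealOne N ^ (k + 1) ⊔ vanishingIdeal G := by
      have h2 := Ideal.mul_mono_right (I := maxIdealOne N) ih
        (hEJ J F fun X hX => hD X hX F hF)
      rw [Ideal.mul_sup, ← pow_succ'] at h2
      have hle : maxIdealOne N * vanishingIdeal G ≤ vanishingIdeal G := Ideal.mul_le_right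
      exact sup_le_sup_left hle _ h2
    obtain ⟨u, hu, v, hv, huv⟩ := Submodule.mem_sup.1 (ih hF)
    have h3 : E F - k * F ∈ maxIdealOne N ^ (k + 1) ⊔ vanishingIdeal G := by
      rw [← huv]
      have h4 : E (u + v) - k * (u + v) = (E u - k * u) + (E v - k * v) := by
        rw [map_add]
        ring
      rw [h4]
      exact Ideal.add_mem _ (hpow k u hu) (Ideal.mem_sup_right (Ideal.sub_mem _ (hEI v hv)
        (Ideal.mul_mem_left _ _ hv)))
    have h4 : (k : MvPolynomial (Vars N) ℂ) * F ∈
        maxIdealOne N ^ (k + 1) ⊔ vanishingIdeal G := by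
      simpa using Ideal.sub_mem _ h1 h3
    -- in characteristic zero `k` is invertible
    have h5 := Ideal.mul_mem_left _ (MvPolynomial.C ((k : ℂ)⁻¹)) h4
    rwa [← mul_assoc, ← map_natCast (MvPolynomial.C (R := ℂ)) k, ← map_mul,
      inv_mul_cancel₀ (Nat.cast_ne_zero.2 hk.ne'), map_one, one_mul] at h5

/-- By Krull's intersection theorem, an ideal of functions stable under invariant derivatives and
vanishing at the identity vanishes on a Zariski neighbourhood of the identity in `G`. -/
theorem exists_evalAt_one_mul_mem_vanishingIdeal {N : ℕ} (G : Subgroup (GL (Fin N) ℂ))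
    (J : Ideal (MvPolynomial (Vars N) ℂ)) (hJ : J ≤ maxIdealOne N)
    (hD : ∀ X ∈ lieAlgebra G, ∀ F ∈ J, leftInvariant X F ∈ J) :
    ∃ u : MvPolynomial (Vars N) ℂ, evalAt 1 u = 1 ∧ ∀ F ∈ J, u * F ∈ vanishingIdeal G := by
  have hloc : ∀ F ∈ J, ∃ u : MvPolynomial (Vars N) ℂ,
      evalAt 1 u = 1 ∧ u * F ∈ vanishingIdeal G := by
    intro F hF
    have h1 : (Submodule.Quotient.mk F : MvPolynomial (Vars N) ℂ ⧸ vanishingIdeal G) ∈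
        (⨅ i : ℕ, maxIdealOne N ^ i • ⊤ :
          Submodule (MvPolynomial (Vars N) ℂ) (MvPolynomial (Vars N) ℂ ⧸ vanishingIdeal G)) := by
      refine (Submodule.mem_iInf _).2 fun k => ?_
      obtain ⟨u, hu, v, hv, huv⟩ :=
        Submodule.mem_sup.1 (le_pow_sup_vanishingIdeal G J hJ hD k hF)
      have h2 : (Submodule.Quotient.mk F : MvPolynomial (Vars N) ℂ ⧸ vanishingIdeal G) =
          u • Submodule.Quotient.mk 1 := by
        rw [← Submodule.Quotient.mk_smul, Submodule.Quotient.eq, ← huv]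
        simpa using hv
      rw [h2]
      exact Submodule.smul_mem_smul hu trivial
    obtain ⟨⟨r, hr⟩, hrF⟩ := (Ideal.mem_iInf_smul_pow_eq_bot_iff _ _).1 h1
    refine ⟨1 - r, by rw [map_sub, map_one, mem_maxIdealOne.1 hr, sub_zero], ?_⟩
    rw [← Submodule.Quotient.mk_smul, Submodule.Quotient.eq] at hrF
    simpa [sub_mul] using Ideal.neg_mem_iff _ |>.2 hrF
  classical
  obtain ⟨S, hS⟩ := IsNoetherian.noetherian J
  choose! u hu huF using hloc
  refine ⟨∏ F ∈ S, u F, ?_, fun F hF => ?_⟩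
  · rw [map_prod]
    exact Finset.prod_eq_one fun F hF => hu F (hS ▸ Submodule.subset_span hF)
  · rw [← hS] at hF
    induction hF using Submodule.span_induction with
    | mem F hF =>
      rw [← Finset.prod_erase_mul _ _ hF, mul_assoc]
      exact Ideal.mul_mem_left _ _ (huF F (hS ▸ Submodule.subset_span hF))
    | zero => simp
    | add F F' _ _ h h' => rw [mul_add]; exact Ideal.add_mem _ h h'
    | smul c F _ h =>
      rw [smul_eq_mul, mul_left_comm]
      exact Ideal.mul_mem_left _ _ h

/-- The ideal generated by a set stable under a derivation is stable. -/
theorem leftInvariant_mem_span {N : ℕ} (X : Matrix (Fin N) (Fin N) ℂ)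
    {W : Set (MvPolynomial (Vars N) ℂ)} (hW : ∀ F ∈ W, leftInvariant X F ∈ W)
    {F : MvPolynomial (Vars N) ℂ} (hF : F ∈ Ideal.span W) : leftInvariant X F ∈ Ideal.span W := by
  induction hF using Submodule.span_induction with
  | mem F hF => exact Submodule.subset_span (hW F hF)
  | zero => simp
  | add F F' _ _ h h' => rw [map_add]; exact Ideal.add_mem _ h h'
  | smul c F hF h =>
    rw [smul_eq_mul, Derivation.leibniz, smul_eq_mul, smul_eq_mul]
    exact Ideal.add_mem _ (Ideal.mul_mem_left _ _ h) (Ideal.mul_mem_right _ _ hF)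

/-- A set of regular functions that is stable under the invariant derivatives along the Lie algebra
of a connected group `G` and vanishes at the identity vanishes on `G`. In other words, `G` is
determined by its infinitesimal neighbourhood of the identity. -/
theorem vanishes_of_leftInvariant_stable {N : ℕ} {G : Subgroup (GL (Fin N) ℂ)}
    (hG : IsZariskiConnected (G : Set (GL (Fin N) ℂ))) (W : Set (MvPolynomial (Vars N) ℂ))
    (hD : ∀ X ∈ lieAlgebra G, ∀ F ∈ W, leftInvariant X F ∈ W)
    (h1 : ∀ F ∈ W, evalAt 1 F = 0) : ∀ F ∈ W, Vanishes G F := by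
  -- Near every point `g` of `G` at which `W` vanishes, `W` vanishes identically.
  have hloc : ∀ g ∈ G, (∀ F ∈ W, evalAt g F = 0) → ∃ u : MvPolynomial (Vars N) ℂ,
      evalAt g u = 1 ∧ ∀ F ∈ W, Vanishes G (u * F) := by
    intro g hg hgW
    obtain ⟨u, hu, huF⟩ := exists_evalAt_one_mul_mem_vanishingIdeal G
      (Ideal.span (translate g '' W)) (by
        rw [Ideal.span_le]
        rintro _ ⟨F, hF, rfl⟩
        rw [SetLike.mem_coe, mem_maxIdealOne, evalAt_translate, mul_one]
        exact hgW F hF) (fun X hX F hF => leftInvariant_mem_span X (by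
          rintro _ ⟨F, hF, rfl⟩
          exact ⟨_, hD X hX F hF, (leftInvariant_translate g X F).symm⟩) hF)
    refine ⟨translate g⁻¹ u, by rw [evalAt_translate, inv_mul_cancel, hu], fun F hF x hx => ?_⟩
    have := huF _ (Ideal.subset_span ⟨F, hF, rfl⟩) (g⁻¹ * x) (G.mul_mem (G.inv_mem hg) hx)
    rwa [map_mul, evalAt_translate, mul_inv_cancel_left, ← evalAt_translate, ← map_mul] at this
  -- `G` is covered by the zeros of `W` and the zeros of the functions `u` with `u W = 0` on `G`.
  -- By the local statement these two closed sets do not meet in `G`.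
  have hcover := hG.2 {g | ∀ F ∈ W, evalAt g F = 0}
    {g | ∀ u ∈ {u : MvPolynomial (Vars N) ℂ | ∀ F ∈ W, Vanishes G (u * F)}, evalAt g u = 0}
    ⟨W, rfl⟩ ⟨_, rfl⟩ (fun g hg => by
      by_contra hcon
      rw [Set.mem_union, not_or] at hcon
      obtain ⟨h2, h3⟩ := hcon
      simp only [Set.mem_ofPred_eq, not_forall] at h2 h3
      obtain ⟨F, hF, hFg⟩ := h2
      obtain ⟨u, hu, hug⟩ := h3
      have := hu F hF g hg
      rw [map_mul, mul_eq_zero] at this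
      tauto) (by
      rw [Set.eq_empty_iff_forall_notMem]
      rintro g ⟨hg, hgW, hgu⟩
      obtain ⟨u, hu, huF⟩ := hloc g hg hgW
      exact one_ne_zero (hu.symm.trans (hgu u huF)))
  rcases hcover with h | h
  · exact fun F hF g hg => h hg F hF
  · obtain ⟨u, hu, huF⟩ := hloc 1 G.one_mem h1
    exact absurd (hu.symm.trans (h G.one_mem u huF)) one_ne_zero

/-- A subspace of matrices that contains the identity and is stable under right multiplication by
the Lie algebra of a connected group contains the group. -/
theorem coe_mem_of_mul_mem {N : ℕ} {G : Subgroup (GL (Fin N) ℂ)}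
    (hG : IsZariskiConnected (G : Set (GL (Fin N) ℂ)))
    (U : Submodule ℂ (Matrix (Fin N) (Fin N) ℂ)) (h1 : 1 ∈ U)
    (hU : ∀ X ∈ lieAlgebra G, ∀ A ∈ U, A * X ∈ U) {g : GL (Fin N) ℂ} (hg : g ∈ G) :
    (g : Matrix (Fin N) (Fin N) ℂ) ∈ U := by
  rw [← Subspace.dualAnnihilator_dualCoannihilator_eq (W := U), Submodule.mem_dualCoannihilator]
  intro ℓ hℓ
  rw [← evalAt_linearFun]
  refine vanishes_of_leftInvariant_stable hG (linearFun '' (U.dualAnnihilator : Set _)) ?_ ?_ _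
    ⟨ℓ, hℓ, rfl⟩ g hg
  · rintro X hX _ ⟨ℓ, hℓ, rfl⟩
    refine ⟨_, ?_, (leftInvariant_linearFun X ℓ).symm⟩
    exact (Submodule.mem_dualAnnihilator _).2 fun A hA =>
      (Submodule.mem_dualAnnihilator _).1 hℓ _ (hU X hX A hA)
  · rintro _ ⟨ℓ, hℓ, rfl⟩
    rw [evalAt_linearFun]
    exact (Submodule.mem_dualAnnihilator _).1 hℓ _ h1

/-- A matrix commuting with the Lie algebra of a connected group commutes with the group. -/
theorem commute_of_commute_lieAlgebra {N : ℕ} {G : Subgroup (GL (Fin N) ℂ)}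
    (hG : IsZariskiConnected (G : Set (GL (Fin N) ℂ))) {A : Matrix (Fin N) (Fin N) ℂ}
    (hA : ∀ X ∈ lieAlgebra G, Commute A X) {g : GL (Fin N) ℂ} (hg : g ∈ G) :
    Commute A (g : Matrix (Fin N) (Fin N) ℂ) := by
  have h := coe_mem_of_mul_mem hG (Subalgebra.centralizer ℂ {A}).toSubmodule
    (Subalgebra.one_mem _) (fun X hX B hB => Subalgebra.mul_mem _ hB
      ((Subalgebra.mem_centralizer_iff ℂ).2 fun _ h => by rw [h]; exact hA X hX)) hg
  exact (Subalgebra.mem_centralizer_iff ℂ).1 h A rfl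

/-! ### One-parameter subgroups -/

/-- The exponential of a matrix, as an element of `GL_N`. -/
def expGL {N : ℕ} (X : Matrix (Fin N) (Fin N) ℂ) : GL (Fin N) ℂ where
  val := NormedSpace.exp X
  inv := NormedSpace.exp (-X)
  val_inv := by
    rw [← Matrix.exp_add_of_commute _ _ (Commute.refl X).neg_right, add_neg_cancel,
      NormedSpace.exp_zero]
  inv_val := by
    rw [← Matrix.exp_add_of_commute _ _ (Commute.refl X).neg_left, neg_add_cancel,
      NormedSpace.exp_zero]

theorem coe_expGL {N : ℕ} (X : Matrix (Fin N) (Fin N) ℂ) :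
    (expGL X : Matrix (Fin N) (Fin N) ℂ) = NormedSpace.exp X := rfl

theorem coe_expGL_inv {N : ℕ} (X : Matrix (Fin N) (Fin N) ℂ) :
    ((expGL X)⁻¹ : GL (Fin N) ℂ) = (NormedSpace.exp (-X) : Matrix (Fin N) (Fin N) ℂ) := rfl

theorem expGL_zero {N : ℕ} : expGL (0 : Matrix (Fin N) (Fin N) ℂ) = 1 := by
  ext1
  rw [coe_expGL, NormedSpace.exp_zero, Units.val_one]

theorem expGL_zero_smul {N : ℕ} (X : Matrix (Fin N) (Fin N) ℂ) : expGL ((0 : ℂ) • X) = 1 := by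
  rw [zero_smul, expGL_zero]

theorem expGL_add_smul {N : ℕ} (X : Matrix (Fin N) (Fin N) ℂ) (z w : ℂ) :
    expGL ((z + w) • X) = expGL (z • X) * expGL (w • X) := by
  ext1
  rw [Units.val_mul, coe_expGL, coe_expGL, coe_expGL, add_smul, Matrix.exp_add_of_commute]
  exact ((Commute.refl X).smul_left z).smul_right w

/-- The one-parameter group `z ↦ exp (z X)`. -/
def oneParam {N : ℕ} (X : Matrix (Fin N) (Fin N) ℂ) : Multiplicative ℂ →* GL (Fin N) ℂ where
  toFun z := expGL (z.toAdd • X)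
  map_one' := expGL_zero_smul X
  map_mul' _ _ := expGL_add_smul X _ _

theorem commute_expGL {N : ℕ} {X : Matrix (Fin N) (Fin N) ℂ} {g : GL (Fin N) ℂ}
    (h : Commute X (g : Matrix (Fin N) (Fin N) ℂ)) (z : ℂ) : Commute (expGL (z • X)) g := by
  let _ : NormedRing (Matrix (Fin N) (Fin N) ℂ) := Matrix.linftyOpNormedRing
  let _ : NormedAlgebra ℂ (Matrix (Fin N) (Fin N) ℂ) := Matrix.linftyOpNormedAlgebra
  refine Units.ext ?_
  have h' : Commute (NormedSpace.exp (z • X)) (g : Matrix (Fin N) (Fin N) ℂ) :=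
    (h.smul_left z).exp_left
  exact h'

theorem hasDerivAt_exp_apply {N : ℕ} (X : Matrix (Fin N) (Fin N) ℂ) (i j : Fin N) (z : ℂ) :
    HasDerivAt (fun z : ℂ => NormedSpace.exp (z • X) i j)
      ((NormedSpace.exp (z • X) * X) i j) z := by
  let _ : NormedRing (Matrix (Fin N) (Fin N) ℂ) := Matrix.linftyOpNormedRing
  let _ : NormedAlgebra ℂ (Matrix (Fin N) (Fin N) ℂ) := Matrix.linftyOpNormedAlgebra
  exact
    (LinearMap.toContinuousLinearMap (Matrix.entryLinearMap ℂ ℂ i j)).hasFDerivAt.comp_hasDerivAt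
    z (hasDerivAt_exp_smul_const X z)

theorem exp_smul_mul_comm {N : ℕ} (X : Matrix (Fin N) (Fin N) ℂ) (z : ℂ) :
    NormedSpace.exp (z • X) * X = X * NormedSpace.exp (z • X) := by
  let _ : NormedRing (Matrix (Fin N) (Fin N) ℂ) := Matrix.linftyOpNormedRing
  let _ : NormedAlgebra ℂ (Matrix (Fin N) (Fin N) ℂ) := Matrix.linftyOpNormedAlgebra
  exact ((Commute.refl X).smul_left z).exp_left

theorem hasDerivAt_evalAt_expGL {N : ℕ} (X : Matrix (Fin N) (Fin N) ℂ)
    (F : MvPolynomial (Vars N) ℂ) (z : ℂ) :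
    HasDerivAt (fun z : ℂ => evalAt (expGL (z • X)) F)
      (evalAt (expGL (z • X)) (leftInvariant X F)) z := by
  induction F using MvPolynomial.induction_on with
  | C a => simpa [evalAt_C] using hasDerivAt_const z a
  | add p q hp hq =>
    simp only [map_add]
    exact hp.add hq
  | mul_X p i hp =>
    have hX : HasDerivAt (fun z : ℂ => evalAt (expGL (z • X)) (MvPolynomial.X i))
        (evalAt (expGL (z • X)) (leftInvariant X (MvPolynomial.X i))) z := by
      rcases i with ⟨a, b⟩ | ⟨a, b⟩
      · simp only [leftInvariant_X_inl, map_sum, map_mul, evalAt_C, evalAt_inl, coe_expGL]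
        convert hasDerivAt_exp_apply X a b z using 1
        rw [Matrix.mul_apply]
        exact Finset.sum_congr rfl fun _ _ => mul_comm _ _
      · simp only [leftInvariant_X_inr, map_sum, map_mul, map_neg, evalAt_C, evalAt_inr,
          coe_expGL_inv, ← smul_neg]
        convert hasDerivAt_exp_apply (-X) a b z using 1
        rw [exp_smul_mul_comm, Matrix.mul_apply]
        simp
    have h := hp.mul hX
    simp only [map_mul, Derivation.leibniz, map_add, smul_eq_mul]
    rw [add_comm, mul_comm (evalAt _ (MvPolynomial.X i))]
    exact h

theorem hasDerivAt_evalAt_mul_expGL {N : ℕ} (g : GL (Fin N) ℂ) (X : Matrix (Fin N) (Fin N) ℂ)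
    (F : MvPolynomial (Vars N) ℂ) (z : ℂ) :
    HasDerivAt (fun z : ℂ => evalAt (g * expGL (z • X)) F)
      (evalAt (g * expGL (z • X)) (leftInvariant X F)) z := by
  simpa only [← evalAt_translate, leftInvariant_translate] using
    hasDerivAt_evalAt_expGL X (translate g F) z

theorem differentiable_evalAt_mul_expGL {N : ℕ} (g : GL (Fin N) ℂ)
    (X : Matrix (Fin N) (Fin N) ℂ) (F : MvPolynomial (Vars N) ℂ) :
    Differentiable ℂ fun z : ℂ => evalAt (g * expGL (z • X)) F :=
  fun z => (hasDerivAt_evalAt_mul_expGL g X F z).differentiableAt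

/-- A regular function all of whose derivatives along `X` vanish at `1` vanishes on the
one-parameter group of `X`, by Taylor expansion. -/
theorem evalAt_expGL_eq_zero {N : ℕ} (X : Matrix (Fin N) (Fin N) ℂ) (F : MvPolynomial (Vars N) ℂ)
    (h : ∀ n : ℕ, evalAt 1 ((leftInvariant X)^[n] F) = 0) (z : ℂ) :
    evalAt (expGL (z • X)) F = 0 := by
  have hd : ∀ n : ℕ, iteratedDeriv n (fun z : ℂ => evalAt (expGL (z • X)) F) =
      fun z => evalAt (expGL (z • X)) ((leftInvariant X)^[n] F) := by
    intro n
    induction n with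
    | zero => simp
    | succ n ih =>
      ext z
      rw [iteratedDeriv_succ, ih, Function.iterate_succ_apply']
      exact (hasDerivAt_evalAt_expGL X _ z).deriv
  have hdiff : Differentiable ℂ fun z : ℂ => evalAt (expGL (z • X)) F :=
    fun z => (hasDerivAt_evalAt_expGL X F z).differentiableAt
  rw [← Complex.taylorSeries_eq_of_entire' 0 z hdiff]
  simp [hd, expGL_zero, h]

/-- The one-parameter groups of the Lie algebra of a closed group lie in the group. -/
theorem expGL_mem {N : ℕ} {G : Subgroup (GL (Fin N) ℂ)}
    (hG : IsZariskiClosed (G : Set (GL (Fin N) ℂ))) {X : Matrix (Fin N) (Fin N) ℂ}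
    (hX : X ∈ lieAlgebra G) (z : ℂ) : expGL (z • X) ∈ G := by
  obtain ⟨E, hE⟩ := hG
  rw [← SetLike.mem_coe, hE]
  intro F hF
  have hF' : Vanishes G F := fun g hg => by
    rw [← SetLike.mem_coe, hE] at hg
    exact hg F hF
  refine evalAt_expGL_eq_zero X F (fun n => ?_) z
  suffices Vanishes G ((leftInvariant X)^[n] F) from this 1 G.one_mem
  induction n with
  | zero => exact hF'
  | succ n ih =>
    rw [Function.iterate_succ_apply']
    exact vanishes_leftInvariant hX ih

theorem mem_lieAlgebra_of_expGL_mem {N : ℕ} {G : Subgroup (GL (Fin N) ℂ)}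
    {X : Matrix (Fin N) (Fin N) ℂ} (h : ∀ z : ℂ, expGL (z • X) ∈ G) : X ∈ lieAlgebra G := by
  intro F hF
  have h1 := hasDerivAt_evalAt_expGL X F 0
  have h2 : (fun z : ℂ => evalAt (expGL (z • X)) F) = fun _ => 0 := funext fun z => hF _ (h z)
  rw [h2, expGL_zero_smul] at h1
  exact h1.unique (hasDerivAt_const _ _)

/-- A matrix is zero if its one-parameter group takes finitely many values. -/
theorem eq_zero_of_finite_range_expGL {N : ℕ} {X : Matrix (Fin N) (Fin N) ℂ}
    (h : (Set.range fun z : ℂ => expGL (z • X)).Finite) : X = 0 := by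
  ext i j
  have h1 := hasDerivAt_evalAt_expGL X (MvPolynomial.X (Sum.inl (i, j))) 0
  set f : ℂ → ℂ := fun z => evalAt (expGL (z • X)) (MvPolynomial.X (Sum.inl (i, j))) with hf
  have hfin : (Set.range f).Finite :=
    (h.image fun g => evalAt g (MvPolynomial.X (Sum.inl (i, j)))).subset (by
      rintro _ ⟨z, rfl⟩
      exact ⟨_, ⟨z, rfl⟩, rfl⟩)
  have hcont : Continuous f := by
    have : Differentiable ℂ f :=
      fun z => (hasDerivAt_evalAt_expGL X (MvPolynomial.X (Sum.inl (i, j))) z).differentiableAt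
    exact this.continuous
  have hconst : ∀ z, f z = f 0 := fun z => by
    by_contra hne
    exact (isPreconnected_range hcont).infinite_of_nontrivial ⟨f z, ⟨z, rfl⟩, f 0, ⟨0, rfl⟩, hne⟩
      hfin
  rw [expGL_zero_smul, ← diffOne_apply, diffOne_inl] at h1
  rw [show f = fun _ => f 0 from funext hconst] at h1
  exact h1.unique (hasDerivAt_const _ _)

/-- Left translates of one-parameter groups are irreducible. -/
theorem forall_mul_expGL_mem_or {N : ℕ} (g : GL (Fin N) ℂ) (X : Matrix (Fin N) (Fin N) ℂ)
    {Z₁ Z₂ : Set (GL (Fin N) ℂ)} (h₁ : IsZariskiClosed Z₁) (h₂ : IsZariskiClosed Z₂)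
    (h : ∀ z : ℂ, g * expGL (z • X) ∈ Z₁ ∪ Z₂) :
    (∀ z : ℂ, g * expGL (z • X) ∈ Z₁) ∨ ∀ z : ℂ, g * expGL (z • X) ∈ Z₂ := by
  obtain ⟨E₁, rfl⟩ := h₁
  obtain ⟨E₂, rfl⟩ := h₂
  by_contra hcon
  rw [not_or] at hcon
  obtain ⟨hc₁, hc₂⟩ := hcon
  simp only [Set.mem_ofPred_eq, not_forall] at hc₁ hc₂
  obtain ⟨z₁, F₁, hF₁, hz₁⟩ := hc₁
  obtain ⟨z₂, F₂, hF₂, hz₂⟩ := hc₂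
  have := AnalyticOnNhd.eq_zero_or_eq_zero_of_mul_eq_zero (U := Set.univ)
    (fun z _ => (differentiable_evalAt_mul_expGL g X F₁).analyticAt z)
    (fun z _ => (differentiable_evalAt_mul_expGL g X F₂).analyticAt z) (fun z _ => by
      rcases h z with h | h
      · rw [h F₁ hF₁, zero_mul]
      · rw [h F₂ hF₂, mul_zero]) isPreconnected_univ
  rcases this with h | h
  · exact hz₁ (h z₁ trivial)
  · exact hz₂ (h z₂ trivial)

/-! ### Zariski closures of subgroups -/

/-- The regular function `g ↦ F (g⁻¹)`. -/
theorem evalAt_rename_swap {N : ℕ} (g : GL (Fin N) ℂ) (F : MvPolynomial (Vars N) ℂ) :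
    evalAt g (MvPolynomial.rename Sum.swap F) = evalAt g⁻¹ F := by
  rw [evalAt, MvPolynomial.aeval_rename, evalAt]
  congr 2
  ext (p | p) <;> simp

/-- The Zariski closure of a subgroup of `GL_N`. -/
def zariskiClosure {N : ℕ} (S : Subgroup (GL (Fin N) ℂ)) : Subgroup (GL (Fin N) ℂ) :=
  have hinv : ∀ {g : GL (Fin N) ℂ}, (∀ F, Vanishes S F → evalAt g F = 0) →
      ∀ F, Vanishes S F → evalAt g⁻¹ F = 0 := fun {g} hg F hF => by
    rw [← evalAt_rename_swap]
    refine hg _ fun s hs => ?_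
    rw [evalAt_rename_swap]
    exact hF _ (S.inv_mem hs)
  have hmul : ∀ {s g : GL (Fin N) ℂ}, s ∈ S → (∀ F, Vanishes S F → evalAt g F = 0) →
      ∀ F, Vanishes S F → evalAt (s * g) F = 0 := fun {s g} hs hg F hF => by
    rw [← evalAt_translate]
    refine hg _ fun s' hs' => ?_
    rw [evalAt_translate]
    exact hF _ (S.mul_mem hs hs')
  { carrier := {g | ∀ F, Vanishes S F → evalAt g F = 0}
    one_mem' := fun F hF => hF 1 S.one_mem
    inv_mem' := hinv
    mul_mem' := fun {a b} ha hb F hF => by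
      rw [← evalAt_translate]
      refine hb _ fun s hs => ?_
      rw [evalAt_translate, ← inv_inv (a * s), mul_inv_rev, ← evalAt_rename_swap]
      refine hmul (S.inv_mem hs) (hinv ha) _ fun s' hs' => ?_
      rw [evalAt_rename_swap]
      exact hF _ (S.inv_mem hs') }

theorem le_zariskiClosure {N : ℕ} (S : Subgroup (GL (Fin N) ℂ)) : S ≤ zariskiClosure S :=
  fun _ hg _ hF => hF _ hg

theorem isZariskiClosed_zariskiClosure {N : ℕ} (S : Subgroup (GL (Fin N) ℂ)) :
    IsZariskiClosed (zariskiClosure S : Set (GL (Fin N) ℂ)) :=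
  ⟨{F | Vanishes S F}, rfl⟩

theorem zariskiClosure_subset {N : ℕ} {S : Subgroup (GL (Fin N) ℂ)} {Z : Set (GL (Fin N) ℂ)}
    (hZ : IsZariskiClosed Z) (h : (S : Set (GL (Fin N) ℂ)) ⊆ Z) :
    (zariskiClosure S : Set (GL (Fin N) ℂ)) ⊆ Z := by
  obtain ⟨E, rfl⟩ := hZ
  exact fun g hg F hF => hg F fun s hs => h hs F hF

/-- The condition that `g` lies in a linear subspace of matrices is closed. -/
theorem isZariskiClosed_coe_mem {N : ℕ} (U : Submodule ℂ (Matrix (Fin N) (Fin N) ℂ)) :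
    IsZariskiClosed {g : GL (Fin N) ℂ | (g : Matrix (Fin N) (Fin N) ℂ) ∈ U} := by
  refine ⟨linearFun '' (U.dualAnnihilator : Set _), ?_⟩
  ext g
  rw [Set.mem_ofPred_eq, Set.mem_ofPred_eq,
    ← Subspace.dualAnnihilator_dualCoannihilator_eq (W := U), Submodule.mem_dualCoannihilator]
  simp [evalAt_linearFun]

theorem commute_of_mem_zariskiClosure {N : ℕ} {S : Subgroup (GL (Fin N) ℂ)} {h g : GL (Fin N) ℂ}
    (hS : ∀ s ∈ S, Commute h s) (hg : g ∈ zariskiClosure S) : Commute h g := by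
  have := zariskiClosure_subset (S := S) (isZariskiClosed_coe_mem
    (Subalgebra.centralizer ℂ {(h : Matrix (Fin N) (Fin N) ℂ)}).toSubmodule) (fun s hs => by
      refine (Subalgebra.mem_centralizer_iff ℂ).2 ?_
      rintro _ rfl
      exact congrArg Units.val (hS s hs)) hg
  exact Units.ext ((Subalgebra.mem_centralizer_iff ℂ).1 this _ rfl)

/-- If `S` is the product of a connected set `T` and a one-parameter group, its closure is
connected. -/
theorem isZariskiConnected_zariskiClosure {N : ℕ} {S T : Subgroup (GL (Fin N) ℂ)}
    (hT : IsZariskiConnected (T : Set (GL (Fin N) ℂ))) (X : Matrix (Fin N) (Fin N) ℂ)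
    (hS : ∀ g, g ∈ S ↔ ∃ t ∈ T, ∃ z : ℂ, g = t * expGL (z • X)) :
    IsZariskiConnected (zariskiClosure S : Set (GL (Fin N) ℂ)) := by
  refine ⟨⟨1, one_mem _⟩, fun Z₁ Z₂ h₁ h₂ hsub hdisj => ?_⟩
  have hmem : ∀ t ∈ T, ∀ z : ℂ, t * expGL (z • X) ∈ zariskiClosure S := fun t ht z =>
    le_zariskiClosure S ((hS _).2 ⟨t, ht, z, rfl⟩)
  have hTS : (T : Set (GL (Fin N) ℂ)) ⊆ zariskiClosure S := fun t ht => by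
    simpa [expGL_zero] using hmem t ht 0
  have key : ∀ {Z Z' : Set (GL (Fin N) ℂ)}, IsZariskiClosed Z → IsZariskiClosed Z' →
      (zariskiClosure S : Set (GL (Fin N) ℂ)) ⊆ Z ∪ Z' →
      (zariskiClosure S : Set (GL (Fin N) ℂ)) ∩ (Z ∩ Z') = ∅ →
      (T : Set (GL (Fin N) ℂ)) ⊆ Z → (zariskiClosure S : Set (GL (Fin N) ℂ)) ⊆ Z := by
    intro Z Z' hZ hZ' hsub hdisj hTZ
    refine zariskiClosure_subset hZ fun g hg => ?_
    obtain ⟨t, ht, z, rfl⟩ := (hS g).1 hg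
    rcases forall_mul_expGL_mem_or t X hZ hZ' fun z => hsub (hmem t ht z) with h | h
    · exact h z
    · have h0 := h 0
      rw [expGL_zero_smul, mul_one] at h0
      exact (Set.eq_empty_iff_forall_notMem.1 hdisj t ⟨hTS ht, hTZ ht, h0⟩).elim
  rcases hT.2 Z₁ Z₂ h₁ h₂ (hTS.trans hsub) (Set.subset_eq_empty
    (Set.inter_subset_inter_left _ hTS) hdisj) with h | h
  · exact Or.inl (key h₁ h₂ hsub hdisj h)
  · exact Or.inr (key h₂ h₁ (by rwa [Set.union_comm]) (by rwa [Set.inter_comm Z₂]) h)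

theorem isZariskiConnected_bot {N : ℕ} :
    IsZariskiConnected ((⊥ : Subgroup (GL (Fin N) ℂ)) : Set (GL (Fin N) ℂ)) := by
  refine ⟨⟨1, one_mem _⟩, fun Z₁ Z₂ _ _ h _ => ?_⟩
  simpa using h

/-! ### The Lie algebra of a semisimple group has trivial center -/

/-- The closure of the one-parameter group of a central element lies in the radical. -/
theorem eq_zero_of_commute_lieAlgebra {N : ℕ} {G : Subgroup (GL (Fin N) ℂ)} (hG : IsSemisimple G)
    {X : Matrix (Fin N) (Fin N) ℂ} (hX : X ∈ lieAlgebra G)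
    (hc : ∀ Y ∈ lieAlgebra G, Commute X Y) : X = 0 := by
  set R := zariskiClosure (oneParam X).range with hR
  have hRG : R ≤ G := zariskiClosure_subset hG.closed (by
    rintro _ ⟨z, rfl⟩
    exact expGL_mem hG.closed hX _)
  have hcomm : ∀ g ∈ G, ∀ r ∈ R, Commute g r := fun g hg r hr => by
    refine commute_of_mem_zariskiClosure ?_ hr
    rintro _ ⟨z, rfl⟩
    exact (commute_expGL (commute_of_commute_lieAlgebra hG.connected hc hg) _).symm
  have hbot : R = ⊥ := by
    refine hG.radical_trivial R hRG ⟨fun r hr g => ?_⟩ ?_ (isZariskiClosed_zariskiClosure _)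
      (isZariskiConnected_zariskiClosure isZariskiConnected_bot X fun g => ?_)
    · rw [Subgroup.mem_subgroupOf] at hr ⊢
      have : (g * r * g⁻¹ : G) = r := by
        rw [mul_inv_eq_iff_eq_mul]
        exact Subtype.ext (hcomm g g.2 r hr)
      rwa [this]
    · exact Group.isSolvable_of_comm fun a b =>
        Subtype.ext (hcomm a (hRG a.2) b b.2)
    · simp only [MonoidHom.mem_range, Subgroup.mem_bot, exists_eq_left, one_mul]
      exact ⟨fun ⟨z, hz⟩ => ⟨z.toAdd, hz.symm⟩, fun ⟨z, hz⟩ => ⟨Multiplicative.ofAdd z, hz.symm⟩⟩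
  refine eq_zero_of_finite_range_expGL ((Set.finite_singleton (1 : GL (Fin N) ℂ)).subset ?_)
  rintro _ ⟨z, rfl⟩
  have h : expGL (z • X) ∈ R := le_zariskiClosure _ ⟨Multiplicative.ofAdd z, rfl⟩
  rwa [hbot, Subgroup.mem_bot] at h

/-! ### Maximal tori -/

theorem commute_of_isDiag_conj {N : ℕ} (P : GL (Fin N) ℂ) {A B : Matrix (Fin N) (Fin N) ℂ}
    (hA : ((P : Matrix (Fin N) (Fin N) ℂ) * A *
      ((P⁻¹ : GL (Fin N) ℂ) : Matrix (Fin N) (Fin N) ℂ)).IsDiag)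
    (hB : ((P : Matrix (Fin N) (Fin N) ℂ) * B *
      ((P⁻¹ : GL (Fin N) ℂ) : Matrix (Fin N) (Fin N) ℂ)).IsDiag) : Commute A B := by
  have h1 : Commute ((P : Matrix (Fin N) (Fin N) ℂ) * A *
      ((P⁻¹ : GL (Fin N) ℂ) : Matrix (Fin N) (Fin N) ℂ)) ((P : Matrix (Fin N) (Fin N) ℂ) * B *
      ((P⁻¹ : GL (Fin N) ℂ) : Matrix (Fin N) (Fin N) ℂ)) := by
    rw [← (Matrix.isDiag_iff_diagonal_diag _).1 hA, ← (Matrix.isDiag_iff_diagonal_diag _).1 hB]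
    exact Matrix.commute_diagonal _ _
  have h2 := congrArg (fun M => ((P⁻¹ : GL (Fin N) ℂ) : Matrix (Fin N) (Fin N) ℂ) * M * P) h1.eq
  have h3 : A * B = B * A := by
    simpa only [mul_assoc, Units.inv_mul_cancel_left, Units.inv_mul, mul_one] using h2
  exact h3

/-- The matrices `A` such that `P A P⁻¹` is diagonal. -/
def diagonalConj {N : ℕ} (P : GL (Fin N) ℂ) : Submodule ℂ (Matrix (Fin N) (Fin N) ℂ) where
  carrier := {A | ((P : Matrix (Fin N) (Fin N) ℂ) * A *
    ((P⁻¹ : GL (Fin N) ℂ) : Matrix (Fin N) (Fin N) ℂ)).IsDiag}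
  add_mem' := fun {A B} hA hB => by
    rw [Set.mem_ofPred_eq, mul_add, add_mul]
    exact Matrix.IsDiag.add hA hB
  zero_mem' := by simp [Matrix.isDiag_zero]
  smul_mem' := fun c A hA => by
    rw [Set.mem_ofPred_eq, mul_smul_comm, smul_mul_assoc]
    exact Matrix.IsDiag.smul c hA

/-- The Lie algebra of a maximal torus `T` of `G` contains every element of the Lie algebra of `G`
that is simultaneously diagonalizable with `T`. -/
theorem mem_lieAlgebra_of_isMaximalTorus {N : ℕ} {G T : Subgroup (GL (Fin N) ℂ)}
    (hG : IsZariskiClosed (G : Set (GL (Fin N) ℂ))) (hT : IsMaximalTorus G T)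
    {X : Matrix (Fin N) (Fin N) ℂ} (hX : X ∈ lieAlgebra G) (P : GL (Fin N) ℂ)
    (hPT : ∀ t ∈ T, ((P * t * P⁻¹ : GL (Fin N) ℂ) : Matrix (Fin N) (Fin N) ℂ).IsDiag)
    (hPX : ((P : Matrix (Fin N) (Fin N) ℂ) * X *
      ((P⁻¹ : GL (Fin N) ℂ) : Matrix (Fin N) (Fin N) ℂ)).IsDiag) : X ∈ lieAlgebra T := by
  have hcomm : ∀ t ∈ T, Commute X (t : Matrix (Fin N) (Fin N) ℂ) := by
    intro t ht
    have h1 := hPT t ht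
    rw [Units.val_mul, Units.val_mul] at h1
    exact commute_of_isDiag_conj P hPX h1
  -- the closure of `T · exp (ℂ X)` is a torus of `G`
  let S : Subgroup (GL (Fin N) ℂ) :=
    { carrier := {g | ∃ t ∈ T, ∃ z : ℂ, g = t * expGL (z • X)}
      one_mem' := ⟨1, T.one_mem, 0, by rw [expGL_zero_smul, mul_one]⟩
      mul_mem' := by
        rintro _ _ ⟨t, ht, z, rfl⟩ ⟨t', ht', z', rfl⟩
        refine ⟨t * t', T.mul_mem ht ht', z + z', ?_⟩
        rw [expGL_add_smul, mul_assoc, mul_assoc, ← mul_assoc t', ← mul_assoc _ t',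
          (commute_expGL (hcomm t' ht') z).eq]
      inv_mem' := by
        rintro _ ⟨t, ht, z, rfl⟩
        refine ⟨t⁻¹, T.inv_mem ht, -z, ?_⟩
        rw [mul_inv_rev, ← mul_one (t⁻¹ * _), ← mul_inv_cancel (expGL (z • X)), mul_assoc t⁻¹,
          ← mul_assoc _ (expGL (z • X)), ← expGL_add_smul, neg_add_cancel, expGL_zero_smul, one_mul,
          ← (commute_expGL (hcomm t ht) z).inv_inv.eq] }
  have hS : ∀ g, g ∈ S ↔ ∃ t ∈ T, ∃ z : ℂ, g = t * expGL (z • X) := fun g => Iff.rfl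
  let U := diagonalConj P
  have hSU : (S : Set (GL (Fin N) ℂ)) ⊆ {g | (g : Matrix (Fin N) (Fin N) ℂ) ∈ U} := by
    rintro _ ⟨t, ht, z, rfl⟩
    have h1 := hPT t ht
    rw [Units.val_mul, Units.val_mul] at h1
    have h2 : ((P : Matrix (Fin N) (Fin N) ℂ) * NormedSpace.exp (z • X) *
        ((P⁻¹ : GL (Fin N) ℂ) : Matrix (Fin N) (Fin N) ℂ)).IsDiag := by
      rw [← Matrix.exp_units_conj, mul_smul_comm, smul_mul_assoc,
        ← (Matrix.isDiag_iff_diagonal_diag _).1 (hPX.smul z), Matrix.exp_diagonal]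
      exact Matrix.isDiag_diagonal _
    have h3 : (P : Matrix (Fin N) (Fin N) ℂ) * (t * NormedSpace.exp (z • X)) *
        ((P⁻¹ : GL (Fin N) ℂ) : Matrix (Fin N) (Fin N) ℂ) =
        (P * t * ((P⁻¹ : GL (Fin N) ℂ) : Matrix (Fin N) (Fin N) ℂ)) *
        (P * NormedSpace.exp (z • X) * ((P⁻¹ : GL (Fin N) ℂ) : Matrix (Fin N) (Fin N) ℂ)) := by
      simp only [mul_assoc, Units.inv_mul_cancel_left]
    change (_ * ((t : Matrix (Fin N) (Fin N) ℂ) * NormedSpace.exp (z • X)) * _).IsDiag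
    rw [h3, ← (Matrix.isDiag_iff_diagonal_diag _).1 h1, ← (Matrix.isDiag_iff_diagonal_diag _).1 h2,
      Matrix.diagonal_mul_diagonal]
    exact Matrix.isDiag_diagonal _
  have htorus : IsTorus (zariskiClosure S) :=
    { closed := isZariskiClosed_zariskiClosure S
      connected := isZariskiConnected_zariskiClosure hT.prop.2.connected X hS
      diagonalizable := ⟨P, fun t ht => by
        rw [Units.val_mul, Units.val_mul]
        exact zariskiClosure_subset (isZariskiClosed_coe_mem U) hSU ht⟩ }
  have hSG : zariskiClosure S ≤ G := zariskiClosure_subset hG (by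
    rintro _ ⟨t, ht, z, rfl⟩
    exact G.mul_mem (hT.prop.1 ht) (expGL_mem hG hX z))
  have hTS : T ≤ zariskiClosure S := fun t ht => le_zariskiClosure S
    ⟨t, ht, 0, by rw [expGL_zero_smul, mul_one]⟩
  refine mem_lieAlgebra_of_expGL_mem fun z => ?_
  exact hT.le_of_ge ⟨hSG, htorus⟩ hTS (le_zariskiClosure S ⟨1, T.one_mem, z, by rw [one_mul]⟩)

/-! ### The derivative of a representation -/

section Derivative

variable {N : ℕ} {G : Subgroup (GL (Fin N) ℂ)} {V : Type*} [AddCommGroup V] [Module ℂ V]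
  [FiniteDimensional ℂ V] {ρ : Representation ℂ G V}

theorem dual_eq_iff {W : Type*} [AddCommGroup W] [Module ℂ W] {a b : W} :
    a = b ↔ ∀ φ : Module.Dual ℂ W, φ a = φ b := by
  rw [← sub_eq_zero, ← Module.forall_dual_apply_eq_zero_iff ℂ]
  simp only [map_sub, sub_eq_zero]

/-- The invariant derivative along `X` of a matrix coefficient of `ρ` at an arbitrary point. -/
theorem evalAt_leftInvariant_rep (hρ : IsRegularMap G fun g => ρ g)
    (φ : Module.Dual ℂ (Module.End ℂ V)) {F : MvPolynomial (Vars N) ℂ}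
    (hF : ∀ g : G, φ (ρ g) = evalAt (g : GL (Fin N) ℂ) F) (X : lieAlgebra G) (g : G) :
    evalAt (g : GL (Fin N) ℂ) (leftInvariant (X : Matrix (Fin N) (Fin N) ℂ) F) =
      φ (ρ g * differential hρ X) := by
  have h1 : ∀ x : G, (φ ∘ₗ LinearMap.mulLeft ℂ (ρ g)) (ρ x) =
      evalAt (x : GL (Fin N) ℂ) (translate g F) := fun x => by
    rw [evalAt_translate, ← Subgroup.coe_mul, ← hF, map_mul]
    rfl
  have h2 := apply_differential hρ (φ ∘ₗ LinearMap.mulLeft ℂ (ρ g)) X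
  rw [diffFun_apply _ _ h1, leftInvariant_translate, evalAt_translate, mul_one] at h2
  exact h2.symm

theorem differential_lie (hρ : IsRegularMap G fun g => ρ g) (X Y : lieAlgebra G) :
    differential hρ ⁅X, Y⁆ = ⁅differential hρ X, differential hρ Y⁆ := by
  rw [dual_eq_iff]
  intro φ
  obtain ⟨F, hF⟩ := hρ φ
  have key : ∀ X Y : lieAlgebra G, evalAt 1 (leftInvariant (X : Matrix (Fin N) (Fin N) ℂ)
      (leftInvariant (Y : Matrix (Fin N) (Fin N) ℂ) F)) =
      φ (differential hρ X * differential hρ Y) := by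
    intro X Y
    have h := evalAt_leftInvariant_rep hρ (φ ∘ₗ LinearMap.mulRight ℂ (differential hρ Y))
      (F := leftInvariant (Y : Matrix (Fin N) (Fin N) ℂ) F)
      (fun g => (evalAt_leftInvariant_rep hρ φ hF Y g).symm) X 1
    rw [Subgroup.coe_one, map_one, one_mul] at h
    exact h
  have h := evalAt_leftInvariant_rep hρ φ hF ⁅X, Y⁆ 1
  rw [Subgroup.coe_one, map_one, one_mul, LieSubalgebra.coe_bracket, leftInvariant_lie,
    Derivation.commutator_apply, map_sub, key, key, ← map_sub] at h
  exact h.symm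

/-- The derivative of a representation, as a homomorphism of Lie algebras. -/
def derivRep (hρ : IsRegularMap G fun g => ρ g) : lieAlgebra G →ₗ⁅ℂ⁆ Module.End ℂ V :=
  { differential hρ with map_lie' := fun {X Y} => differential_lie hρ X Y }

/-- A representation of a closed group with finite kernel has injective derivative: if the
derivative kills `X`, the kernel contains the one-parameter group of `X`. -/
theorem injective_differential (hG : IsZariskiClosed (G : Set (GL (Fin N) ℂ)))
    (hρ : IsRegularMap G fun g => ρ g) (hker : (MonoidHom.ker ρ : Set G).Finite) :
    Function.Injective (differential hρ) := by
  rw [← LinearMap.ker_eq_bot, LinearMap.ker_eq_bot']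
  intro X hX
  refine Subtype.ext (eq_zero_of_finite_range_expGL
    ((hker.image ((↑) : G → GL (Fin N) ℂ)).subset ?_))
  rintro _ ⟨z, rfl⟩
  refine ⟨⟨_, expGL_mem hG X.2 z⟩, ?_, rfl⟩
  rw [SetLike.mem_coe, MonoidHom.mem_ker, dual_eq_iff]
  intro φ
  obtain ⟨F, hF⟩ := hρ φ
  have hd : ∀ w : ℂ, HasDerivAt
      (fun w : ℂ => evalAt (expGL (w • (X : Matrix (Fin N) (Fin N) ℂ))) F) 0 w := fun w => by
    have h1 := hasDerivAt_evalAt_expGL (X : Matrix (Fin N) (Fin N) ℂ) F w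
    rwa [evalAt_leftInvariant_rep hρ φ hF X ⟨_, expGL_mem hG X.2 w⟩, hX, mul_zero, map_zero] at h1
  have h2 := is_const_of_deriv_eq_zero (fun w => (hd w).differentiableAt) (fun w => (hd w).deriv)
    z 0
  rw [expGL_zero_smul] at h2
  have h3 : φ (ρ 1) = evalAt ((1 : G) : GL (Fin N) ℂ) F := hF 1
  rw [Subgroup.coe_one, ← h2, map_one] at h3
  exact (hF _).trans h3.symm

/-- A subspace stable under the Lie algebra of a connected group is stable under the group. -/
theorem rep_apply_mem_of_differential_apply_mem (hG : IsZariskiConnected (G : Set (GL (Fin N) ℂ)))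
    (hρ : IsRegularMap G fun g => ρ g) (U : Submodule ℂ V)
    (hU : ∀ X, ∀ u ∈ U, differential hρ X u ∈ U) (g : G) {u : V} (hu : u ∈ U) : ρ g u ∈ U := by
  rw [← Subspace.dualAnnihilator_dualCoannihilator_eq (W := U), Submodule.mem_dualCoannihilator]
  intro ψ hψ
  obtain ⟨F, hF⟩ := hρ (ψ ∘ₗ LinearMap.applyₗ u)
  refine (hF g).trans (vanishes_of_leftInvariant_stable hG
    {F | ∃ u ∈ U, ∀ g : G, ψ (ρ g u) = evalAt (g : GL (Fin N) ℂ) F} ?_ ?_ F ⟨u, hu, hF⟩ g g.2)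
  · rintro X hX F ⟨u, hu, hF⟩
    exact ⟨differential hρ ⟨X, hX⟩ u, hU _ _ hu, fun g =>
      (evalAt_leftInvariant_rep hρ (ψ ∘ₗ LinearMap.applyₗ u) hF ⟨X, hX⟩ g).symm⟩
  · rintro F ⟨u, hu, hF⟩
    rw [← Subgroup.coe_one G, ← hF, map_one]
    exact (Submodule.mem_dualAnnihilator _).1 hψ u hu

theorem eq_bot_or_eq_top_of_differential_apply_mem
    (hG : IsZariskiConnected (G : Set (GL (Fin N) ℂ)))
    (hρ : IsRegularMap G fun g => ρ g) (hirr : ρ.IsIrreducible) (U : Submodule ℂ V)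
    (hU : ∀ X, ∀ u ∈ U, differential hρ X u ∈ U) : U = ⊥ ∨ U = ⊤ := by
  let U' : Subrepresentation ρ :=
    ⟨U, fun g _ hu => rep_apply_mem_of_differential_apply_mem hG hρ U hU g hu⟩
  rcases hirr.eq_bot_or_eq_top U' with h | h
  · exact Or.inl (congrArg Subrepresentation.toSubmodule h)
  · exact Or.inr (congrArg Subrepresentation.toSubmodule h)

/-- A semisimple group with an irreducible representation with finite kernel has a semisimple Lie
algebra. Such a Lie algebra is reductive, and its center is trivial. -/
theorem isKilling_lieAlgebra (hG : IsSemisimple G) (hρ : IsRegularMap G fun g => ρ g)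
    (hirr : ρ.IsIrreducible) (hker : (MonoidHom.ker ρ : Set G).Finite) :
    LieAlgebra.IsKilling ℂ (lieAlgebra G) := by
  let _ : LieRingModule (lieAlgebra G) V := LieRingModule.compLieHom V (derivRep hρ)
  have _ : LieModule ℂ (lieAlgebra G) V := LieModule.compLieHom V (derivRep hρ)
  have hact : ∀ (X : lieAlgebra G) (v : V), ⁅X, v⁆ = differential hρ X v := fun _ _ => rfl
  have _ : Nontrivial V := by
    by_contra hV
    rw [not_nontrivial_iff_subsingleton] at hV
    obtain ⟨a, b, hab⟩ := hirr.exists_pair_ne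
    exact hab (Subrepresentation.toSubmodule_injective (Subsingleton.elim _ _))
  have _ : LieModule.IsIrreducible ℂ (lieAlgebra G) V := by
    refine LieModule.IsIrreducible.mk fun U hU => ?_
    rcases eq_bot_or_eq_top_of_differential_apply_mem hG.connected hρ hirr U.toSubmodule
      (fun X u hu => U.lie_mem (x := X) hu) with h | h
    · exact absurd ((LieSubmodule.toSubmodule_eq_bot U).1 h) hU
    · exact (LieSubmodule.toSubmodule_eq_top _).1 h
  have _ : LieModule.IsFaithful ℂ (lieAlgebra G) V :=
    ⟨injective_differential hG.closed hρ hker⟩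
  have h := (LieAlgebra.hasCentralRadical_and_of_isIrreducible_of_isFaithful ℂ (lieAlgebra G) V).1
  have _ : LieAlgebra.HasTrivialRadical ℂ (lieAlgebra G) := by
    rw [LieAlgebra.hasTrivialRadical_iff, (LieAlgebra.hasCentralRadical_iff _ _).1 h,
      LieSubmodule.eq_bot_iff]
    intro X hX
    rw [LieModule.mem_maxTrivSubmodule] at hX
    refine Subtype.ext (eq_zero_of_commute_lieAlgebra hG X.2 fun Y hY => ?_)
    have := congrArg Subtype.val (hX ⟨Y, hY⟩)
    rw [LieSubalgebra.coe_bracket, LieRing.of_associative_ring_bracket] at this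
    exact (sub_eq_zero.1 this).symm
  infer_instance

end Derivative

/-! ### Jordan decomposition in the Lie algebra of an algebraic group -/

/-- If `S` is diagonalizable, `D` is locally nilpotent and they commute, every subspace stable under
`S + D` is stable under `S`: on a given vector `S` acts as a polynomial in `S + D`. -/
theorem apply_mem_of_add_apply_mem {K V : Type*} [Field K] [AddCommGroup V] [Module K V]
    {S D : Module.End K V} (hSD : Commute S D) (hD : ∀ v, ∃ k : ℕ, (D ^ k) v = 0)
    {I : Submodule K V} (hI : ∀ v ∈ I, (S + D) v ∈ I) {v : V} (hvI : v ∈ I)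
    (hv : v ∈ ⨆ μ, S.eigenspace μ) : S v ∈ I := by
  classical
  obtain ⟨f, hf, rfl⟩ := (Submodule.mem_iSup_iff_exists_finsupp _ _).1 hv
  choose k hk using hD
  set m := f.support.sup fun μ => k (f μ)
  have hDm : ∀ μ ∈ f.support, (D ^ m) (f μ) = 0 := fun μ hμ => by
    obtain ⟨c, hc⟩ := Nat.exists_eq_add_of_le' (Finset.le_sup (f := fun μ => k (f μ)) hμ)
    rw [show m = c + k (f μ) from hc, pow_add, Module.End.mul_apply, hk, map_zero]
  have hcop : Pairwise (Function.onFun IsCoprime fun μ : f.support =>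
      Ideal.span {(Polynomial.X - Polynomial.C (μ : K)) ^ m}) := fun μ ν hμν => by
    rw [Function.onFun, Ideal.isCoprime_span_singleton_iff]
    refine (Polynomial.isCoprime_X_sub_C_of_isUnit_sub ?_).pow
    exact (sub_ne_zero.2 fun h => hμν (Subtype.ext h)).isUnit
  -- `p` takes the value `μ` to order `m` at every eigenvalue `μ` that occurs in `v`
  obtain ⟨p, hp⟩ := Ideal.exists_forall_sub_mem_ideal hcop fun μ => Polynomial.C (μ : K)
  have hpf : ∀ μ ∈ f.support, Polynomial.aeval (S + D) p (f μ) = S (f μ) := fun μ hμ => by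
    obtain ⟨q, hq⟩ := Ideal.mem_span_singleton'.1 (hp ⟨μ, hμ⟩)
    have hE : ∀ w ∈ S.eigenspace μ, ∀ j : ℕ,
        ((S + D - algebraMap K _ μ) ^ j) w = (D ^ j) w ∧ (D ^ j) w ∈ S.eigenspace μ := by
      intro w hw j
      induction j with
      | zero => exact ⟨rfl, hw⟩
      | succ j ih =>
        rw [pow_succ', pow_succ', Module.End.mul_apply, Module.End.mul_apply, ih.1]
        have h1 := Module.End.mem_eigenspace_iff.1 ih.2
        refine ⟨?_, ?_⟩
        · simp [h1]
        · rw [Module.End.mem_eigenspace_iff, ← Module.End.mul_apply, hSD.eq, Module.End.mul_apply,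
            h1, map_smul]
    have h1 : p = q * (Polynomial.X - Polynomial.C μ) ^ m + Polynomial.C μ := by
      rw [hq, sub_add_cancel]
    rw [h1, map_add, map_mul, map_pow, map_sub, Polynomial.aeval_X, Polynomial.aeval_C,
      LinearMap.add_apply, Module.End.mul_apply, (hE _ (hf μ) m).1, hDm μ hμ, map_zero, zero_add,
      Module.algebraMap_end_apply, Module.End.mem_eigenspace_iff.1 (hf μ)]
  have h2 : S (f.sum fun _ x => x) = Polynomial.aeval (S + D) p (f.sum fun _ x => x) := by
    rw [Finsupp.sum, map_sum, map_sum]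
    exact (Finset.sum_congr rfl hpf).symm
  rw [h2]
  have h3 : ∀ j : ℕ, ∀ w ∈ I, ((S + D) ^ j) w ∈ I := fun j => by
    induction j with
    | zero => exact fun w hw => hw
    | succ j ih =>
      intro w hw
      rw [pow_succ', Module.End.mul_apply]
      exact hI _ (ih w hw)
  rw [Polynomial.aeval_eq_sum_range, LinearMap.sum_apply]
  exact Submodule.sum_mem _ fun j _ => Submodule.smul_mem _ _ (h3 j _ hvI)

/-- The regular function `g ↦ (g a)_i`. -/
def rowFun {N : ℕ} (i : Fin N) : (Fin N → ℂ) →ₗ[ℂ] MvPolynomial (Vars N) ℂ :=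
  Fintype.linearCombination ℂ fun k => MvPolynomial.X (Sum.inl (i, k))

/-- The regular function `g ↦ (a g⁻¹)_j`. -/
def colFun {N : ℕ} (j : Fin N) : (Fin N → ℂ) →ₗ[ℂ] MvPolynomial (Vars N) ℂ :=
  Fintype.linearCombination ℂ fun k => MvPolynomial.X (Sum.inr (k, j))

theorem leftInvariant_rowFun {N : ℕ} (X : Matrix (Fin N) (Fin N) ℂ) (i : Fin N)
    (a : Fin N → ℂ) : leftInvariant X (rowFun i a) = rowFun i (X *ᵥ a) := by
  simp only [rowFun, Fintype.linearCombination_apply, map_sum, Derivation.map_smul,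
    leftInvariant_X_inl, Matrix.mulVec, dotProduct, Finset.smul_sum, Finset.sum_smul,
    ← MvPolynomial.smul_eq_C_mul, smul_smul]
  rw [Finset.sum_comm]
  simp only [mul_comm]

theorem leftInvariant_colFun {N : ℕ} (X : Matrix (Fin N) (Fin N) ℂ) (j : Fin N)
    (a : Fin N → ℂ) : leftInvariant X (colFun j a) = -colFun j (a ᵥ* X) := by
  simp only [colFun, Fintype.linearCombination_apply, map_sum, Derivation.map_smul,
    leftInvariant_X_inr, Matrix.vecMul, dotProduct, Finset.smul_sum, Finset.sum_smul,
    ← MvPolynomial.smul_eq_C_mul, smul_smul, smul_neg, Finset.sum_neg_distrib]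
  rw [Finset.sum_comm]

theorem rowFun_single {N : ℕ} (i k : Fin N) :
    rowFun i (Pi.single k 1) = MvPolynomial.X (Sum.inl (i, k)) := by
  simp [rowFun]

theorem colFun_single {N : ℕ} (k j : Fin N) :
    colFun j (Pi.single k 1) = MvPolynomial.X (Sum.inr (k, j)) := by
  simp [colFun]

/-- A derivation that is locally nilpotent on the generators of a polynomial ring is locally
nilpotent. -/
theorem exists_pow_derivation_apply_eq_zero {σ R : Type*} [CommRing R]
    (D : Derivation R (MvPolynomial σ R) (MvPolynomial σ R))
    (hX : ∀ i, ∃ k : ℕ, ((D : Module.End R (MvPolynomial σ R)) ^ k) (MvPolynomial.X i) = 0)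
    (F : MvPolynomial σ R) : ∃ k : ℕ, ((D : Module.End R (MvPolynomial σ R)) ^ k) F = 0 := by
  set D' : Module.End R (MvPolynomial σ R) := (D : MvPolynomial σ R →ₗ[R] MvPolynomial σ R) with hD'
  have hle : ∀ {F : MvPolynomial σ R} {k : ℕ} (j : ℕ), (D' ^ k) F = 0 → (D' ^ (j + k)) F = 0 :=
    fun j h => by rw [pow_add, Module.End.mul_apply, h, map_zero]
  -- by the Leibniz rule, `D ^ (a + b)` kills products of elements killed by `D ^ a` and `D ^ b`
  have hmul : ∀ n a b : ℕ, a + b = n → ∀ F F' : MvPolynomial σ R, (D' ^ a) F = 0 →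
      (D' ^ b) F' = 0 → (D' ^ n) (F * F') = 0 := by
    intro n
    induction n with
    | zero =>
      intro a b hab F F' hF _
      obtain ⟨rfl, rfl⟩ : a = 0 ∧ b = 0 := by omega
      have hF0 : F = 0 := hF
      rw [hF0, zero_mul, map_zero]
    | succ n ih =>
      intro a b hab F F' hF hF'
      rw [pow_succ, Module.End.mul_apply]
      have h1 : D' (F * F') = F * D' F' + F' * D' F := D.leibniz F F'
      rw [h1, map_add]
      rcases a with - | a
      · have hF0 : F = 0 := hF
        simp [hF0]
      rcases b with - | b
      · have hF0 : F' = 0 := hF'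
        simp [hF0]
      rw [ih (a + 1) b (by omega) _ _ hF (by rwa [pow_succ, Module.End.mul_apply] at hF'),
        mul_comm, ih a (b + 1) (by omega) _ _ (by rwa [pow_succ, Module.End.mul_apply] at hF) hF',
        add_zero]
  induction F using MvPolynomial.induction_on with
  | C a => exact ⟨1, by rw [pow_one]; exact MvPolynomial.derivation_C D a⟩
  | add p q hp hq =>
    obtain ⟨a, ha⟩ := hp
    obtain ⟨b, hb⟩ := hq
    exact ⟨a + b, by rw [map_add, hle a hb, add_comm a, hle b ha, add_zero]⟩
  | mul_X p i hp =>
    obtain ⟨a, ha⟩ := hp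
    obtain ⟨b, hb⟩ := hX i
    exact ⟨a + b, hmul _ a b rfl _ _ ha hb⟩

theorem exists_pow_leftInvariant_apply_eq_zero {N : ℕ} {X : Matrix (Fin N) (Fin N) ℂ}
    (hX : IsNilpotent X) (F : MvPolynomial (Vars N) ℂ) :
    ∃ k : ℕ, ((leftInvariant X : Module.End ℂ (MvPolynomial (Vars N) ℂ)) ^ k) F = 0 := by
  obtain ⟨n, hn⟩ := hX
  refine exists_pow_derivation_apply_eq_zero _ (fun i => ⟨n, ?_⟩) F
  rcases i with ⟨i, j⟩ | ⟨i, j⟩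
  · have h : ∀ (k : ℕ) (a : Fin N → ℂ),
        ((leftInvariant X : Module.End ℂ (MvPolynomial (Vars N) ℂ)) ^ k) (rowFun i a) =
          rowFun i ((X ^ k) *ᵥ a) := by
      intro k
      induction k with
      | zero => simp
      | succ k ih =>
        intro a
        rw [pow_succ, Module.End.mul_apply, Derivation.coeFn_coe, leftInvariant_rowFun, ih,
          Matrix.mulVec_mulVec, ← pow_succ]
    rw [← rowFun_single, h, hn, Matrix.zero_mulVec, map_zero]
  · have h : ∀ (k : ℕ) (a : Fin N → ℂ),
        ((leftInvariant X : Module.End ℂ (MvPolynomial (Vars N) ℂ)) ^ k) (colFun j a) =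
          (-1 : ℂ) ^ k • colFun j (a ᵥ* (X ^ k)) := by
      intro k
      induction k with
      | zero => simp
      | succ k ih =>
        intro a
        rw [pow_succ, Module.End.mul_apply, Derivation.coeFn_coe, leftInvariant_colFun, map_neg, ih,
          Matrix.vecMul_vecMul, ← pow_succ', pow_succ (-1 : ℂ)]
        simp
    rw [← colFun_single, h, hn, Matrix.vecMul_zero, map_zero, smul_zero]

/-- The polynomial ring is spanned by eigenvectors of a derivation if its generators are in the span
of eigenvectors, because products of eigenvectors are eigenvectors. -/
theorem iSup_eigenspace_derivation_eq_top {σ K : Type*} [Field K]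
    (D : Derivation K (MvPolynomial σ K) (MvPolynomial σ K))
    (hX : ∀ i, MvPolynomial.X i ∈
      ⨆ μ, Module.End.eigenspace (D : MvPolynomial σ K →ₗ[K] MvPolynomial σ K) μ)
    (F : MvPolynomial σ K) :
    F ∈ ⨆ μ, Module.End.eigenspace (D : MvPolynomial σ K →ₗ[K] MvPolynomial σ K) μ := by
  set E := ⨆ μ, Module.End.eigenspace (D : MvPolynomial σ K →ₗ[K] MvPolynomial σ K) μ with hE
  have hmem : ∀ {F μ}, D F = μ • F → F ∈ E := fun {F μ} h =>
    Submodule.mem_iSup_of_mem μ (Module.End.mem_eigenspace_iff.2 h)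
  have hmul : ∀ F ∈ E, ∀ F' ∈ E, F * F' ∈ E := by
    intro F hF F' hF'
    refine Submodule.iSup_induction _ (motive := fun F => F * F' ∈ E) hF (fun μ F hF => ?_)
      (by simp) fun a b ha hb => by rw [add_mul]; exact E.add_mem ha hb
    refine Submodule.iSup_induction _ (motive := fun F' => F * F' ∈ E) hF' (fun ν F' hF' => ?_)
      (by simp) fun a b ha hb => by rw [mul_add]; exact E.add_mem ha hb
    have h1 : D F = μ • F := Module.End.mem_eigenspace_iff.1 hF
    have h2 : D F' = ν • F' := Module.End.mem_eigenspace_iff.1 hF'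
    refine hmem (μ := ν + μ) ?_
    rw [D.leibniz, h1, h2, smul_eq_mul, smul_eq_mul, mul_smul_comm, mul_smul_comm, mul_comm F',
      add_smul]
  induction F using MvPolynomial.induction_on with
  | C a => exact hmem (μ := 0) (by simp)
  | add p q hp hq => exact E.add_mem hp hq
  | mul_X p i hp => exact hmul _ hp _ (hX i)

theorem mem_iSup_eigenspace_leftInvariant {N : ℕ} {X : Matrix (Fin N) (Fin N) ℂ}
    (P : GL (Fin N) ℂ) (hP : ((P : Matrix (Fin N) (Fin N) ℂ) * X *
      ((P⁻¹ : GL (Fin N) ℂ) : Matrix (Fin N) (Fin N) ℂ)).IsDiag) (F : MvPolynomial (Vars N) ℂ) :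
    F ∈ ⨆ μ, Module.End.eigenspace
      (leftInvariant X : MvPolynomial (Vars N) ℂ →ₗ[ℂ] MvPolynomial (Vars N) ℂ) μ := by
  set Q : Matrix (Fin N) (Fin N) ℂ := ((P⁻¹ : GL (Fin N) ℂ) : Matrix (Fin N) (Fin N) ℂ) with hQ
  set P' : Matrix (Fin N) (Fin N) ℂ := (P : Matrix (Fin N) (Fin N) ℂ) with hP'
  have hPQ : P' * Q = 1 := Units.mul_inv P
  have hQP : Q * P' = 1 := Units.inv_mul P
  obtain ⟨d, hd⟩ : ∃ d, P' * X * Q = Matrix.diagonal d :=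
    ⟨_, ((Matrix.isDiag_iff_diagonal_diag _).1 hP).symm⟩
  have hXQ : X * Q = Q * Matrix.diagonal d := by
    rw [← hd, mul_assoc P', ← mul_assoc Q, hQP, one_mul]
  have hPX : P' * X = Matrix.diagonal d * P' := by
    rw [← hd, mul_assoc _ Q, hQP, mul_one]
  refine iSup_eigenspace_derivation_eq_top _ (fun i => ?_) F
  rcases i with ⟨i, k⟩ | ⟨k, j⟩
  · rw [← rowFun_single, ← Matrix.one_mulVec (Pi.single k (1 : ℂ)), ← hQP, ← Matrix.mulVec_mulVec,
      Matrix.mulVec_eq_sum, map_sum]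
    refine Submodule.sum_mem _ fun j _ => ?_
    rw [op_smul_eq_smul, map_smul]
    refine Submodule.smul_mem _ _ (Submodule.mem_iSup_of_mem (d j)
      (Module.End.mem_eigenspace_iff.2 ?_))
    rw [Derivation.coeFn_coe, leftInvariant_rowFun, ← map_smul]
    congr 1
    ext a
    have := congrFun (congrFun hXQ a) j
    rw [Matrix.mul_diagonal, Matrix.mul_apply] at this
    simpa [Matrix.mulVec, dotProduct, mul_comm] using this
  · rw [← colFun_single, ← Matrix.vecMul_one (Pi.single k (1 : ℂ)), ← hQP, ← Matrix.vecMul_vecMul,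
      Matrix.vecMul_eq_sum, map_sum]
    refine Submodule.sum_mem _ fun i _ => ?_
    rw [map_smul]
    refine Submodule.smul_mem _ _ (Submodule.mem_iSup_of_mem (-d i)
      (Module.End.mem_eigenspace_iff.2 ?_))
    rw [Derivation.coeFn_coe, leftInvariant_colFun, neg_smul, ← map_smul]
    congr 2
    ext a
    have := congrFun (congrFun hPX i) a
    rw [Matrix.diagonal_mul, Matrix.mul_apply] at this
    simpa [Matrix.vecMul, dotProduct] using this

/-- The Lie algebra of an algebraic group contains the semisimple parts of its elements. -/
theorem mem_lieAlgebra_of_add_mem {N : ℕ} {G : Subgroup (GL (Fin N) ℂ)}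
    {S D : Matrix (Fin N) (Fin N) ℂ} (hSD : Commute S D) (hD : IsNilpotent D) (P : GL (Fin N) ℂ)
    (hP : ((P : Matrix (Fin N) (Fin N) ℂ) * S *
      ((P⁻¹ : GL (Fin N) ℂ) : Matrix (Fin N) (Fin N) ℂ)).IsDiag)
    (h : S + D ∈ lieAlgebra G) : S ∈ lieAlgebra G := by
  intro F hF
  have hcomm : Commute (leftInvariant S : Module.End ℂ (MvPolynomial (Vars N) ℂ))
      (leftInvariant D : Module.End ℂ (MvPolynomial (Vars N) ℂ)) := by
    have h1 : ⁅leftInvariant S, leftInvariant D⁆ = 0 := by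
      rw [← leftInvariant_lie, hSD.lie_eq]
      simpa using leftInvariant_smul (0 : ℂ) (0 : Matrix (Fin N) (Fin N) ℂ)
    refine LinearMap.ext fun F => ?_
    have h2 := DFunLike.congr_fun h1 F
    rw [Derivation.commutator_apply] at h2
    exact sub_eq_zero.1 h2
  have h2 := apply_mem_of_add_apply_mem (I := (vanishingIdeal G).restrictScalars ℂ) hcomm
    (exists_pow_leftInvariant_apply_eq_zero hD) (fun F hF => by
      have h3 : leftInvariant (S + D) F ∈ vanishingIdeal G := vanishes_leftInvariant h hF
      rw [leftInvariant_add] at h3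
      exact h3) hF (mem_iSup_eigenspace_leftInvariant P hP F)
  exact h2 1 G.one_mem

/-! ### Simultaneous diagonalization -/

/-- Matrices whose common eigenvectors span are simultaneously diagonalizable. -/
theorem exists_isDiag_conj {N : ℕ} (M : Set (Matrix (Fin N) (Fin N) ℂ))
    (h : Submodule.span ℂ {v : Fin N → ℂ | ∀ A ∈ M, ∃ c : ℂ, A *ᵥ v = c • v} = ⊤) :
    ∃ P : GL (Fin N) ℂ, ∀ A ∈ M, ((P : Matrix (Fin N) (Fin N) ℂ) * A *
      ((P⁻¹ : GL (Fin N) ℂ) : Matrix (Fin N) (Fin N) ℂ)).IsDiag := by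
  let b₀ := Module.Basis.ofSpan h.ge
  have hb₀ : ∀ i, ∀ A ∈ M, ∃ c : ℂ, A *ᵥ b₀ i = c • b₀ i := fun i =>
    Module.Basis.ofSpan_subset h.ge ⟨i, rfl⟩
  let e := b₀.indexEquiv (Pi.basisFun ℂ (Fin N))
  let b := b₀.reindex e
  have hb : ∀ i, ∀ A ∈ M, ∃ c : ℂ, A *ᵥ b i = c • b i := fun i => by
    rw [Module.Basis.reindex_apply]
    exact hb₀ _
  let Q := (Pi.basisFun ℂ (Fin N)).toMatrix b
  let P := b.toMatrix (Pi.basisFun ℂ (Fin N))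
  have hPQ : P * Q = 1 := Module.Basis.toMatrix_mul_toMatrix_flip _ _
  have hQP : Q * P = 1 := Module.Basis.toMatrix_mul_toMatrix_flip _ _
  refine ⟨⟨P, Q, hPQ, hQP⟩, fun A hA => ?_⟩
  choose c hc using fun i => hb i A hA
  have hAQ : A * Q = Q * Matrix.diagonal c := by
    ext i j
    have := congrFun (hc j) i
    rw [Matrix.mul_diagonal, Matrix.mul_apply]
    simpa [Matrix.mulVec, dotProduct, Q, Module.Basis.toMatrix_apply, mul_comm] using this
  change (P * A * Q).IsDiag
  rw [mul_assoc, hAQ, ← mul_assoc, hPQ, one_mul]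
  exact Matrix.isDiag_diagonal c

/-- A semisimple matrix that commutes with simultaneously diagonalizable matrices is simultaneously
diagonalizable with them. -/
theorem exists_isDiag_conj_insert {N : ℕ} {M : Set (Matrix (Fin N) (Fin N) ℂ)} (P : GL (Fin N) ℂ)
    (hP : ∀ A ∈ M, ((P : Matrix (Fin N) (Fin N) ℂ) * A *
      ((P⁻¹ : GL (Fin N) ℂ) : Matrix (Fin N) (Fin N) ℂ)).IsDiag)
    {S : Matrix (Fin N) (Fin N) ℂ} (hS : Module.End.IsSemisimple (Matrix.toLinAlgEquiv' S))
    (hcomm : ∀ A ∈ M, Commute S A) :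
    ∃ P : GL (Fin N) ℂ, ∀ A ∈ insert S M, ((P : Matrix (Fin N) (Fin N) ℂ) * A *
      ((P⁻¹ : GL (Fin N) ℂ) : Matrix (Fin N) (Fin N) ℂ)).IsDiag := by
  refine exists_isDiag_conj _ (eq_top_iff.2 fun v _ => ?_)
  set U := Submodule.span ℂ {v : Fin N → ℂ | ∀ A ∈ insert S M, ∃ c : ℂ, A *ᵥ v = c • v} with hU
  set Q : Matrix (Fin N) (Fin N) ℂ := ((P⁻¹ : GL (Fin N) ℂ) : Matrix (Fin N) (Fin N) ℂ) with hQ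
  set P' : Matrix (Fin N) (Fin N) ℂ := (P : Matrix (Fin N) (Fin N) ℂ) with hP'
  have hQP : Q * P' = 1 := Units.inv_mul P
  rw [← Matrix.one_mulVec v, ← hQP, ← Matrix.mulVec_mulVec, Matrix.mulVec_eq_sum]
  refine Submodule.sum_mem _ fun j _ => ?_
  rw [op_smul_eq_smul]
  refine Submodule.smul_mem _ _ ?_
  -- The space of vectors on which all `A ∈ M` act as on the `j`-th column of `Q`.
  let p : Submodule ℂ (Fin N → ℂ) :=
    { carrier := {v | ∀ A ∈ M, A *ᵥ v = (P' * A * Q) j j • v}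
      add_mem' := fun hv hw A hA => by rw [Matrix.mulVec_add, hv A hA, hw A hA, smul_add]
      zero_mem' := fun A _ => by simp
      smul_mem' := fun c v hv A hA => by rw [Matrix.mulVec_smul, hv A hA, smul_comm] }
  have hpS : ∀ v ∈ p, Matrix.toLinAlgEquiv' S v ∈ p := fun v hv A hA => by
    rw [Matrix.toLinAlgEquiv'_apply, Matrix.mulVec_mulVec, ← (hcomm A hA).eq,
      ← Matrix.mulVec_mulVec, hv A hA, Matrix.mulVec_smul]
  have hp := Submodule.eq_iSup_inf_genEigenspace (p := p) 1 hpS hS.iSup_eigenspace_eq_top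
  have hpU : p ≤ U := by
    rw [hp]
    refine iSup_le fun μ v hv => Submodule.subset_span ?_
    rintro A (rfl | hA)
    · exact ⟨μ, Module.End.mem_eigenspace_iff.1 hv.2⟩
    · exact ⟨_, hv.1 A hA⟩
  refine hpU fun A hA => ?_
  have hAQ : A * Q = Q * (P' * A * Q) := by
    rw [mul_assoc P', ← mul_assoc Q, hQP, one_mul]
  rw [← (Matrix.isDiag_iff_diagonal_diag _).1 (hP A hA)] at hAQ
  ext a
  have := congrFun (congrFun hAQ a) j
  rw [Matrix.mul_diagonal, Matrix.mul_apply] at this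
  simpa [Matrix.mulVec, dotProduct, mul_comm] using this

/-- Jordan decomposition of a matrix. -/
theorem exists_semisimple_add_nilpotent {N : ℕ} (X : Matrix (Fin N) (Fin N) ℂ) :
    ∃ S D : Matrix (Fin N) (Fin N) ℂ, X = S + D ∧ Commute S D ∧ IsNilpotent D ∧
      Module.End.IsSemisimple (Matrix.toLinAlgEquiv' S) ∧ ∀ A, Commute A X → Commute A S := by
  obtain ⟨D, hD, S, hS, hDnil, hSss, h⟩ :=
    Module.End.exists_isNilpotent_isSemisimple (f := Matrix.toLinAlgEquiv' X)
  set φ := Matrix.toLinAlgEquiv' (R := ℂ) (n := Fin N)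
  refine ⟨φ.symm S, φ.symm D, ?_, ?_, ?_, ?_, fun A hA => ?_⟩
  · rw [← map_add, add_comm, ← h, φ.symm_apply_apply]
  · exact ((Algebra.commute_of_mem_adjoin_singleton_of_commute hS
      (Algebra.commute_of_mem_adjoin_self hD).symm).symm).map φ.symm
  · exact hDnil.map φ.symm
  · rwa [φ.apply_symm_apply]
  · have := (Algebra.commute_of_mem_adjoin_singleton_of_commute hS (hA.map φ)).map φ.symm
    rwa [φ.symm_apply_apply] at this

/-! ### The Lie algebra of a maximal torus is a Cartan subalgebra -/

section Cartan

variable {N : ℕ} {G T : Subgroup (GL (Fin N) ℂ)}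

/-- The Lie algebra of `T` consists of matrices of every linear subspace that contains `T`. -/
theorem mem_of_mem_lieAlgebra (U : Submodule ℂ (Matrix (Fin N) (Fin N) ℂ))
    (hU : ∀ t ∈ T, (t : Matrix (Fin N) (Fin N) ℂ) ∈ U) {X : Matrix (Fin N) (Fin N) ℂ}
    (hX : X ∈ lieAlgebra T) : X ∈ U := by
  rw [← Subspace.dualAnnihilator_dualCoannihilator_eq (W := U), Submodule.mem_dualCoannihilator]
  intro ℓ hℓ
  rw [← diffOne_linearFun ℓ]
  refine hX _ fun t ht => ?_
  rw [evalAt_linearFun]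
  exact (Submodule.mem_dualAnnihilator _).1 hℓ _ (hU t ht)

theorem lieAlgebra_isDiag_conj (P : GL (Fin N) ℂ)
    (hP : ∀ t ∈ T, ((P * t * P⁻¹ : GL (Fin N) ℂ) : Matrix (Fin N) (Fin N) ℂ).IsDiag)
    {X : Matrix (Fin N) (Fin N) ℂ} (hX : X ∈ lieAlgebra T) :
    ((P : Matrix (Fin N) (Fin N) ℂ) * X *
      ((P⁻¹ : GL (Fin N) ℂ) : Matrix (Fin N) (Fin N) ℂ)).IsDiag :=
  mem_of_mem_lieAlgebra (diagonalConj P) (fun t ht => by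
    have := hP t ht
    rwa [Units.val_mul, Units.val_mul] at this) hX

theorem commute_lieAlgebra_torus (hT : IsTorus T) {X Y : Matrix (Fin N) (Fin N) ℂ}
    (hX : X ∈ lieAlgebra T) (hY : Y ∈ lieAlgebra T) : Commute X Y := by
  obtain ⟨P, hP⟩ := hT.diagonalizable
  exact commute_of_isDiag_conj P (lieAlgebra_isDiag_conj P hP hX) (lieAlgebra_isDiag_conj P hP hY)

/-- If `h` is diagonalizable then `ad h` is semisimple, so the kernel of its square is its
kernel. -/
theorem commute_of_commute_lie (P : GL (Fin N) ℂ) {h X : Matrix (Fin N) (Fin N) ℂ}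
    (hP : ((P : Matrix (Fin N) (Fin N) ℂ) * h *
      ((P⁻¹ : GL (Fin N) ℂ) : Matrix (Fin N) (Fin N) ℂ)).IsDiag)
    (hX : Commute h ⁅X, h⁆) : Commute h X := by
  set Q : Matrix (Fin N) (Fin N) ℂ := ((P⁻¹ : GL (Fin N) ℂ) : Matrix (Fin N) (Fin N) ℂ) with hQ
  set P' : Matrix (Fin N) (Fin N) ℂ := (P : Matrix (Fin N) (Fin N) ℂ) with hP'
  have hPQ : P' * Q = 1 := Units.mul_inv P
  have hQP : Q * P' = 1 := Units.inv_mul P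
  obtain ⟨d, hd⟩ : ∃ d, P' * h * Q = Matrix.diagonal d :=
    ⟨_, ((Matrix.isDiag_iff_diagonal_diag _).1 hP).symm⟩
  have hh : h = Q * Matrix.diagonal d * P' := by
    rw [← hd, mul_assoc, mul_assoc _ Q, hQP, mul_one, ← mul_assoc, hQP, one_mul]
  set Y := P' * X * Q with hY
  have hXY : X = Q * Y * P' := by
    rw [hY, mul_assoc, mul_assoc _ Q, hQP, mul_one, ← mul_assoc, hQP, one_mul]
  have hconj : ∀ A B : Matrix (Fin N) (Fin N) ℂ,
      (Q * A * P') * (Q * B * P') = Q * (A * B) * P' := by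
    intro A B
    rw [mul_assoc (Q * A), ← mul_assoc P' (Q * B), ← mul_assoc P' Q, hPQ, one_mul]
    simp only [mul_assoc]
  have hinj : ∀ {A B : Matrix (Fin N) (Fin N) ℂ}, Q * A * P' = Q * B * P' → A = B := by
    intro A B hAB
    have := congrArg (fun M => P' * M * Q) hAB
    simpa only [mul_assoc, hPQ, mul_one, ← mul_assoc P' Q, one_mul] using this
  have h1 : Matrix.diagonal d * (Y * Matrix.diagonal d - Matrix.diagonal d * Y) =
      (Y * Matrix.diagonal d - Matrix.diagonal d * Y) * Matrix.diagonal d := by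
    have h2 := hX.eq
    rw [LieRing.of_associative_ring_bracket, hh, hXY, hconj, hconj, ← sub_mul, ← mul_sub, hconj,
      hconj] at h2
    exact hinj h2
  have h2 : Matrix.diagonal d * Y = Y * Matrix.diagonal d := by
    ext i j
    have h3 := congrFun (congrFun h1 i) j
    simp only [Matrix.diagonal_mul, Matrix.mul_diagonal, Matrix.sub_apply] at h3 ⊢
    have h4 : (d i - d j) * ((d i - d j) * Y i j) = 0 := by linear_combination -h3
    rcases mul_eq_zero.1 h4 with h | h
    · linear_combination h * Y i j
    · linear_combination h
  have h3 : h * X = X * h := by rw [hh, hXY, hconj, hconj, h2]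
  exact h3

/-- The centralizer in `Lie G` of the Lie algebra of `T`. -/
def centralizerTorus (G T : Subgroup (GL (Fin N) ℂ)) : LieSubalgebra ℂ (lieAlgebra G) where
  carrier := {X | ∀ h ∈ lieAlgebra T, Commute h (X : Matrix (Fin N) (Fin N) ℂ)}
  add_mem' := fun hX hY h hh => (hX h hh).add_right (hY h hh)
  zero_mem' := fun h _ => Commute.zero_right h
  smul_mem' := fun c X hX h hh => (hX h hh).smul_right c
  lie_mem' := fun {X Y} hX hY h hh => by
    rw [LieSubalgebra.coe_bracket, LieRing.of_associative_ring_bracket]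
    exact ((hX h hh).mul_right (hY h hh)).sub_right ((hY h hh).mul_right (hX h hh))

theorem mem_centralizerTorus {X : lieAlgebra G} : X ∈ centralizerTorus G T ↔
    ∀ h ∈ lieAlgebra T, Commute h (X : Matrix (Fin N) (Fin N) ℂ) := Iff.rfl

/-- Elements of the centralizer of a maximal torus have semisimple part in the Lie algebra of the
torus. -/
theorem exists_add_nilpotent_of_mem_centralizerTorus
    (hG : IsZariskiClosed (G : Set (GL (Fin N) ℂ))) (hT : IsMaximalTorus G T)
    {X : lieAlgebra G} (hX : X ∈ centralizerTorus G T) :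
    ∃ S ∈ lieAlgebra T, ∃ D : lieAlgebra G, D ∈ centralizerTorus G T ∧
      IsNilpotent (D : Matrix (Fin N) (Fin N) ℂ) ∧ (X : Matrix (Fin N) (Fin N) ℂ) = S + D := by
  obtain ⟨S, D, hXSD, hcomm, hD, hS, hSX⟩ :=
    exists_semisimple_add_nilpotent (X : Matrix (Fin N) (Fin N) ℂ)
  obtain ⟨P, hP⟩ := hT.prop.2.diagonalizable
  have hST : ∀ t ∈ T, Commute S (t : Matrix (Fin N) (Fin N) ℂ) := fun t ht =>
    (hSX _ (commute_of_commute_lieAlgebra hT.prop.2.connected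
      (fun h hh => (hX h hh).symm) ht).symm).symm
  obtain ⟨P', hP'⟩ := exists_isDiag_conj_insert (M := Units.val '' (T : Set (GL (Fin N) ℂ))) P
    (by
      rintro _ ⟨t, ht, rfl⟩
      have := hP t ht
      rwa [Units.val_mul, Units.val_mul] at this) hS (by
      rintro _ ⟨t, ht, rfl⟩
      exact hST t ht)
  have hSG : S ∈ lieAlgebra G :=
    mem_lieAlgebra_of_add_mem hcomm hD P' (hP' S (Set.mem_insert _ _)) (hXSD ▸ X.2)
  have hSt : S ∈ lieAlgebra T := mem_lieAlgebra_of_isMaximalTorus hG hT hSG P' (fun t ht => by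
    rw [Units.val_mul, Units.val_mul]
    exact hP' _ (Set.mem_insert_of_mem _ ⟨t, ht, rfl⟩)) (hP' S (Set.mem_insert _ _))
  have hDX : D = (X : Matrix (Fin N) (Fin N) ℂ) - S := by rw [hXSD, add_sub_cancel_left]
  refine ⟨S, hSt, ⟨D, hDX ▸ sub_mem X.2 hSG⟩, fun h hh => ?_, hD, hXSD⟩
  have hhD : Commute h D := by
    rw [hDX]
    exact (hX h hh).sub_right (commute_lieAlgebra_torus hT.prop.2 hh hSt)
  exact hhD

theorem isNilpotent_ad_of_isNilpotent {X : lieAlgebra G}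
    (hX : IsNilpotent (X : Matrix (Fin N) (Fin N) ℂ)) :
    IsNilpotent (LieAlgebra.ad ℂ (lieAlgebra G) X) :=
  LieSubalgebra.isNilpotent_ad_of_isNilpotent_ad _ (LieAlgebra.ad_nilpotent_of_nilpotent hX)

/-- The centralizer is nilpotent because each of its elements acts on it as its nilpotent part does,
and self-normalizing because the Lie algebra of `T` acts semisimply. -/
theorem isCartanSubalgebra_centralizerTorus
    (hG : IsZariskiClosed (G : Set (GL (Fin N) ℂ))) (hT : IsMaximalTorus G T) :
    (centralizerTorus G T).IsCartanSubalgebra where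
  nilpotent := by
    rw [LieAlgebra.isNilpotent_iff_forall (R := ℂ)]
    rintro ⟨X, hX⟩
    obtain ⟨S, hS, D, hD, hDnil, hXSD⟩ := exists_add_nilpotent_of_mem_centralizerTorus hG hT hX
    have h1 : LieAlgebra.ad ℂ (centralizerTorus G T) ⟨X, hX⟩ =
        LieAlgebra.ad ℂ (centralizerTorus G T) ⟨D, hD⟩ := by
      refine LinearMap.ext fun Y => Subtype.ext (Subtype.ext ?_)
      change ⁅(X : Matrix (Fin N) (Fin N) ℂ), ((Y : lieAlgebra G) : Matrix (Fin N) (Fin N) ℂ)⁆ =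
        ⁅(D : Matrix (Fin N) (Fin N) ℂ), ((Y : lieAlgebra G) : Matrix (Fin N) (Fin N) ℂ)⁆
      rw [hXSD, add_lie, (Y.2 S hS).lie_eq, zero_add]
    rw [h1]
    exact LieSubalgebra.isNilpotent_ad_of_isNilpotent_ad (centralizerTorus G T) (x := ⟨D, hD⟩)
      (isNilpotent_ad_of_isNilpotent hDnil)
  self_normalizing := by
    refine le_antisymm (fun X hX h hh => ?_) (LieSubalgebra.le_normalizer _)
    rw [LieSubalgebra.mem_normalizer_iff] at hX
    obtain ⟨P, hP⟩ := hT.prop.2.diagonalizable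
    exact commute_of_commute_lie P (lieAlgebra_isDiag_conj P hP hh)
      (hX ⟨h, lieAlgebra_mono hT.prop.1 hh⟩
        (fun h' hh' => commute_lieAlgebra_torus hT.prop.2 hh' hh) h hh)

/-- The Lie algebra of a maximal torus is its own centralizer. -/
theorem mem_centralizerTorus_iff (hG : IsZariskiClosed (G : Set (GL (Fin N) ℂ)))
    [LieAlgebra.IsKilling ℂ (lieAlgebra G)] (hT : IsMaximalTorus G T) {X : lieAlgebra G} :
    X ∈ centralizerTorus G T ↔ (X : Matrix (Fin N) (Fin N) ℂ) ∈ lieAlgebra T := by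
  refine ⟨fun hX => ?_, fun hX h hh => commute_lieAlgebra_torus hT.prop.2 hh hX⟩
  have _ := isCartanSubalgebra_centralizerTorus hG hT
  obtain ⟨S, hS, D, hD, hDnil, hXSD⟩ := exists_add_nilpotent_of_mem_centralizerTorus hG hT hX
  have hD0 := LieAlgebra.IsKilling.eq_zero_of_isNilpotent_ad_of_mem_isCartanSubalgebra ℂ
    (lieAlgebra G) (centralizerTorus G T) hD (isNilpotent_ad_of_isNilpotent hDnil)
  rw [hXSD, hD0]
  simpa using hS

end Cartan

/-! ### Simple coroots -/

section Coroots

variable {N n : ℕ} {G T : Subgroup (GL (Fin N) ℂ)} [LieAlgebra.IsKilling ℂ (lieAlgebra G)]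

/-- The Lie algebra of a maximal torus, as a Cartan subalgebra of the Lie algebra of `G`. -/
def torusEquiv (hG : IsZariskiClosed (G : Set (GL (Fin N) ℂ))) (hT : IsMaximalTorus G T) :
    lieAlgebra T ≃ₗ[ℂ] centralizerTorus G T where
  toFun h := ⟨⟨h, lieAlgebra_mono hT.prop.1 h.2⟩, (mem_centralizerTorus_iff hG hT).2 h.2⟩
  map_add' _ _ := rfl
  map_smul' _ _ := rfl
  invFun X := ⟨X, (mem_centralizerTorus_iff hG hT).1 X.2⟩
  left_inv _ := rfl
  right_inv _ := rfl

theorem coe_torusEquiv (hG : IsZariskiClosed (G : Set (GL (Fin N) ℂ))) (hT : IsMaximalTorus G T)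
    (h : lieAlgebra T) : ((torusEquiv hG hT h : lieAlgebra G) : Matrix (Fin N) (Fin N) ℂ) = h := rfl

/-- Root spaces agree with those of the Cartan subalgebra, on which the torus acts by honest rather
than generalized eigenvectors. -/
theorem mem_rootSpace_iff (hG : IsZariskiClosed (G : Set (GL (Fin N) ℂ)))
    (hT : IsMaximalTorus G T) [(centralizerTorus G T).IsCartanSubalgebra]
    {α : Module.Dual ℂ (lieAlgebra T)} {χ : centralizerTorus G T → ℂ}
    (hχ : ∀ h, χ (torusEquiv hG hT h) = α h) (X : lieAlgebra G) :
    (X : Matrix (Fin N) (Fin N) ℂ) ∈ rootSpace G T α ↔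
      X ∈ LieAlgebra.rootSpace (centralizerTorus G T) χ := by
  constructor
  · intro hX
    refine (LieModule.mem_genWeightSpace (lieAlgebra G) χ X).2 fun h => ⟨1, ?_⟩
    obtain ⟨h, rfl⟩ := (torusEquiv hG hT).surjective h
    rw [pow_one, hχ]
    refine Subtype.ext ?_
    have h1 : ⁅((torusEquiv hG hT h : lieAlgebra G) : Matrix (Fin N) (Fin N) ℂ),
        (X : Matrix (Fin N) (Fin N) ℂ)⁆ - α h • (X : Matrix (Fin N) (Fin N) ℂ) = 0 :=
      sub_eq_zero.2 (hX.2 h)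
    exact h1
  · intro hX
    refine ⟨X.2, fun h => ?_⟩
    have h1 := LieAlgebra.IsKilling.lie_eq_smul_of_mem_rootSpace hX (torusEquiv hG hT h)
    rw [hχ] at h1
    exact congrArg Subtype.val h1

theorem exists_weight_of_isRoot (hG : IsZariskiClosed (G : Set (GL (Fin N) ℂ)))
    (hT : IsMaximalTorus G T) [(centralizerTorus G T).IsCartanSubalgebra]
    {α : Module.Dual ℂ (lieAlgebra T)} (hα : IsRoot G T α) :
    ∃ w : LieModule.Weight ℂ (centralizerTorus G T) (lieAlgebra G), w.IsNonZero ∧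
      ∀ h, w (torusEquiv hG hT h) = α h := by
  obtain ⟨X, hX, hX0⟩ := Submodule.exists_mem_ne_zero_of_ne_bot hα.2
  have hχ : ∀ h, (α ∘ₗ (torusEquiv hG hT).symm.toLinearMap) (torusEquiv hG hT h) = α h :=
    fun h => by simp
  have hX' := (mem_rootSpace_iff hG hT hχ ⟨X, hX.1⟩).1 hX
  refine ⟨⟨α ∘ₗ (torusEquiv hG hT).symm.toLinearMap, fun hbot => ?_⟩, fun h0 => hα.1 ?_, hχ⟩
  · exact hX0 (congrArg Subtype.val ((LieSubmodule.mem_bot _).1 (hbot.le hX')))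
  · ext h
    rw [← hχ h]
    exact congrFun h0 _

theorem isRoot_of_weight (hG : IsZariskiClosed (G : Set (GL (Fin N) ℂ)))
    (hT : IsMaximalTorus G T) [(centralizerTorus G T).IsCartanSubalgebra]
    (w : LieModule.Weight ℂ (centralizerTorus G T) (lieAlgebra G)) (hw : w.IsNonZero) :
    IsRoot G T (w.toLinear ∘ₗ (torusEquiv hG hT).toLinearMap) := by
  constructor
  · intro h0
    refine hw (funext fun h => ?_)
    have := DFunLike.congr_fun h0 ((torusEquiv hG hT).symm h)
    simpa using this
  · obtain ⟨X, hX, hX0⟩ := w.exists_ne_zero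
    refine (Submodule.ne_bot_iff _).2 ⟨X, (mem_rootSpace_iff hG hT (χ := w) (fun h => rfl) X).2 hX,
      fun h => hX0 (Subtype.ext h)⟩

/-- Coroots in the sense of `IsCoroot` are the coroots of the root system of the Lie algebra. -/
theorem isCoroot_iff (hG : IsZariskiClosed (G : Set (GL (Fin N) ℂ)))
    (hT : IsMaximalTorus G T) [(centralizerTorus G T).IsCartanSubalgebra]
    {α : Module.Dual ℂ (lieAlgebra T)}
    {w : LieModule.Weight ℂ (centralizerTorus G T) (lieAlgebra G)} (hw0 : w.IsNonZero)
    (hw : ∀ h, w (torusEquiv hG hT h) = α h) (h : lieAlgebra T) :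
    IsCoroot G T α h ↔ torusEquiv hG hT h = LieAlgebra.IsKilling.coroot w := by
  have hneg : ∀ h, (-w) (torusEquiv hG hT h) = (-α) h := fun h => by
    rw [LieModule.Weight.coe_neg, Pi.neg_apply, hw, LinearMap.neg_apply]
  have hset : {Z : Matrix (Fin N) (Fin N) ℂ | ∃ X ∈ rootSpace G T α, ∃ Y ∈ rootSpace G T (-α),
      Z = ⁅X, Y⁆} = (lieAlgebra G).toSubmodule.subtype ''
      {Z | ∃ X ∈ LieAlgebra.rootSpace (centralizerTorus G T) w,
        ∃ Y ∈ LieAlgebra.rootSpace (centralizerTorus G T) (-w), ⁅X, Y⁆ = Z} := by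
    ext Z
    constructor
    · rintro ⟨X, hX, Y, hY, rfl⟩
      exact ⟨⁅(⟨X, hX.1⟩ : lieAlgebra G), (⟨Y, hY.1⟩ : lieAlgebra G)⁆,
        ⟨⟨X, hX.1⟩, (mem_rootSpace_iff hG hT hw _).1 hX, ⟨Y, hY.1⟩,
          (mem_rootSpace_iff hG hT hneg _).1 hY, rfl⟩, rfl⟩
    · rintro ⟨_, ⟨X, hX, Y, hY, rfl⟩, rfl⟩
      exact ⟨X, (mem_rootSpace_iff hG hT hw _).2 hX, Y, (mem_rootSpace_iff hG hT hneg _).2 hY, rfl⟩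
  have hmem : (h : Matrix (Fin N) (Fin N) ℂ) ∈ Submodule.span ℂ {Z : Matrix (Fin N) (Fin N) ℂ |
      ∃ X ∈ rootSpace G T α, ∃ Y ∈ rootSpace G T (-α), Z = ⁅X, Y⁆} ↔
      torusEquiv hG hT h ∈ LieAlgebra.corootSpace (w : centralizerTorus G T → ℂ) := by
    rw [LieAlgebra.mem_corootSpace, hset, Submodule.span_image, ← coe_torusEquiv hG hT h]
    constructor
    · rintro ⟨Z, hZ, hZh⟩
      have h1 : Z = (torusEquiv hG hT h : lieAlgebra G) := Subtype.ext hZh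
      rwa [← h1]
    · exact fun hZ => ⟨(torusEquiv hG hT h : lieAlgebra G), hZ, rfl⟩
  rw [IsCoroot, hmem, ← hw]
  constructor
  · exact fun h => LieAlgebra.IsKilling.eq_coroot_of_mem_corootSpace_of_two w h.1 h.2
  · intro h
    rw [h]
    exact ⟨LieAlgebra.IsKilling.coroot_mem_corootSpace w,
      LieAlgebra.IsKilling.root_apply_coroot hw0⟩

/-- The simple coroots form a basis of the Lie algebra of the torus. -/
theorem exists_basis_coroot (hG : IsZariskiClosed (G : Set (GL (Fin N) ℂ)))
    (hT : IsMaximalTorus G T) [(centralizerTorus G T).IsCartanSubalgebra]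
    {α : Fin n → Module.Dual ℂ (lieAlgebra T)} (hα : IsBase G T α) :
    ∃ coroot : Module.Basis (Fin n) ℂ (lieAlgebra T),
      ∀ i h, IsCoroot G T (α i) h ↔ h = coroot i := by
  set e := torusEquiv hG hT
  choose w hw0 hw using fun i => exists_weight_of_isRoot hG hT (hα.isRoot i)
  have hspan : ⊤ ≤ Submodule.span ℂ (Set.range α) := by
    have hroot : ∀ v : LieModule.Weight ℂ (centralizerTorus G T) (lieAlgebra G), v.IsNonZero →
        v.toLinear ∘ₗ e.toLinearMap ∈ Submodule.span ℂ (Set.range α) := by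
      intro v hv
      have hsum : ∀ m : Fin n → ℕ, ∑ i, m i • α i ∈ Submodule.span ℂ (Set.range α) := fun m =>
        Submodule.sum_mem _ fun i _ => nsmul_mem (Submodule.subset_span (Set.mem_range_self i)) _
      obtain ⟨m, hm | hm⟩ := hα.nonneg_or_nonpos _ (isRoot_of_weight hG hT v hv)
      · rw [hm]; exact hsum m
      · rw [hm]; exact neg_mem (hsum m)
    intro β _
    have h1 : β ∘ₗ e.symm.toLinearMap ∈ Submodule.span ℂ
        ({v : LieModule.Weight ℂ (centralizerTorus G T) (lieAlgebra G) | v.IsNonZero}.image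
          (LieModule.Weight.toLinear ℂ (centralizerTorus G T) (lieAlgebra G))) := by
      rw [LieAlgebra.IsKilling.span_weight_isNonZero_eq_top]
      trivial
    have h2 : Submodule.span ℂ
        ({v : LieModule.Weight ℂ (centralizerTorus G T) (lieAlgebra G) | v.IsNonZero}.image
          (LieModule.Weight.toLinear ℂ (centralizerTorus G T) (lieAlgebra G))) ≤
        (Submodule.span ℂ (Set.range α)).comap e.toLinearMap.dualMap := by
      rw [Submodule.span_le]
      rintro _ ⟨v, hv, rfl⟩
      exact hroot v hv
    have h3 : (β ∘ₗ e.symm.toLinearMap) ∘ₗ e.toLinearMap ∈ Submodule.span ℂ (Set.range α) := h2 h1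
    convert h3 using 1
    ext h
    simp
  let b := (Module.Basis.mk hα.linearIndependent hspan).map e.dualMap.symm
  let b' := b.map (LieAlgebra.IsKilling.cartanEquivDual (centralizerTorus G T)).symm
  have hb : ∀ i, b i = (w i).toLinear := fun i => by
    ext h
    obtain ⟨h, rfl⟩ := e.surjective h
    simp [b, e, hw]
  have hc : ∀ i, IsUnit (2 * (w i ((LieAlgebra.IsKilling.cartanEquivDual
      (centralizerTorus G T)).symm (w i).toLinear))⁻¹) := fun i =>
    (mul_ne_zero two_ne_zero (inv_ne_zero
      (LieAlgebra.IsKilling.root_apply_cartanEquivDual_symm_ne_zero (hw0 i)))).isUnit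
  refine ⟨(b'.isUnitSMul hc).map e.symm, fun i h => ?_⟩
  rw [isCoroot_iff hG hT (hw0 i) (hw i), Module.Basis.map_apply, Module.Basis.isUnitSMul_apply,
    LinearEquiv.eq_symm_apply, Module.Basis.map_apply, hb, LieAlgebra.IsKilling.coroot, mul_smul,
    two_smul ℂ, two_nsmul]

/-- Weights of representations take rational values on coroots. -/
theorem exists_rat_apply_coroot {L M : Type*} [LieRing L] [LieAlgebra ℂ L] [FiniteDimensional ℂ L]
    [LieAlgebra.IsKilling ℂ L] (H : LieSubalgebra ℂ L) [H.IsCartanSubalgebra] [AddCommGroup M]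
    [Module ℂ M] [FiniteDimensional ℂ M] [LieRingModule L M] [LieModule ℂ L M]
    {w : LieModule.Weight ℂ H L} (hw : w.IsNonZero) {χ : H → ℂ}
    (hχ : LieModule.genWeightSpace M χ ≠ ⊥) :
    ∃ q : ℚ, χ (LieAlgebra.IsKilling.coroot w) = q := by
  -- the `w`-string through `χ` has trace zero on coroots, which gives a relation `a w + b χ = 0`
  obtain ⟨a, b, hb, h⟩ := LieModule.exists_forall_mem_corootSpace_smul_add_eq_zero M
    (w : H → ℂ) χ hw hχ
  have h1 := h _ (LieAlgebra.IsKilling.coroot_mem_corootSpace w)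
  rw [Pi.add_apply, Pi.smul_apply, Pi.smul_apply, LieAlgebra.IsKilling.root_apply_coroot hw,
    zsmul_eq_mul, zsmul_eq_mul] at h1
  have hb' : (b : ℂ) ≠ 0 := Int.cast_ne_zero.2 hb.ne'
  refine ⟨-(2 * a) / b, ?_⟩
  push_cast
  rw [eq_div_iff hb']
  linear_combination h1

/-- An ideal of a semisimple Lie algebra that meets a Cartan subalgebra trivially is zero. -/
theorem lieIdeal_eq_bot_of_disjoint_cartan {L : Type*} [LieRing L] [LieAlgebra ℂ L]
    [FiniteDimensional ℂ L] [LieAlgebra.IsKilling ℂ L] (H : LieSubalgebra ℂ L)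
    [H.IsCartanSubalgebra] (I : LieIdeal ℂ L) (hI : ∀ x ∈ I, x ∈ H → x = 0) : I = ⊥ := by
  have h1 := LieAlgebra.IsKilling.lieIdeal_eq_inf_cartan_sup_biSup_rootSpace (H := H) I
  have h2 : I.restr H ⊓ H.toLieSubmodule = ⊥ := by
    rw [LieSubmodule.eq_bot_iff]
    exact fun x hx => hI x hx.1 hx.2
  -- a root space generates, together with its opposite, a coroot, which lies in `H`
  have h3 : ∀ w : H.root, ¬ LieAlgebra.rootSpace H w.val ≤ I.restr H := by
    intro w hw
    have hw0 := H.isNonZero_coe_root w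
    obtain ⟨h, e, f, ht, he, hf⟩ :=
      LieAlgebra.IsKilling.exists_isSl2Triple_of_weight_isNonZero hw0
    have hI' : h ∈ I := by
      rw [← ht.lie_e_f]
      exact lie_mem_left ℂ L I _ _ (hw he)
    have hh := ht.h_eq_coroot hw0 he hf
    exact ht.h_ne_zero (hI h hI' (hh ▸ SetLike.coe_mem _))
  rw [h2, bot_sup_eq, iSup_eq_bot.2 fun w => iSup_eq_bot.2 fun hw => absurd hw (h3 w)] at h1
  rw [LieSubmodule.eq_bot_iff]
  intro x hx
  have hx' : x ∈ I.restr H := hx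
  rwa [h1, LieSubmodule.mem_bot] at hx'

end Coroots

/-! ### Weight spaces of a torus -/

section Characters

variable {N : ℕ} {T : Subgroup (GL (Fin N) ℂ)}

/-- A homomorphism `T → ℂˣ` given by a polynomial is an algebraic character. -/
def AlgChar.ofPoly (e : T →* ℂˣ) (F : MvPolynomial (Vars N) ℂ)
    (hF : ∀ t, (e t : ℂ) = evalAt (t : GL (Fin N) ℂ) F) : AlgChar T :=
  ⟨e, fun φ => ⟨MvPolynomial.C (φ 1) * F, fun t => by
    rw [map_mul, ← hF, evalAt_C, mul_comm, ← smul_eq_mul, ← map_smul, smul_eq_mul, mul_one]⟩⟩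

theorem AlgChar.exists_poly (e : AlgChar T) :
    ∃ F : MvPolynomial (Vars N) ℂ, ∀ t, (e.1 t : ℂ) = evalAt (t : GL (Fin N) ℂ) F :=
  e.2 LinearMap.id

/-- The inverse of a character. -/
def AlgChar.inv (e : AlgChar T) : AlgChar T :=
  AlgChar.ofPoly e.1⁻¹ (MvPolynomial.rename Sum.swap e.exists_poly.choose) fun t => by
    rw [evalAt_rename_swap, ← Subgroup.coe_inv, ← e.exists_poly.choose_spec, MonoidHom.inv_apply,
      map_inv]

theorem AlgChar.inv_apply (e : AlgChar T) (t : T) : e.inv.1 t = (e.1 t)⁻¹ := rfl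

/-- Dedekind's theorem on the linear independence of characters, with vector coefficients. -/
theorem eq_zero_of_sum_char_smul_eq_zero {W : Type*} [AddCommGroup W] [Module ℂ W]
    {s : Finset (AlgChar T)} {v : AlgChar T → W}
    (h : ∀ t : T, ∑ e ∈ s, (e.1 t : ℂ) • v e = 0) {e : AlgChar T} (he : e ∈ s) : v e = 0 := by
  rw [dual_eq_iff]
  intro φ
  have hinj : Function.Injective fun e : AlgChar T => (Units.coeHom ℂ).comp e.1 := fun a b hab =>
    Subtype.ext (MonoidHom.ext fun t => Units.ext (DFunLike.congr_fun hab t))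
  have hli := (linearIndependent_monoidHom T ℂ).comp _ hinj
  rw [map_zero]
  refine linearIndependent_iff'.1 hli s (fun e => φ (v e)) (funext fun t => ?_) e he
  have h1 := congrArg φ (h t)
  rw [map_sum, map_zero] at h1
  rw [Finset.sum_apply, Pi.zero_apply, ← h1]
  refine Finset.sum_congr rfl fun e _ => ?_
  rw [map_smul, smul_eq_mul, mul_comm]
  rfl

/-- The functions on `T` that are linear combinations of characters form an algebra. -/
theorem adjoin_range_char_eq_span :
    Subalgebra.toSubmodule
      (Algebra.adjoin ℂ (Set.range fun (e : AlgChar T) (t : T) => (e.1 t : ℂ))) =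
      Submodule.span ℂ (Set.range fun (e : AlgChar T) (t : T) => (e.1 t : ℂ)) := by
  let M : Submonoid (T → ℂ) :=
    { carrier := Set.range fun (e : AlgChar T) (t : T) => (e.1 t : ℂ)
      one_mem' := ⟨AlgChar.ofPoly 1 1 (by simp), by
        ext t; simp [AlgChar.ofPoly]⟩
      mul_mem' := by
        rintro _ _ ⟨e, rfl⟩ ⟨f, rfl⟩
        obtain ⟨E, hE⟩ := e.exists_poly
        obtain ⟨F, hF⟩ := f.exists_poly
        exact ⟨AlgChar.ofPoly (e.1 * f.1) (E * F) fun t => by simp [hE, hF], by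
          ext t; simp [AlgChar.ofPoly]⟩ }
  have hM : (M : Set (T → ℂ)) = Set.range fun (e : AlgChar T) (t : T) => (e.1 t : ℂ) := rfl
  rw [← hM, Algebra.adjoin_eq_span, Submonoid.closure_eq]

/-- The diagonal entries of a diagonalized torus are characters. -/
theorem exists_char_eq_diag {P : GL (Fin N) ℂ} (hP : ∀ t ∈ T,
    ((P * t * P⁻¹ : GL (Fin N) ℂ) : Matrix (Fin N) (Fin N) ℂ).IsDiag) (k : Fin N) :
    ∃ e : AlgChar T, ∀ t : T,
      (e.1 t : ℂ) = ((P * t * P⁻¹ : GL (Fin N) ℂ) : Matrix (Fin N) (Fin N) ℂ) k k := by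
  let f : T →* ℂ :=
    { toFun := fun t => ((P * t * P⁻¹ : GL (Fin N) ℂ) : Matrix (Fin N) (Fin N) ℂ) k k
      map_one' := by simp
      map_mul' := fun s t => by
        have h : P * ((s * t : T) : GL (Fin N) ℂ) * P⁻¹ = (P * s * P⁻¹) * (P * t * P⁻¹) := by
          rw [Subgroup.coe_mul]; group
        rw [h, Units.val_mul, Matrix.mul_apply, Finset.sum_eq_single k]
        · intro j _ hj
          rw [hP s s.2 hj.symm, zero_mul]
        · exact fun h => absurd (Finset.mem_univ k) h }
  refine ⟨AlgChar.ofPoly f.toHomUnits (∑ b, (∑ a, MvPolynomial.C ((P : Matrix _ _ ℂ) k a) *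
    MvPolynomial.X (Sum.inl (a, b))) * MvPolynomial.C (((P⁻¹ : GL (Fin N) ℂ) : Matrix _ _ ℂ) b k))
    fun t => ?_, fun t => rfl⟩
  simp only [map_sum, map_mul, evalAt_C, evalAt_inl]
  change ((P * t * P⁻¹ : GL (Fin N) ℂ) : Matrix (Fin N) (Fin N) ℂ) k k = _
  simp only [Units.val_mul, Matrix.mul_apply]

/-- Regular functions on a torus are linear combinations of characters. -/
theorem IsTorus.mem_span_char (hT : IsTorus T) {f : T → ℂ} (hf : IsRegularFun T f) :
    f ∈ Submodule.span ℂ (Set.range fun (e : AlgChar T) (t : T) => (e.1 t : ℂ)) := by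
  rw [← adjoin_range_char_eq_span, Subalgebra.mem_toSubmodule]
  set A := Algebra.adjoin ℂ (Set.range fun (e : AlgChar T) (t : T) => (e.1 t : ℂ)) with hA
  obtain ⟨P, hP⟩ := hT.diagonalizable
  obtain ⟨F, hF⟩ := hf
  have hchar : ∀ e : AlgChar T, (fun t : T => (e.1 t : ℂ)) ∈ A := fun e =>
    Algebra.subset_adjoin (Set.mem_range_self e)
  choose e he using exists_char_eq_diag hP
  have hentry : ∀ (t : GL (Fin N) ℂ), t ∈ T → ∀ i j, (t : Matrix (Fin N) (Fin N) ℂ) i j =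
      ∑ k, (((P⁻¹ : GL (Fin N) ℂ) : Matrix (Fin N) (Fin N) ℂ) i k *
        (P : Matrix (Fin N) (Fin N) ℂ) k j) *
        ((P * t * P⁻¹ : GL (Fin N) ℂ) : Matrix (Fin N) (Fin N) ℂ) k k := by
    intro t ht i j
    have h : t = P⁻¹ * (P * t * P⁻¹) * P := by group
    conv_lhs => rw [h, Units.val_mul, Units.val_mul, Matrix.mul_apply]
    refine Finset.sum_congr rfl fun k _ => ?_
    rw [Matrix.mul_apply, Finset.sum_eq_single k]
    · ring
    · intro l _ hl
      rw [hP t ht hl, mul_zero]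
    · exact fun h => absurd (Finset.mem_univ k) h
  have hvar : ∀ i, (fun t : T => evalAt (t : GL (Fin N) ℂ) (MvPolynomial.X i)) ∈ A := by
    rintro (⟨i, j⟩ | ⟨i, j⟩)
    · have h : (fun t : T => evalAt (t : GL (Fin N) ℂ) (MvPolynomial.X (Sum.inl (i, j)))) =
          ∑ k, (((P⁻¹ : GL (Fin N) ℂ) : Matrix (Fin N) (Fin N) ℂ) i k *
            (P : Matrix (Fin N) (Fin N) ℂ) k j) • fun t : T => ((e k).1 t : ℂ) := by
        ext t
        rw [evalAt_inl, hentry t t.2, Finset.sum_apply]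
        exact Finset.sum_congr rfl fun k _ => by rw [Pi.smul_apply, he, smul_eq_mul]
      rw [h]
      exact sum_mem fun k _ => A.smul_mem (hchar _) _
    · have h : (fun t : T => evalAt (t : GL (Fin N) ℂ) (MvPolynomial.X (Sum.inr (i, j)))) =
          ∑ k, (((P⁻¹ : GL (Fin N) ℂ) : Matrix (Fin N) (Fin N) ℂ) i k *
            (P : Matrix (Fin N) (Fin N) ℂ) k j) • fun t : T => ((e k).inv.1 t : ℂ) := by
        ext t
        rw [evalAt_inr, hentry _ (T.inv_mem t.2), Finset.sum_apply]
        exact Finset.sum_congr rfl fun k _ => by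
          rw [Pi.smul_apply, AlgChar.inv_apply, ← map_inv, he, smul_eq_mul, Subgroup.coe_inv]
      rw [h]
      exact sum_mem fun k _ => A.smul_mem (hchar _) _
  obtain rfl : f = fun t : T => evalAt (t : GL (Fin N) ℂ) F := funext hF
  clear hF
  induction F using MvPolynomial.induction_on with
  | C a =>
    have h : (fun t : T => evalAt (t : GL (Fin N) ℂ) (MvPolynomial.C a)) =
      algebraMap ℂ (T → ℂ) a := funext fun t => evalAt_C _ _
    rw [h]
    exact A.algebraMap_mem a
  | add p q hp hq =>
    simp only [map_add]
    exact A.add_mem hp hq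
  | mul_X p i hp =>
    simp only [map_mul]
    exact A.mul_mem hp (hvar i)

end Characters

section Weights

variable {N : ℕ} {G T : Subgroup (GL (Fin N) ℂ)} {V : Type*} [AddCommGroup V] [Module ℂ V]
  {ρ : Representation ℂ G V}

theorem mem_weightSpace {hTG : T ≤ G} {e : AlgChar T} {v : V} :
    v ∈ weightSpace hTG ρ e ↔ ∀ t : T, ρ (Subgroup.inclusion hTG t) v = (e.1 t : ℂ) • v := Iff.rfl

variable [FiniteDimensional ℂ V]

/-- Every vector of a representation of a torus is a sum of weight vectors. -/
theorem iSup_weightSpace (hT : IsTorus T) (hTG : T ≤ G) (hρ : IsRegularMap G fun g => ρ g) :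
    ⨆ e, weightSpace hTG ρ e = ⊤ := by
  classical
  rw [eq_top_iff]
  intro v _
  let b := Module.finBasis ℂ V
  have hreg : ∀ i, IsRegularFun T fun t => b.repr (ρ (Subgroup.inclusion hTG t) v) i := by
    intro i
    obtain ⟨F, hF⟩ := hρ ((b.coord i) ∘ₗ LinearMap.applyₗ v)
    exact ⟨F, fun t => hF (Subgroup.inclusion hTG t)⟩
  have hc : ∀ i, ∃ c : AlgChar T →₀ ℂ, c.sum (fun e a => a • fun t : T => (e.1 t : ℂ)) =
      fun t => b.repr (ρ (Subgroup.inclusion hTG t) v) i := fun i =>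
    Finsupp.mem_span_range_iff_exists_finsupp.1 (hT.mem_span_char (hreg i))
  choose c hc using hc
  let s : Finset (AlgChar T) := Finset.univ.biUnion fun i => (c i).support
  let w : AlgChar T → V := fun e => ∑ i, c i e • b i
  have hw : ∀ t : T, ρ (Subgroup.inclusion hTG t) v = ∑ e ∈ s, (e.1 t : ℂ) • w e := by
    intro t
    rw [← b.sum_repr (ρ (Subgroup.inclusion hTG t) v)]
    simp only [w, Finset.smul_sum]
    rw [Finset.sum_comm]
    refine Finset.sum_congr rfl fun i _ => ?_
    have h : ∑ e ∈ s, c i e • (fun t : T => (e.1 t : ℂ)) =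
        fun t => b.repr (ρ (Subgroup.inclusion hTG t) v) i := by
      rw [← hc i]
      exact (Finsupp.sum_of_support_subset (c i) (s := s)
        (Finset.subset_biUnion_of_mem (fun i => (c i).support) (Finset.mem_univ i))
        (fun e a => a • fun t : T => (e.1 t : ℂ)) (fun _ _ => zero_smul ℂ _)).symm
    have h := congrFun h t
    rw [Finset.sum_apply] at h
    rw [← h, Finset.sum_smul]
    exact Finset.sum_congr rfl fun e _ => by rw [Pi.smul_apply, smul_smul, smul_eq_mul, mul_comm]
  -- compare coefficients of characters in `ρ (t' t) v = ρ t' (ρ t v)`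
  have hmem : ∀ e ∈ s, w e ∈ weightSpace hTG ρ e := by
    intro e he
    rw [mem_weightSpace]
    intro t'
    rw [← sub_eq_zero]
    refine eq_zero_of_sum_char_smul_eq_zero
      (v := fun e => ρ (Subgroup.inclusion hTG t') (w e) - (e.1 t' : ℂ) • w e) (fun t => ?_) he
    have h1 : ρ (Subgroup.inclusion hTG (t' * t)) v =
        ρ (Subgroup.inclusion hTG t') (ρ (Subgroup.inclusion hTG t) v) := by
      rw [map_mul, map_mul]; rfl
    rw [hw, hw, map_sum] at h1
    simp only [smul_sub, Finset.sum_sub_distrib]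
    rw [sub_eq_zero]
    simp only [map_smul] at h1
    rw [← h1]
    exact Finset.sum_congr rfl fun e _ => by rw [map_mul, Units.val_mul, mul_comm, mul_smul]
  have hv : v = ∑ e ∈ s, w e := by
    have := hw 1
    simpa using this
  rw [hv]
  exact Submodule.sum_mem _ fun e he => Submodule.mem_iSup_of_mem e (hmem e he)

theorem isInternal_weightSpace (hT : IsTorus T) (hTG : T ≤ G)
    (hρ : IsRegularMap G fun g => ρ g) [DecidableEq (AlgChar T)] :
    DirectSum.IsInternal (weightSpace hTG ρ) := by
  refine DirectSum.isInternal_submodule_of_iSupIndep_of_iSup_eq_top ?_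
    (iSup_weightSpace hT hTG hρ)
  rw [iSupIndep_iff_finsetSum_eq_zero_imp_eq_zero]
  intro s v hv hsum e he
  refine eq_zero_of_sum_char_smul_eq_zero (fun t => ?_) he
  have h := congrArg (ρ (Subgroup.inclusion hTG t)) hsum
  rw [map_sum, map_zero] at h
  rw [← h]
  exact Finset.sum_congr rfl fun e he => (hv e he t).symm

/-- The trace of an endomorphism acting by scalars on the weight spaces. -/
theorem trace_eq_weightSum (hT : IsTorus T) (hTG : T ≤ G) (hρ : IsRegularMap G fun g => ρ g)
    {A : Module.End ℂ V} {a : AlgChar T → ℂ}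
    (hA : ∀ e, ∀ v ∈ weightSpace hTG ρ e, A v = a e • v) :
    LinearMap.trace ℂ V A = weightSum hTG ρ a := by
  classical
  have hmaps : ∀ e, Set.MapsTo A (weightSpace hTG ρ e) (weightSpace hTG ρ e) := fun e v hv => by
    rw [hA e v hv]
    exact Submodule.smul_mem _ _ hv
  rw [LinearMap.trace_eq_sum_trace_restrict' (isInternal_weightSpace hT hTG hρ)
    (finite_weights hTG ρ) hmaps, weightSum, weights]
  refine Finset.sum_congr rfl fun e _ => ?_
  have h : A.restrict (hmaps e) = a e • LinearMap.id :=
    LinearMap.ext fun v => Subtype.ext (hA e v v.2)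
  rw [h, map_smul, LinearMap.trace_id, smul_eq_mul, nsmul_eq_mul, mul_comm]

/-- The Lie algebra of `T` acts on a weight space through the differential of the character. -/
theorem differential_apply_of_mem_weightSpace (hTG : T ≤ G) (hρ : IsRegularMap G fun g => ρ g)
    {e : AlgChar T} {v : V} (hv : v ∈ weightSpace hTG ρ e) (h : lieAlgebra T) :
    differential hρ ⟨h, lieAlgebra_mono hTG h.2⟩ v = e.weight h • v := by
  rw [dual_eq_iff]
  intro ψ
  obtain ⟨F, hF⟩ := hρ (ψ ∘ₗ LinearMap.applyₗ v)
  obtain ⟨E, hE⟩ := e.exists_poly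
  have h1 := apply_differential hρ (ψ ∘ₗ LinearMap.applyₗ v) ⟨h, lieAlgebra_mono hTG h.2⟩
  have h2 := apply_differential e.2 LinearMap.id h
  rw [diffFun_apply _ F hF] at h1
  rw [diffFun_apply _ E hE] at h2
  have h3 := h.2 (F - MvPolynomial.C (ψ v) * E) fun t ht => by
    have h4 := hF (Subgroup.inclusion hTG ⟨t, ht⟩)
    have h5 := hE ⟨t, ht⟩
    rw [map_sub, map_mul, evalAt_C, ← h5]
    refine sub_eq_zero.2 (h4.symm.trans ?_)
    change ψ (ρ (Subgroup.inclusion hTG ⟨t, ht⟩) v) = _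
    rw [hv, map_smul, smul_eq_mul, mul_comm]
  rw [map_sub, map_sub, leftInvariant_C_mul, map_mul, evalAt_C, ← h2, sub_eq_zero] at h3
  rw [map_smul, smul_eq_mul, mul_comm]
  exact h1.trans h3

end Weights

/-! ### The trace form -/

section TraceForm

variable {N n : ℕ} {G T : Subgroup (GL (Fin N) ℂ)} {V : Type*} [AddCommGroup V] [Module ℂ V]
  {ρ : Representation ℂ G V}

theorem endTraceForm_apply (A B : Module.End ℂ V) :
    endTraceForm V A B = LinearMap.trace ℂ V (A * B) := rfl

theorem endTraceForm_lie (A B C : Module.End ℂ V) :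
    endTraceForm V ⁅A, B⁆ C = endTraceForm V A ⁅B, C⁆ := by
  rw [endTraceForm_apply, endTraceForm_apply, LieRing.of_associative_ring_bracket,
    LieRing.of_associative_ring_bracket, sub_mul, mul_sub, map_sub, map_sub, mul_assoc, mul_assoc,
    LinearMap.trace_mul_comm ℂ B, mul_assoc]

variable [FiniteDimensional ℂ V]

/-- The action of the Lie algebra of `T` on `V`. -/
def torusDeriv (hTG : T ≤ G) (hρ : IsRegularMap G fun g => ρ g) :
    lieAlgebra T →ₗ[ℂ] Module.End ℂ V :=
  differential hρ ∘ₗ Submodule.inclusion (lieAlgebra_mono hTG)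

theorem torusDeriv_apply_of_mem_weightSpace (hTG : T ≤ G) (hρ : IsRegularMap G fun g => ρ g)
    {e : AlgChar T} {v : V} (hv : v ∈ weightSpace hTG ρ e) (h : lieAlgebra T) :
    torusDeriv hTG hρ h v = e.weight h • v :=
  differential_apply_of_mem_weightSpace hTG hρ hv h

/-- Endomorphisms are determined by their restrictions to the weight spaces. -/
theorem end_ext_weightSpace (hT : IsTorus T) (hTG : T ≤ G) (hρ : IsRegularMap G fun g => ρ g)
    {A B : Module.End ℂ V} (h : ∀ e, ∀ v ∈ weightSpace hTG ρ e, A v = B v) : A = B := by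
  have h1 : ⨆ e, weightSpace hTG ρ e ≤ LinearMap.eqLocus A B := iSup_le fun e v hv => h e v hv
  rw [iSup_weightSpace hT hTG hρ] at h1
  exact LinearMap.ext fun v => h1 trivial

theorem commute_torusDeriv (hT : IsTorus T) (hTG : T ≤ G) (hρ : IsRegularMap G fun g => ρ g)
    (h : lieAlgebra T) (t : T) :
    Commute (torusDeriv hTG hρ h) (ρ (Subgroup.inclusion hTG t)) :=
  end_ext_weightSpace hT hTG hρ fun e v hv => by
    rw [Module.End.mul_apply, Module.End.mul_apply, hv t, map_smul,
      torusDeriv_apply_of_mem_weightSpace hTG hρ hv, map_smul, hv t, smul_comm]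

theorem endTraceForm_torusDeriv (hT : IsTorus T) (hTG : T ≤ G)
    (hρ : IsRegularMap G fun g => ρ g) (h h' : lieAlgebra T) :
    endTraceForm V (torusDeriv hTG hρ h) (torusDeriv hTG hρ h') =
      weightSum hTG ρ fun e => e.weight h * e.weight h' := by
  refine trace_eq_weightSum hT hTG hρ fun e v hv => ?_
  change torusDeriv hTG hρ h (torusDeriv hTG hρ h' v) = _
  rw [torusDeriv_apply_of_mem_weightSpace hTG hρ hv, map_smul,
    torusDeriv_apply_of_mem_weightSpace hTG hρ hv, smul_smul, mul_comm]

theorem endTraceForm_torusDeriv_rep (hT : IsTorus T) (hTG : T ≤ G)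
    (hρ : IsRegularMap G fun g => ρ g) (h : lieAlgebra T) (t : T) :
    endTraceForm V (torusDeriv hTG hρ h) (ρ (Subgroup.inclusion hTG t)) =
      weightSum hTG ρ fun e => e.weight h * (e.1 t : ℂ) := by
  refine trace_eq_weightSum hT hTG hρ fun e v hv => ?_
  change torusDeriv hTG hρ h (ρ (Subgroup.inclusion hTG t) v) = _
  rw [hv t, map_smul, torusDeriv_apply_of_mem_weightSpace hTG hρ hv, smul_smul, mul_comm]

/-- If the weights are rational in some basis of the Lie algebra of `T`, the trace form is
positive definite on the rational form it spans, so it is nondegenerate. -/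
theorem eq_zero_of_endTraceForm_torusDeriv_eq_zero (hT : IsTorus T) (hTG : T ≤ G)
    (hρ : IsRegularMap G fun g => ρ g) (hinj : Function.Injective (differential hρ))
    (b : Module.Basis (Fin n) ℂ (lieAlgebra T))
    (hrat : ∀ e, weightSpace hTG ρ e ≠ ⊥ → ∀ i, ∃ q : ℚ, e.weight (b i) = q) {h : lieAlgebra T}
    (hh : ∀ i, endTraceForm V (torusDeriv hTG hρ (b i)) (torusDeriv hTG hρ h) = 0) : h = 0 := by
  -- the complex conjugate of `h` with respect to the rational form spanned by `b`
  let h' : lieAlgebra T := ∑ i, (starRingEnd ℂ) (b.repr h i) • b i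
  have hconj : ∀ e ∈ weights hTG ρ, e.weight h' = (starRingEnd ℂ) (e.weight h) := by
    intro e he
    have he' : weightSpace hTG ρ e ≠ ⊥ := (Set.Finite.mem_toFinset _).1 he
    conv_rhs => rw [← b.sum_repr h]
    simp only [h', map_sum, map_smul, smul_eq_mul, map_mul]
    refine Finset.sum_congr rfl fun i _ => ?_
    obtain ⟨q, hq⟩ := hrat e he' i
    rw [hq, map_ratCast]
  have h0 : endTraceForm V (torusDeriv hTG hρ h') (torusDeriv hTG hρ h) = 0 := by
    simp only [h', map_sum, map_smul, LinearMap.sum_apply, LinearMap.smul_apply, hh, smul_zero,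
      Finset.sum_const_zero]
  have h1 : ∑ e ∈ weights hTG ρ,
      (Module.finrank ℂ (weightSpace hTG ρ e) : ℝ) * Complex.normSq (e.weight h) = 0 := by
    rw [endTraceForm_torusDeriv hT, weightSum] at h0
    have h2 : ((∑ e ∈ weights hTG ρ, (Module.finrank ℂ (weightSpace hTG ρ e) : ℝ) *
        Complex.normSq (e.weight h) : ℝ) : ℂ) = 0 := by
      rw [← h0, Complex.ofReal_sum]
      refine Finset.sum_congr rfl fun e he => ?_
      rw [hconj e he, ← Complex.normSq_eq_conj_mul_self, nsmul_eq_mul, Complex.ofReal_mul,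
        Complex.ofReal_natCast]
    exact_mod_cast h2
  have h2 : ∀ e ∈ weights hTG ρ, e.weight h = 0 := by
    intro e he
    have h3 := (Finset.sum_eq_zero_iff_of_nonneg fun e _ =>
      mul_nonneg (Nat.cast_nonneg _) (Complex.normSq_nonneg _)).1 h1 e he
    have he' : weightSpace hTG ρ e ≠ ⊥ := (Set.Finite.mem_toFinset _).1 he
    rcases mul_eq_zero.1 h3 with h4 | h4
    · exact absurd (Submodule.finrank_eq_zero.1 (Nat.cast_eq_zero.1 h4)) he'
    · exact Complex.normSq_eq_zero.1 h4
  have h3 : torusDeriv hTG hρ h = 0 := by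
    refine end_ext_weightSpace hT hTG hρ fun e v hv => ?_
    rw [torusDeriv_apply_of_mem_weightSpace hTG hρ hv, LinearMap.zero_apply]
    by_cases he : weightSpace hTG ρ e = ⊥
    · rw [he, Submodule.mem_bot] at hv
      rw [hv, smul_zero]
    · rw [h2 e ((Set.Finite.mem_toFinset _).2 he), zero_smul]
  have h4 := hinj (h3.trans (map_zero (differential hρ)).symm)
  exact Submodule.inclusion_injective _ (h4.trans (map_zero _).symm)

/-- Weights take rational values on coroots. -/
theorem exists_rat_weight_apply_of_isCoroot [LieAlgebra.IsKilling ℂ (lieAlgebra G)]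
    (hG : IsZariskiClosed (G : Set (GL (Fin N) ℂ))) (hT : IsMaximalTorus G T)
    (hρ : IsRegularMap G fun g => ρ g) {α : Module.Dual ℂ (lieAlgebra T)} (hα : IsRoot G T α)
    {h : lieAlgebra T} (hh : IsCoroot G T α h) {e : AlgChar T}
    (he : weightSpace hT.prop.1 ρ e ≠ ⊥) : ∃ q : ℚ, e.weight h = q := by
  have _ := isCartanSubalgebra_centralizerTorus hG hT
  let _ : LieRingModule (lieAlgebra G) V := LieRingModule.compLieHom V (derivRep hρ)
  have _ : LieModule ℂ (lieAlgebra G) V := LieModule.compLieHom V (derivRep hρ)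
  obtain ⟨w, hw0, hw⟩ := exists_weight_of_isRoot hG hT hα
  have hχ : LieModule.genWeightSpace V (fun x => e.weight ((torusEquiv hG hT).symm x)) ≠ ⊥ := by
    obtain ⟨v, hv, hv0⟩ := Submodule.exists_mem_ne_zero_of_ne_bot he
    intro h0
    refine hv0 ((LieSubmodule.mem_bot v).1 (h0.le ((LieModule.mem_genWeightSpace V _ v).2
      fun x => ⟨1, ?_⟩)))
    obtain ⟨k, rfl⟩ := (torusEquiv hG hT).surjective x
    rw [pow_one, LinearEquiv.symm_apply_apply]
    exact sub_eq_zero.2 (differential_apply_of_mem_weightSpace hT.prop.1 hρ hv k)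
  obtain ⟨q, hq⟩ := exists_rat_apply_coroot (centralizerTorus G T) hw0 hχ
  rw [← (isCoroot_iff hG hT hw0 hw h).1 hh, LinearEquiv.symm_apply_apply] at hq
  exact ⟨q, hq⟩

/-- The trace form of `V` is nondegenerate on the Lie algebra: its kernel is an ideal, and this
ideal meets the Lie algebra of `T` trivially. -/
theorem eq_zero_of_endTraceForm_differential_eq_zero [LieAlgebra.IsKilling ℂ (lieAlgebra G)]
    (hG : IsZariskiClosed (G : Set (GL (Fin N) ℂ))) (hT : IsMaximalTorus G T)
    (hρ : IsRegularMap G fun g => ρ g) (hinj : Function.Injective (differential hρ))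
    (b : Module.Basis (Fin n) ℂ (lieAlgebra T))
    (hrat : ∀ e, weightSpace hT.prop.1 ρ e ≠ ⊥ → ∀ i, ∃ q : ℚ, e.weight (b i) = q)
    {X : lieAlgebra G}
    (hX : ∀ Y, endTraceForm V (differential hρ Y) (differential hρ X) = 0) : X = 0 := by
  have _ := isCartanSubalgebra_centralizerTorus hG hT
  let _ : LieRingModule (lieAlgebra G) V := LieRingModule.compLieHom V (derivRep hρ)
  have _ : LieModule ℂ (lieAlgebra G) V := LieModule.compLieHom V (derivRep hρ)
  have hform : ∀ Y X, LieModule.traceForm ℂ (lieAlgebra G) V Y X =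
      endTraceForm V (differential hρ Y) (differential hρ X) := fun _ _ => rfl
  let I : LieIdeal ℂ (lieAlgebra G) := LieAlgebra.InvariantForm.orthogonal
    (LieModule.traceForm ℂ (lieAlgebra G) V) (LieModule.traceForm_lieInvariant ℂ (lieAlgebra G) V) ⊤
  have hI : ∀ X, X ∈ I ↔ ∀ Y, endTraceForm V (differential hρ Y) (differential hρ X) = 0 := by
    intro X
    simp only [I, LieAlgebra.InvariantForm.mem_orthogonal, LieSubmodule.mem_top, true_imp_iff,
      hform]
  have hbot := lieIdeal_eq_bot_of_disjoint_cartan (centralizerTorus G T) I fun X hX hXT => by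
    have h1 : (⟨X, (mem_centralizerTorus_iff hG hT).1 hXT⟩ : lieAlgebra T) = 0 :=
      eq_zero_of_endTraceForm_torusDeriv_eq_zero hT.prop.2 hT.prop.1 hρ hinj b hrat
        fun i => (hI X).1 hX _
    exact Subtype.ext (congrArg (fun k : lieAlgebra T => (k : Matrix (Fin N) (Fin N) ℂ)) h1)
  exact (LieSubmodule.mem_bot X).1 (hbot.le ((hI X).2 hX))

end TraceForm

/-! ### The Springer morphism -/

section Springer

variable {N : ℕ} {G T : Subgroup (GL (Fin N) ℂ)} {V : Type*} [AddCommGroup V] [Module ℂ V]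
  [FiniteDimensional ℂ V] {ρ : Representation ℂ G V}

theorem isCompl_imageLie_perpLie (hρ : IsRegularMap G fun g => ρ g)
    (hnd : ∀ X, (∀ Y, endTraceForm V (differential hρ Y) (differential hρ X) = 0) → X = 0) :
    IsCompl (imageLie hρ) (perpLie hρ) := by
  have hrefl : (endTraceForm V).IsRefl := fun A B h => by
    rw [endTraceForm_apply, LinearMap.trace_mul_comm]
    exact h
  refine (LinearMap.BilinForm.isCompl_orthogonal_iff_disjoint hrefl).2 ?_
  rw [Submodule.disjoint_def]
  rintro _ ⟨X, rfl⟩ hX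
  rw [hnd X fun Y => hX _ ⟨Y, rfl⟩, map_zero]

/-- The Springer morphism is determined by its pairing with `𝔤`. -/
theorem endTraceForm_differential_springer {hρ : IsRegularMap G fun g => ρ g}
    (hinj : Function.Injective (differential hρ)) (hcompl : IsCompl (imageLie hρ) (perpLie hρ))
    (g : G) (Y : lieAlgebra G) :
    endTraceForm V (differential hρ Y) (differential hρ (springer hρ hinj hcompl g)) =
      endTraceForm V (differential hρ Y) (ρ g) := by
  have h1 : ρ g - differential hρ (springer hρ hinj hcompl g) ∈ perpLie hρ := by
    rw [← LinearMap.ker_linearProjOfIsCompl (perpLie hρ) (differential hρ) hinj hcompl,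
      LinearMap.mem_ker, map_sub]
    exact sub_eq_zero.2 (LinearMap.linearProjOfIsCompl_apply_left _ _ hinj hcompl _).symm
  have h2 : endTraceForm V (differential hρ Y)
      (ρ g - differential hρ (springer hρ hinj hcompl g)) = 0 := h1 _ ⟨Y, rfl⟩
  rw [map_sub, sub_eq_zero] at h2
  exact h2.symm

/-- The Springer morphism maps a torus into the centralizer of its Lie algebra. -/
theorem springer_mem_centralizerTorus (hT : IsTorus T) (hTG : T ≤ G)
    {hρ : IsRegularMap G fun g => ρ g}
    (hnd : ∀ X, (∀ Y, endTraceForm V (differential hρ Y) (differential hρ X) = 0) → X = 0)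
    (hinj : Function.Injective (differential hρ)) (hcompl : IsCompl (imageLie hρ) (perpLie hρ))
    (t : T) :
    springer hρ hinj hcompl (Subgroup.inclusion hTG t) ∈ centralizerTorus G T := by
  rw [mem_centralizerTorus]
  intro h hh
  set g := Subgroup.inclusion hTG t
  set θ := springer hρ hinj hcompl g
  let H : lieAlgebra G := ⟨h, lieAlgebra_mono hTG hh⟩
  have hcomm : differential hρ H * ρ g = ρ g * differential hρ H :=
    commute_torusDeriv hT hTG hρ ⟨h, hh⟩ t
  have h0 : ⁅H, θ⁆ = 0 := by
    refine hnd _ fun Y => ?_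
    rw [differential_lie, ← endTraceForm_lie, ← differential_lie,
      endTraceForm_differential_springer, differential_lie, endTraceForm_lie,
      LieRing.of_associative_ring_bracket, hcomm, sub_self, map_zero]
  have h1 := congrArg Subtype.val h0
  rw [LieSubalgebra.coe_bracket, LieRing.of_associative_ring_bracket] at h1
  exact sub_eq_zero.1 h1

end Springer

end LinAlgGroup

end

theorem theorem1p1 {N n : ℕ} (G T : Subgroup (GL (Fin N) ℂ))
    (hG : LinAlgGroup.IsSemisimple G) (hT : LinAlgGroup.IsMaximalTorus G T)
    (α : Fin n → Module.Dual ℂ (LinAlgGroup.lieAlgebra T)) (hα : LinAlgGroup.IsBase G T α)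
    {V : Type*} [AddCommGroup V] [Module ℂ V] [FiniteDimensional ℂ V]
    (ρ : Representation ℂ G V) (hρ : LinAlgGroup.IsRegularMap G fun g => ρ g)
    (hirr : ρ.IsIrreducible) (hker : (MonoidHom.ker ρ : Set G).Finite) :
    -- the simple coroots form a basis of `𝔱`
    ∃ coroot : Module.Basis (Fin n) ℂ (LinAlgGroup.lieAlgebra T),
      (∀ i h, LinAlgGroup.IsCoroot G T (α i) h ↔ h = coroot i) ∧
      -- `𝔤` embeds in `End V`, and `End V = 𝔤 ⊕ 𝔤^⊥`
      ∃ (hinj : Function.Injective (LinAlgGroup.differential hρ))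
        (hcompl : IsCompl (LinAlgGroup.imageLie hρ) (LinAlgGroup.perpLie hρ)),
        ∀ t : T,
          -- `θ(t) = ∑ i, c_i(t) α̌_i` lies in `𝔱`, with coefficient vector `c(t)`
          ∃ c : Fin n → ℂ,
            (LinAlgGroup.springer hρ hinj hcompl (Subgroup.inclusion hT.prop.1 t) :
                Matrix (Fin N) (Fin N) ℂ) =
              ∑ i, c i • (coroot i : Matrix (Fin N) (Fin N) ℂ) ∧
            -- and `c(t)` is the unique solution of the linear system with matrix `S(G, λ)`
            ∀ x : Fin n → ℂ,
              (fun i => LinAlgGroup.weightSum hT.prop.1 ρ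
                  fun μ => μ.coord coroot i * (μ.1 t : ℂ)) =
                Matrix.of (fun i j => LinAlgGroup.weightSum hT.prop.1 ρ
                  fun μ => μ.coord coroot i * μ.coord coroot j) *ᵥ x ↔ x = c := by
  open LinAlgGroup in
  have _ := isKilling_lieAlgebra hG hρ hirr hker
  have _ := isCartanSubalgebra_centralizerTorus hG.closed hT
  have hinj := injective_differential hG.closed hρ hker
  obtain ⟨b, hb⟩ := exists_basis_coroot hG.closed hT hα
  have hrat : ∀ e, weightSpace hT.prop.1 ρ e ≠ ⊥ → ∀ i, ∃ q : ℚ, e.weight (b i) = q :=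
    fun e he i => exists_rat_weight_apply_of_isCoroot hG.closed hT hρ (hα.isRoot i)
      ((hb i _).2 rfl) he
  have hnd : ∀ X, (∀ Y, endTraceForm V (differential hρ Y) (differential hρ X) = 0) → X = 0 :=
    fun X hX => eq_zero_of_endTraceForm_differential_eq_zero hG.closed hT hρ hinj b hrat hX
  have hcompl := isCompl_imageLie_perpLie hρ hnd
  refine ⟨b, hb, hinj, hcompl, fun t => ?_⟩
  let θ : lieAlgebra T := ⟨springer hρ hinj hcompl (Subgroup.inclusion hT.prop.1 t),
    (mem_centralizerTorus_iff hG.closed hT).1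
      (springer_mem_centralizerTorus hT.prop.2 hT.prop.1 hnd hinj hcompl t)⟩
  have hcoord : ∀ (μ : AlgChar T) i, μ.coord b i = μ.weight (b i) := fun μ i => by
    rw [AlgChar.coord, Module.Basis.dualBasis_repr]
  refine ⟨fun i => b.repr θ i, ?_, fun x => ?_⟩
  · have h := congrArg (lieAlgebra T).subtype (b.sum_repr θ)
    rw [map_sum] at h
    exact h.symm
  let hx : lieAlgebra T := ∑ j, x j • b j
  have hleft : ∀ i, weightSum hT.prop.1 ρ (fun μ => μ.coord b i * (μ.1 t : ℂ)) =
      endTraceForm V (torusDeriv hT.prop.1 hρ (b i)) (torusDeriv hT.prop.1 hρ θ) := fun i => by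
    simp only [hcoord]
    rw [← endTraceForm_torusDeriv_rep hT.prop.2 hT.prop.1 hρ]
    exact (endTraceForm_differential_springer hinj hcompl _ _).symm
  have hright : ∀ i, (Matrix.of (fun i j => weightSum hT.prop.1 ρ
      fun μ => μ.coord b i * μ.coord b j) *ᵥ x) i =
      endTraceForm V (torusDeriv hT.prop.1 hρ (b i)) (torusDeriv hT.prop.1 hρ hx) := fun i => by
    simp only [hcoord, hx, map_sum, map_smul, Matrix.mulVec, dotProduct, Matrix.of_apply]
    refine Finset.sum_congr rfl fun j _ => ?_
    rw [← endTraceForm_torusDeriv hT.prop.2 hT.prop.1 hρ, smul_eq_mul, mul_comm]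
  constructor
  · intro h
    have h0 : θ - hx = 0 := eq_zero_of_endTraceForm_torusDeriv_eq_zero hT.prop.2 hT.prop.1 hρ hinj
      b hrat fun i => by
        rw [map_sub, map_sub, ← hleft, ← hright]
        exact sub_eq_zero.2 (congrFun h i)
    ext i
    rw [sub_eq_zero.1 h0, b.repr_sum_self]
  · rintro rfl
    ext i
    rw [hright, hleft]
    simp only [hx, b.sum_repr]
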